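/- Let $k=\mathbb R$ or $\mathbb C$. A (non-negatively) graded manifold is a smooth finite-dimensional manifold (its body; Hausdorff, second countable, without boundary) with a sheaf of $\mathbb N$-graded commutative $k$-algebras that is locally freely generated over the smooth $k$-valued functions by finitely many coordinates of positive degree; parity is the degree mod $2$, and morphisms are morphisms of ringed spaces that preserve the degree. An NQ-manifold $(\mathcal M,Q)$ is a graded manifold $\mathcal M$ with a derivation $Q$ of degree $1$ of its functions $C^\infty(\mathcal M)=(C^\infty(\mathcal M)_n)_{n\ge0}$ such that $Q^2=0$; morphisms of NQ-manifolds intertwine the derivations. Let $T[1][0,1]$ have the coordinates $t$ (degree $0$) and $\theta$ (degree $1$), with $D=\theta\,\partial_t$. For NQ-manifolds $\mathcal L$ and $\mathcal M$, a super-curve in $\mathcal M$ parametrised by $\mathcal L$ is a morphism $\varphi:(T[1][0,1]\times\mathcal L,\,D+Q_{\mathcal L})\to(\mathcal M,Q)$, i.e. a degree-preserving homomorphism of algebras $f\mapsto\varphi^*f=\varphi_0f+\theta\,\varphi_1f$ (covering a smooth map $[0,1]\times|\mathcal L|\to|\mathcal M|$) with $\varphi^*Qf=(D+Q_{\mathcal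 L})\varphi^*f$. The space $\bar{\mathcal S}$ of super-curves in $\mathcal M$ is the space that represents the presheaf $\mathcal L\mapsto\mathrm{Hom}_{NQ}(T[1][0,1]\times\mathcal L,\mathcal M)$ on NQ-manifolds. Accordingly an element $\omega\in C^\infty(\bar{\mathcal S})_n$ is a rule that assigns to each NQ-manifold $\mathcal L$ and each super-curve $\varphi$ parametrised by $\mathcal L$ a function $\omega(\varphi)\in C^\infty(\mathcal L)_n$, naturally in $\mathcal L$; the differential is $(\delta_B\omega)(\varphi)=Q_{\mathcal L}(\omega(\varphi))$. Then for every NQ-manifold $(\mathcal M,Q)$ and every $n\ge 0$ $$H^n_{\delta_B}(\bar{\mathcal S})\cong H^n_Q(\mathcal M)$$ as $k$-vector spaces. The isomorphism $H^n_Q(\mathcal M)\to H^n_{\delta_B}(\bar{\mathcal S})$ is induced by the map $\bar{\mathcal S}\to\mathcal M$ that sends a super-curve to its initial point ($t=0$, $\theta=0$): $[f]\mapsto[\varphi\mapsto \varphi_0f|_{t=0}]$. Its inverse is induced by the inclusion $\mathcal M\to\bar{\mathcal S}$ of the constant super-curves: $[\omega]\mapsto[\omega(\mathrm{pr})]$,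 where $\mathrm{pr}:T[1][0,1]\times\mathcal M\to\mathcal M$ is the projection. -/

import Mathlib

open Set Filter Topology Manifold
open scoped ContDiff

universe u v w

noncomputable section

/-! ### Cohomology of a cochain complex graded by `ℕ` -/

section Cohomology

variable {k : Type v} [Ring k] {C : ℕ → Type w} [∀ n, AddCommGroup (C n)] [∀ n, Module k (C n)]

/-- Coboundaries in degree `n`; in degree `0` there are none but `0`. -/
def coboundaries (d : ∀ n, C n →ₗ[k] C (n + 1)) : ∀ n, Submodule k (C n)
  | 0 => ⊥
  | n + 1 => LinearMap.range (d n)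

/-- The `n`-th cohomology `ker d / im d`. -/
abbrev Cohomology (d : ∀ n, C n →ₗ[k] C (n + 1)) (n : ℕ) : Type w :=
  LinearMap.ker (d n) ⧸ (coboundaries d n).submoduleOf (LinearMap.ker (d n))

/-- The cohomology class of a cocycle. -/
def cohomologyClass (d : ∀ n, C n →ₗ[k] C (n + 1)) {n : ℕ} (z : C n) (hz : d n z = 0) :
    Cohomology d n :=
  Submodule.Quotient.mk ⟨z, hz⟩

end Cohomology

/-! ### Non-negatively graded manifolds -/

/-- A system of graded local coordinates on a bundle `F` of graded algebras over `B`: over an open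
set `dom`, finitely many homogeneous sections `coord j` of positive degrees `wt j` that freely
generate each fibre as a graded-commutative algebra, i.e. the ordered monomials in them (with
exponents at most `1` on the generators of odd degree) form a basis of the fibre.
Values of `coord j` outside `dom` are irrelevant. -/
structure GradedCoords (k : Type v) [RCLike k] {B : Type u} [TopologicalSpace B] {F : B → Type u}
    [∀ x, Ring (F x)] [∀ x, Algebra k (F x)] (deg : ∀ x, ℕ → Submodule k (F x)) where
  dom : Set B
  isOpen_dom : IsOpen dom
  rank : ℕ
  wt : Fin rank → ℕ
  wt_pos : ∀ j, 0 < wt j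
  coord : Fin rank → ∀ x, F x
  coord_mem : ∀ x ∈ dom, ∀ j, coord j x ∈ deg x (wt j)
  linearIndependent : ∀ x ∈ dom, LinearIndependent k
    (fun a : {a : Fin rank → ℕ // ∀ j, Odd (wt j) → a j ≤ 1} =>
      (List.ofFn fun j => coord j x ^ a.1 j).prod)
  span_eq_top : ∀ x ∈ dom, Submodule.span k
    (range (fun a : {a : Fin rank → ℕ // ∀ j, Odd (wt j) → a j ≤ 1} =>
      (List.ofFn fun j => coord j x ^ a.1 j).prod)) = ⊤

namespace GradedCoords

variable {k : Type v} [RCLike k] {B : Type u} [TopologicalSpace B] {F : B → Type u}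
  [∀ x, Ring (F x)] [∀ x, Algebra k (F x)] {deg : ∀ x, ℕ → Submodule k (F x)}

/-- Polynomials in the coordinates with smooth `k`-valued functions on the body as coefficients. -/
def polys (E : Type u) [NormedAddCommGroup E] [NormedSpace ℝ E] [ChartedSpace E B]
    (c : GradedCoords k deg) : Subalgebra k (∀ x, F x) :=
  Algebra.adjoin k
    ({s | ∃ a : B → k, ContMDiff 𝓘(ℝ, E) 𝓘(ℝ, k) ∞ a ∧ s = fun x => algebraMap k (F x) (a x)} ∪
      range c.coord)

/-- Polynomials in the coordinates with smooth `k`-valued functions on `[0,1] × B`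
as coefficients. -/
def famPolys (E : Type u) [NormedAddCommGroup E] [NormedSpace ℝ E] [ChartedSpace E B]
    (c : GradedCoords k deg) : Subalgebra k (unitInterval → ∀ x, F x) :=
  Algebra.adjoin k
    ({s | ∃ a : unitInterval × B → k, ContMDiff ((𝓡∂ 1).prod 𝓘(ℝ, E)) 𝓘(ℝ, k) ∞ a ∧
        s = fun t x => algebraMap k (F x) (a (t, x))} ∪
      range fun j => fun _ : unitInterval => c.coord j)

end GradedCoords

/-- A non-negatively graded manifold over `k` (`ℝ` or `ℂ`): a smooth finite-dimensional manifold
`body` together with a structure sheaf which is, locally, freely generated as a graded-commutative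
algebra over the sheaf of smooth `k`-valued functions by finitely many coordinates of positive
degree. As all generators have positive degree, the functions of degree `0` are the smooth
functions on the body and the structure sheaf is the sheaf of smooth sections of a bundle of graded
algebras `fiber`; the smooth structure of this bundle is given by an atlas of graded coordinate
systems whose changes of coordinates are polynomial with smooth coefficients. Parity is the
degree mod `2`. -/
structure NManifold (k : Type v) [RCLike k] where
  E : Type u
  [instNormed : NormedAddCommGroup E]
  [instNormedSpace : NormedSpace ℝ E]
  [instFiniteDimensional : FiniteDimensional ℝ E]
  body : Type u
  [instTop : TopologicalSpace body]
  [instCharted : ChartedSpace E body]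
  [instManifold : IsManifold 𝓘(ℝ, E) ∞ body]
  [instT2 : T2Space body]
  [instSecondCountable : SecondCountableTopology body]
  fiber : body → Type u
  [instRing : ∀ x, Ring (fiber x)]
  [instAlgebra : ∀ x, Algebra k (fiber x)]
  deg : ∀ x, ℕ → Submodule k (fiber x)
  [instGraded : ∀ x, SetLike.GradedMonoid (deg x)]
  deg_internal : ∀ x, DirectSum.IsInternal (deg x)
  graded_comm : ∀ x n m, ∀ a ∈ deg x n, ∀ b ∈ deg x m, a * b = (-1) ^ (n * m) * (b * a)
  atlas : Set (GradedCoords k deg)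
  atlas_cover : ∀ x, ∃ c ∈ atlas, x ∈ c.dom
  atlas_compat : ∀ c ∈ atlas, ∀ c' ∈ atlas, ∀ x ∈ c.dom ∩ c'.dom, ∀ j,
    ∃ p ∈ c.polys E, ∀ᶠ y in 𝓝 x, c'.coord j y = p y

attribute [instance] NManifold.instNormed NManifold.instNormedSpace
  NManifold.instFiniteDimensional NManifold.instTop NManifold.instCharted NManifold.instManifold
  NManifold.instT2 NManifold.instSecondCountable NManifold.instRing NManifold.instAlgebra
  NManifold.instGraded

namespace NManifold

variable {k : Type v} [RCLike k]

/-- A section is smooth at `x` if near `x` it is a polynomial in the graded coordinates with smooth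
coefficients. -/
def SmoothAt (L : NManifold.{u} k) (s : ∀ x, L.fiber x) (x : L.body) : Prop :=
  ∀ c ∈ L.atlas, x ∈ c.dom → ∃ p ∈ c.polys L.E, ∀ᶠ y in 𝓝 x, s y = p y

/-- The same for a function on `[0,1] × L`, written as a family of sections over `[0,1]`. -/
def FamSmoothAt (L : NManifold.{u} k) (s : unitInterval → ∀ x, L.fiber x) (t : unitInterval)
    (x : L.body) : Prop :=
  ∀ c ∈ L.atlas, x ∈ c.dom → ∃ p ∈ c.famPolys L.E, ∀ᶠ q in 𝓝 (t, x), s q.1 q.2 = p q.1 q.2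

variable {L : NManifold.{u} k}

theorem SmoothAt.add {s s' : ∀ x, L.fiber x} {x : L.body} (h : L.SmoothAt s x)
    (h' : L.SmoothAt s' x) : L.SmoothAt (s + s') x := by
  intro c hc hx
  obtain ⟨p, hp, e⟩ := h c hc hx
  obtain ⟨p', hp', e'⟩ := h' c hc hx
  refine ⟨p + p', add_mem hp hp', ?_⟩
  filter_upwards [e, e'] with y h1 h2
  simp [h1, h2]

theorem SmoothAt.mul {s s' : ∀ x, L.fiber x} {x : L.body} (h : L.SmoothAt s x)
    (h' : L.SmoothAt s' x) : L.SmoothAt (s * s') x := by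
  intro c hc hx
  obtain ⟨p, hp, e⟩ := h c hc hx
  obtain ⟨p', hp', e'⟩ := h' c hc hx
  refine ⟨p * p', mul_mem hp hp', ?_⟩
  filter_upwards [e, e'] with y h1 h2
  simp [h1, h2]

theorem SmoothAt.smul {s : ∀ x, L.fiber x} {x : L.body} (r : k) (h : L.SmoothAt s x) :
    L.SmoothAt (r • s) x := by
  intro c hc hx
  obtain ⟨p, hp, e⟩ := h c hc hx
  refine ⟨r • p, Subalgebra.smul_mem _ hp r, ?_⟩
  filter_upwards [e] with y h1
  simp [h1]

theorem smoothAt_zero (x : L.body) : L.SmoothAt 0 x :=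
  fun _ _ _ => ⟨0, zero_mem _, Eventually.of_forall fun _ => rfl⟩

theorem FamSmoothAt.add {s s' : unitInterval → ∀ x, L.fiber x} {t : unitInterval} {x : L.body}
    (h : L.FamSmoothAt s t x) (h' : L.FamSmoothAt s' t x) : L.FamSmoothAt (s + s') t x := by
  intro c hc hx
  obtain ⟨p, hp, e⟩ := h c hc hx
  obtain ⟨p', hp', e'⟩ := h' c hc hx
  refine ⟨p + p', add_mem hp hp', ?_⟩
  filter_upwards [e, e'] with y h1 h2
  simp [h1, h2]

theorem FamSmoothAt.mul {s s' : unitInterval → ∀ x, L.fiber x} {t : unitInterval} {x : L.body}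
    (h : L.FamSmoothAt s t x) (h' : L.FamSmoothAt s' t x) : L.FamSmoothAt (s * s') t x := by
  intro c hc hx
  obtain ⟨p, hp, e⟩ := h c hc hx
  obtain ⟨p', hp', e'⟩ := h' c hc hx
  refine ⟨p * p', mul_mem hp hp', ?_⟩
  filter_upwards [e, e'] with y h1 h2
  simp [h1, h2]

theorem famSmoothAt_scalar {a : unitInterval × L.body → k}
    (ha : ContMDiff ((𝓡∂ 1).prod 𝓘(ℝ, L.E)) 𝓘(ℝ, k) ∞ a) (t : unitInterval) (x : L.body) :
    L.FamSmoothAt (fun t x => algebraMap k (L.fiber x) (a (t, x))) t x :=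
  fun _ _ _ => ⟨_, Algebra.subset_adjoin (Or.inl ⟨a, ha, rfl⟩), Eventually.of_forall fun _ => rfl⟩

theorem FamSmoothAt.slice {s : unitInterval → ∀ x, L.fiber x} {t : unitInterval} {x : L.body}
    (h : L.FamSmoothAt s t x) : L.SmoothAt (s t) x := by
  intro c hc hx
  obtain ⟨p, hp, e⟩ := h c hc hx
  refine ⟨p t, ?_, ?_⟩
  · clear e
    unfold GradedCoords.famPolys at hp
    induction hp using Algebra.adjoin_induction with
    | mem q hq =>
      rcases hq with ⟨a, ha, rfl⟩ | ⟨j, rfl⟩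
      · refine Algebra.subset_adjoin (Or.inl ⟨fun x => a (t, x), ?_, rfl⟩)
        exact ha.comp (contMDiff_const.prodMk contMDiff_id)
      · exact Algebra.subset_adjoin (Or.inr ⟨j, rfl⟩)
    | algebraMap r => exact Subalgebra.algebraMap_mem _ r
    | add q q' _ _ h1 h2 => exact add_mem h1 h2
    | mul q q' _ _ h1 h2 => exact mul_mem h1 h2
  · exact (Continuous.prodMk_right t).continuousAt.eventually e

theorem SmoothAt.const {s : ∀ x, L.fiber x} {x : L.body} (h : L.SmoothAt s x) (t : unitInterval) :
    L.FamSmoothAt (fun _ => s) t x := by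
  intro c hc hx
  obtain ⟨p, hp, e⟩ := h c hc hx
  refine ⟨fun _ => p, ?_, ?_⟩
  · clear e
    unfold GradedCoords.polys at hp
    induction hp using Algebra.adjoin_induction with
    | mem q hq =>
      rcases hq with ⟨a, ha, rfl⟩ | ⟨j, rfl⟩
      · exact Algebra.subset_adjoin (Or.inl ⟨fun q => a q.2, ha.comp contMDiff_snd, rfl⟩)
      · exact Algebra.subset_adjoin (Or.inr ⟨j, rfl⟩)
    | algebraMap r => exact Subalgebra.algebraMap_mem _ r
    | add q q' _ _ h1 h2 => exact add_mem h1 h2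
    | mul q q' _ _ h1 h2 => exact mul_mem h1 h2
  · exact (continuous_snd.continuousAt (x := (t, x))).eventually e

theorem smoothAt_coord {c : GradedCoords k L.deg} (hc : c ∈ L.atlas) {x : L.body} (hx : x ∈ c.dom)
    (j : Fin c.rank) : L.SmoothAt (c.coord j) x :=
  fun c' hc' hx' => L.atlas_compat c' hc' c hc x ⟨hx', hx⟩ j

variable (L) in
/-- The space `C^∞(L)_n` of functions of degree `n`: the smooth global sections of degree `n`. -/
def fn (n : ℕ) : Submodule k (∀ x, L.fiber x) where
  carrier := {s | (∀ x, s x ∈ L.deg x n) ∧ ∀ x, L.SmoothAt s x}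
  zero_mem' := ⟨fun _ => zero_mem _, smoothAt_zero⟩
  add_mem' h h' := ⟨fun x => add_mem (h.1 x) (h'.1 x), fun x => (h.2 x).add (h'.2 x)⟩
  smul_mem' r _ h := ⟨fun x => Submodule.smul_mem _ r (h.1 x), fun x => (h.2 x).smul r⟩

/-- The product of functions. -/
def fnMul {n m : ℕ} (f : L.fn n) (g : L.fn m) : L.fn (n + m) :=
  ⟨f.1 * g.1, fun x => SetLike.GradedMul.mul_mem (f.2.1 x) (g.2.1 x),
    fun x => (f.2.2 x).mul (g.2.2 x)⟩

/-- A morphism of graded manifolds `L → M`, as a morphism of ringed spaces: a smooth map of bodies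
and a pull-back of sections by degree-preserving algebra homomorphisms which takes
(germs of) smooth sections to smooth sections. -/
structure Hom (L M : NManifold.{u} k) where
  base : L.body → M.body
  base_smooth : ContMDiff 𝓘(ℝ, L.E) 𝓘(ℝ, M.E) ∞ base
  pull : ∀ x, M.fiber (base x) →ₐ[k] L.fiber x
  pull_mem : ∀ x n, ∀ a ∈ M.deg (base x) n, pull x a ∈ L.deg x n
  smooth : ∀ (s : ∀ y, M.fiber y) (x : L.body), M.SmoothAt s (base x) →
    L.SmoothAt (fun y => pull y (s (base y))) x

/-- The pull-back of functions along a morphism. -/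
def Hom.map {L M : NManifold.{u} k} (g : Hom L M) (n : ℕ) : M.fn n →ₗ[k] L.fn n where
  toFun f := ⟨fun x => g.pull x (f.1 (g.base x)), fun x => g.pull_mem x n _ (f.2.1 _),
    fun x => g.smooth _ x (f.2.2 _)⟩
  map_add' f f' := by ext x; simp
  map_smul' r f := by ext x; simp

theorem FamSmoothAt.pull {L M : NManifold.{u} k} (g : Hom L M)
    {s : unitInterval → ∀ y, M.fiber y} {t : unitInterval} {x : L.body}
    (h : M.FamSmoothAt s t (g.base x)) :
    L.FamSmoothAt (fun τ y => g.pull y (s τ (g.base y))) t x := by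
  obtain ⟨c, hc, hx⟩ := M.atlas_cover (g.base x)
  obtain ⟨p, hp, e⟩ := h c hc hx
  have key : L.FamSmoothAt (fun τ y => g.pull y (p τ (g.base y))) t x := by
    clear e
    unfold GradedCoords.famPolys at hp
    induction hp using Algebra.adjoin_induction with
    | mem q hq =>
      rcases hq with ⟨a, ha, rfl⟩ | ⟨j, rfl⟩
      · simp only [AlgHom.commutes]
        exact famSmoothAt_scalar (a := fun q => a (q.1, g.base q.2))
          (ha.comp (contMDiff_fst.prodMk (g.base_smooth.comp contMDiff_snd))) t x
      · exact (g.smooth _ x (smoothAt_coord hc hx j)).const t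
    | algebraMap r =>
      have : (fun τ y => g.pull y
          ((algebraMap k (unitInterval → ∀ y, M.fiber y) r) τ (g.base y))) =
          fun (_ : unitInterval) y => algebraMap k (L.fiber y) r := by
        funext τ y; simp [Pi.algebraMap_apply]
      rw [this]
      exact famSmoothAt_scalar (a := fun _ => r) contMDiff_const t x
    | add q q' _ _ h1 h2 =>
      simp only [Pi.add_apply, map_add]
      exact h1.add h2
    | mul q q' _ _ h1 h2 =>
      simp only [Pi.mul_apply, map_mul]
      exact h1.mul h2
  intro c' hc' hx'
  obtain ⟨p', hp', e'⟩ := key c' hc' hx'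
  refine ⟨p', hp', ?_⟩
  have hcont : ContinuousAt (fun q : unitInterval × L.body => (q.1, g.base q.2)) (t, x) :=
    (continuous_fst.prodMk (g.base_smooth.continuous.comp continuous_snd)).continuousAt
  filter_upwards [e', hcont.eventually e] with q h1 h2
  rw [← h1, h2]

/-- A morphism of graded manifolds `T[1][0,1] × L → M`, where `T[1][0,1]` has the coordinate `t` of
degree `0` and the coordinate `θ` of degree `1`, `θ² = 0`. The functions on `T[1][0,1] × L` are
`a + θ b` with `a`, `b` smooth functions on `[0,1] × L`, and the pull-back of a function on `M` is
its superfield `even + θ odd`: `even` preserves the degree and `odd` lowers it by one. That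
`even + θ odd` is a homomorphism of algebras means that `even` is one and that `odd` satisfies the
(signed) Leibniz rule along `even`. -/
structure SuperMap (L M : NManifold.{u} k) where
  base : unitInterval → L.body → M.body
  base_smooth : ContMDiff ((𝓡∂ 1).prod 𝓘(ℝ, L.E)) 𝓘(ℝ, M.E) ∞
    (fun q : unitInterval × L.body => base q.1 q.2)
  even : ∀ t x, M.fiber (base t x) →ₐ[k] L.fiber x
  odd : ∀ t x, M.fiber (base t x) →ₗ[k] L.fiber x
  even_mem : ∀ t x n, ∀ a ∈ M.deg (base t x) n, even t x a ∈ L.deg x n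
  odd_zero : ∀ t x, ∀ a ∈ M.deg (base t x) 0, odd t x a = 0
  odd_mem : ∀ t x n, ∀ a ∈ M.deg (base t x) (n + 1), odd t x a ∈ L.deg x n
  odd_mul : ∀ t x n, ∀ a ∈ M.deg (base t x) n, ∀ b,
    odd t x (a * b) = odd t x a * even t x b + (-1) ^ n * (even t x a * odd t x b)
  even_smooth : ∀ (s : ∀ y, M.fiber y) (t : unitInterval) (x : L.body),
    M.SmoothAt s (base t x) → L.FamSmoothAt (fun τ y => even τ y (s (base τ y))) t x
  odd_smooth : ∀ (s : ∀ y, M.fiber y) (t : unitInterval) (x : L.body),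
    M.SmoothAt s (base t x) → L.FamSmoothAt (fun τ y => odd τ y (s (base τ y))) t x

namespace SuperMap

variable {L M : NManifold.{u} k}

/-- The component of `θ^0` of the superfield of `f`, at time `t`. -/
def evenPart (φ : SuperMap L M) (t : unitInterval) (n : ℕ) : M.fn n →ₗ[k] L.fn n where
  toFun f := ⟨fun x => φ.even t x (f.1 (φ.base t x)), fun x => φ.even_mem t x n _ (f.2.1 _),
    fun x => (φ.even_smooth _ t x (f.2.2 _)).slice⟩
  map_add' f f' := by ext x; simp
  map_smul' r f := by ext x; simp

/-- The component of `θ` of the superfield of `f`, at time `t`, for `f` of positive degree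
(in degree `0` this component vanishes). -/
def oddPart (φ : SuperMap L M) (t : unitInterval) (n : ℕ) : M.fn (n + 1) →ₗ[k] L.fn n where
  toFun f := ⟨fun x => φ.odd t x (f.1 (φ.base t x)), fun x => φ.odd_mem t x n _ (f.2.1 _),
    fun x => (φ.odd_smooth _ t x (f.2.2 _)).slice⟩
  map_add' f f' := by ext x; simp
  map_smul' r f := by ext x; simp

/-- The composition of `φ : T[1][0,1] × L → M` with `id × g`, where `g : L' → L`. -/
def comp {L' : NManifold.{u} k} (φ : SuperMap L M) (g : Hom L' L) : SuperMap L' M where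
  base t x := φ.base t (g.base x)
  base_smooth := φ.base_smooth.comp
    (contMDiff_fst.prodMk (g.base_smooth.comp contMDiff_snd))
  even t x := (g.pull x).comp (φ.even t (g.base x))
  odd t x := (g.pull x).toLinearMap ∘ₗ φ.odd t (g.base x)
  even_mem t x n a ha := g.pull_mem x n _ (φ.even_mem t _ n a ha)
  odd_zero t x a ha := by simp [φ.odd_zero t _ a ha]
  odd_mem t x n a ha := g.pull_mem x n _ (φ.odd_mem t _ n a ha)
  odd_mul t x n a ha b := by simp [φ.odd_mul t _ n a ha b]
  even_smooth s t x h := (φ.even_smooth s t (g.base x) h).pull g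
  odd_smooth s t x h := (φ.odd_smooth s t (g.base x) h).pull g

/-- The projection `T[1][0,1] × M → M`. -/
def const (M : NManifold.{u} k) : SuperMap M M where
  base _ x := x
  base_smooth := contMDiff_snd
  even _ x := AlgHom.id k (M.fiber x)
  odd _ _ := 0
  even_mem _ _ _ _ ha := ha
  odd_zero _ _ _ _ := rfl
  odd_mem _ _ _ _ _ := zero_mem _
  odd_mul _ _ _ _ _ _ := by simp
  even_smooth _ t _ h := h.const t
  odd_smooth _ t x _ := (smoothAt_zero x).const t

end SuperMap

/-- `b` is the derivative at time `t` of the family `a` of functions of degree `n` on `L`. In each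
fibre the elements of degree `n` form a finite-dimensional space, so that derivatives can be tested
on linear functionals. -/
def HasTimeDeriv {L : NManifold.{u} k} {n : ℕ} (a : unitInterval → L.fn n) (b : L.fn n)
    (t : unitInterval) : Prop :=
  ∀ (x : L.body) (l : L.fiber x →ₗ[k] k),
    HasDerivWithinAt (fun τ : ℝ => l ((a (projIcc 0 1 zero_le_one τ)).1 x)) (l (b.1 x))
      (Icc 0 1) t

end NManifold

/-! ### NQ-manifolds -/

/-- An NQ-manifold: a non-negatively graded manifold with a homological vector field `Q`, i.e. a
derivation of degree `1` of its algebra of functions with `Q² = 0`. -/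
structure NQManifold (k : Type v) [RCLike k] extends NManifold.{u} k where
  Q : ∀ n, toNManifold.fn n →ₗ[k] toNManifold.fn (n + 1)
  Q_mul : ∀ (n m : ℕ) (f : toNManifold.fn n) (g : toNManifold.fn m),
    (Q (n + m) (NManifold.fnMul f g)).1 = (Q n f).1 * g.1 + (-1) ^ n * (f.1 * (Q m g).1)
  Q_sq : ∀ (n : ℕ) (f : toNManifold.fn n), Q (n + 1) (Q n f) = 0

namespace NQManifold

variable {k : Type v} [RCLike k]

/-- Morphisms of NQ-manifolds: morphisms of graded manifolds that intertwine the homological vector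
fields. -/
structure Hom (L M : NQManifold.{u} k) extends NManifold.Hom L.toNManifold M.toNManifold where
  map_Q : ∀ (n : ℕ) (f : M.fn n), toHom.map (n + 1) (M.Q n f) = L.Q n (toHom.map n f)

/-- A super-curve in `M` parametrised by the test manifold `L`: a morphism of NQ-manifolds
`φ : T[1][0,1] × L → M`. The homological vector field of `T[1][0,1] × L` is `D + Q_L` with
`D = θ ∂_t`, so `(D + Q_L)(a + θ b) = Q_L a + θ (∂_t a - Q_L b)`, and the condition
`φ^* Q f = (D + Q_L) φ^* f` is written out in components. -/
structure SuperCurve (L M : NQManifold.{u} k) extends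
    NManifold.SuperMap L.toNManifold M.toNManifold where
  even_Q : ∀ (t : unitInterval) (n : ℕ) (f : M.fn n),
    toSuperMap.evenPart t (n + 1) (M.Q n f) = L.Q n (toSuperMap.evenPart t n f)
  deriv_even_zero : ∀ (t : unitInterval) (f : M.fn 0),
    NManifold.HasTimeDeriv (fun τ => toSuperMap.evenPart τ 0 f)
      (toSuperMap.oddPart t 0 (M.Q 0 f)) t
  deriv_even_succ : ∀ (t : unitInterval) (n : ℕ) (f : M.fn (n + 1)),
    NManifold.HasTimeDeriv (fun τ => toSuperMap.evenPart τ (n + 1) f)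
      (toSuperMap.oddPart t (n + 1) (M.Q (n + 1) f) + L.Q n (toSuperMap.oddPart t n f)) t

namespace SuperCurve

variable {L L' M : NQManifold.{u} k}

/-- Change of the test manifold: `φ ∘ (id × g)`. This makes `L ↦ SuperCurve L M` a presheaf on
NQ-manifolds. -/
def comp (φ : SuperCurve L M) (g : Hom L' L) : SuperCurve L' M where
  toSuperMap := φ.toSuperMap.comp g.toHom
  even_Q t n f :=
    (congrArg (g.toHom.map (n + 1)) (φ.even_Q t n f)).trans (g.map_Q n _)
  deriv_even_zero t f x l :=
    φ.deriv_even_zero t f (g.base x) (l ∘ₗ (g.pull x).toLinearMap)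
  deriv_even_succ t n f x l := by
    have h := φ.deriv_even_succ t n f (g.base x) (l ∘ₗ (g.pull x).toLinearMap)
    have e1 : (φ.toSuperMap.comp g.toHom).oddPart t n f =
      g.toHom.map n (φ.oddPart t n f) := rfl
    have e2 : (φ.toSuperMap.comp g.toHom).oddPart t (n + 1) (M.Q (n + 1) f) =
      g.toHom.map (n + 1) (φ.oddPart t (n + 1) (M.Q (n + 1) f)) := rfl
    rw [e1, e2, ← g.map_Q, ← map_add]
    exact h

/-- The initial point of a super-curve, i.e. its restriction to `t = 0`, `θ = 0`: a morphism
`L → M`. -/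
def initial (φ : SuperCurve L M) : Hom L M where
  base := φ.base 0
  base_smooth := φ.base_smooth.comp (contMDiff_const.prodMk contMDiff_id)
  pull := φ.even 0
  pull_mem := φ.even_mem 0
  smooth s x h := (φ.even_smooth s 0 x h).slice
  map_Q := φ.even_Q 0

/-- The tautological family of constant super-curves: the projection `T[1][0,1] × M → M`. -/
def const (M : NQManifold.{u} k) : SuperCurve M M where
  toSuperMap := NManifold.SuperMap.const M.toNManifold
  even_Q _ _ _ := rfl
  deriv_even_zero t f x l :=
    (hasDerivWithinAt_const (t : ℝ) (Icc (0 : ℝ) 1) (l (f.1 x))).congr_deriv (map_zero l).symm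
  deriv_even_succ t n f x l := by
    have e1 : (NManifold.SuperMap.const M.toNManifold).oddPart t n f = 0 := rfl
    have e2 : (NManifold.SuperMap.const M.toNManifold).oddPart t (n + 1) (M.Q (n + 1) f) = 0 := rfl
    rw [e1, e2, map_zero, add_zero]
    exact (hasDerivWithinAt_const (t : ℝ) (Icc (0 : ℝ) 1) (l (f.1 x))).congr_deriv (map_zero l).symm

end SuperCurve

/-! ### Functions on the space of super-curves -/

/-- The functions of degree `n` on the space `S̄` of super-curves in `M`, as a subspace. As `S̄`
represents the presheaf `L ↦ Hom(T[1][0,1] × L, M)` on NQ-manifolds, a function on it is (Yoneda) a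
rule that assigns to each super-curve parametrised by a test manifold `L` a function on `L`,
naturally in `L`. -/
def curveFnSubmodule (M : NQManifold.{u} k) (n : ℕ) :
    Submodule k (∀ L : NQManifold.{u} k, SuperCurve L M → L.fn n) where
  carrier := {χ | ∀ (L L' : NQManifold.{u} k) (g : Hom L' L) (φ : SuperCurve L M),
    χ L' (φ.comp g) = g.toHom.map n (χ L φ)}
  zero_mem' L L' g φ := by simp
  add_mem' h h' L L' g φ := by simp [h L L' g φ, h' L L' g φ]
  smul_mem' r χ h L L' g φ := by simp [h L L' g φ]

/-- The space `C^∞(S̄)_n` of functions of degree `n` on the space `S̄` of super-curves in `M`. -/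
def curveFn (M : NQManifold.{u} k) (n : ℕ) : Type (max (u + 1) v) := M.curveFnSubmodule n

instance (M : NQManifold.{u} k) (n : ℕ) : AddCommGroup (M.curveFn n) :=
  inferInstanceAs (AddCommGroup (M.curveFnSubmodule n))

instance (M : NQManifold.{u} k) (n : ℕ) : Module k (M.curveFn n) :=
  inferInstanceAs (Module k (M.curveFnSubmodule n))

/-- The differential `δ_B` of `C^∞(S̄)`: on each test manifold `L` it is the homological vector
field of `L`. -/
def deltaB (M : NQManifold.{u} k) (n : ℕ) : M.curveFn n →ₗ[k] M.curveFn (n + 1) where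
  toFun χ := ⟨fun L φ => L.Q n (χ.1 L φ), fun L L' g φ =>
    (congrArg (L'.Q n) (χ.2 L L' g φ)).trans (g.map_Q n _).symm⟩
  map_add' χ χ' := Subtype.ext (funext fun L => funext fun φ =>
    map_add (L.Q n) (χ.1 L φ) (χ'.1 L φ))
  map_smul' r χ := Subtype.ext (funext fun L => funext fun φ =>
    map_smul (L.Q n) r (χ.1 L φ))

theorem deltaB_sq (M : NQManifold.{u} k) (n : ℕ) (χ : M.curveFn n) :
    M.deltaB (n + 1) (M.deltaB n χ) = 0 :=
  Subtype.ext (funext fun L => funext fun φ => L.Q_sq n (χ.1 L φ))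

/-- Pull-back of functions along the map `S̄ → M` that sends a super-curve to its initial point. -/
def initialPull (M : NQManifold.{u} k) (n : ℕ) : M.fn n →ₗ[k] M.curveFn n where
  toFun f := ⟨fun _ φ => φ.initial.toHom.map n f, fun _ _ _ _ => rfl⟩
  map_add' f f' := Subtype.ext (funext fun _ => funext fun φ =>
    map_add (φ.initial.toHom.map n) f f')
  map_smul' r f := Subtype.ext (funext fun _ => funext fun φ =>
    map_smul (φ.initial.toHom.map n) r f)

/-- Pull-back of functions along the inclusion `M → S̄` of the constant super-curves. -/
def constPull (M : NQManifold.{u} k) (n : ℕ) : M.curveFn n →ₗ[k] M.fn n where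
  toFun χ := χ.1 M (SuperCurve.const M)
  map_add' _ _ := rfl
  map_smul' _ _ := rfl

theorem deltaB_initialPull (M : NQManifold.{u} k) {n : ℕ} {f : M.fn n} (hf : M.Q n f = 0) :
    M.deltaB n (M.initialPull n f) = 0 := by
  refine Subtype.ext (funext fun L => funext fun φ => ?_)
  refine (φ.initial.map_Q n f).symm.trans ?_
  rw [hf, map_zero]
  rfl

theorem Q_constPull (M : NQManifold.{u} k) {n : ℕ} {χ : M.curveFn n} (hχ : M.deltaB n χ = 0) :
    M.Q n (M.constPull n χ) = 0 :=
  congrArg (fun η : M.curveFn (n + 1) => η.1 M (SuperCurve.const M)) hχ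

/-- The `Q`-cohomology `H_Q^n(M)`. -/
abbrev HQ (M : NQManifold.{u} k) (n : ℕ) : Type u :=
  Cohomology (C := fun n => M.fn n) M.Q n

/-- The class of a `Q`-closed function. -/
def classQ (M : NQManifold.{u} k) {n : ℕ} (f : M.fn n) (hf : M.Q n f = 0) : M.HQ n :=
  cohomologyClass (C := fun n => M.fn n) M.Q f hf

/-- The `δ_B`-cohomology `H_{δ_B}^n(S̄)` of the space of super-curves in `M`. -/
abbrev HdeltaB (M : NQManifold.{u} k) (n : ℕ) :=
  Cohomology (C := fun n => M.curveFn n) M.deltaB n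

/-- The class of a `δ_B`-closed function. -/
def classDeltaB (M : NQManifold.{u} k) {n : ℕ} (χ : M.curveFn n) (hχ : M.deltaB n χ = 0) :
    M.HdeltaB n :=
  cohomologyClass (C := fun n => M.curveFn n) M.deltaB χ hχ

end NQManifold

end

/-! The proof contracts super-curves to their initial points, along a time line that is made part of
the test manifold. With `r = ramp`, the map `(t, s) ↦ t * r s` induces a map `T[1][0,1] × T[1]ℝ →
T[1][0,1]`, which sends `t` to `r(s) t` and `θ` to `r(s) θ + t r'(s) σ`, where `σ` is the odd
coordinate of `T[1]ℝ`. Precomposition turns a super-curve `φ` parametrised by `L` into a super-curve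
`φ.contract` parametrised by `T[1]ℝ × L`. It restricts to `φ` at `s = 1` and to the constant
super-curve at the initial point of `φ` at `s = 0`.

A function `χ` on the space of super-curves can be evaluated on every test manifold, in particular
on `T[1]ℝ × L`. Write `χ(φ.contract) = α + σ β`. If `χ` is closed, this function is closed for `σ
∂_s + Q_L`, so that `∂_s α = Q β`. Integration over `0 ≤ s ≤ 1` shows that `χ(φ)` and the value of
`χ` on the constant super-curve differ by `Q ∫ β` (`Q_fiberIntegral`). Contraction and integration
are natural in `L` (`contract_comp`, `fiberIntegral_map`), so `φ ↦ ∫ β` is again a function on the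
space of super-curves, of degree one less. Hence the pull-back to constant super-curves followed by
the pull-back along initial points is the identity on cohomology. In degree `0` there is no `β`, and
`α` is constant in time. The opposite composition is the identity already on functions.

The work lies in making `T[1]ℝ × L` an NQ-manifold. A homological vector field is given only on
global functions at a fixed time, so it has to be shown that it preserves smoothness of families and
commutes with `∂_s`. The Leibniz rule makes it local (`vf_congr`), Hadamard's lemma gives its
coordinate formula (`vf_scalar`, `vf_family`), and symmetry of second derivatives gives the rest
(`smoothFamAt_vf_aux`). The fibres carry no topology. Derivatives are therefore taken of finite sums
of scalar coefficients times fixed vectors (`HasFiberDeriv`), and linear functionals separate the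
results. The line `ℝ` is used in place of `[0,1]` because bodies of test manifolds have no boundary.
-/

noncomputable section

/-! ### Calculus with parameters -/

section Calculus

/-- The integral over `[0,1]` of a smooth function depends smoothly on parameters. -/
theorem contDiff_integral_zero_one {E F : Type*} [NormedAddCommGroup E] [NormedSpace ℝ E]
    [NormedAddCommGroup F] [NormedSpace ℝ F] {f : E × ℝ → F} (hf : ContDiff ℝ ∞ f) :
    ContDiff ℝ ∞ fun p => ∫ t in (0 : ℝ)..1, f (p, t) := by
  -- The integral is the value at `1` of the convolution of the indicator of `(0,1]` with `s ↦ f (p,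
  -- 1 - s)`. The bump makes the second factor compactly supported, and equals `1` at the points `1
  -- - t`, `0 < t ≤ 1`, that matter.
  let ψ : ContDiffBump (0 : ℝ) := ⟨1, 2, one_pos, one_lt_two⟩
  let g : E → ℝ → F := fun p s => ψ s • f (p, 1 - s)
  have hg : ContDiff ℝ ∞ ↿g := by
    have h1 : ContDiff ℝ ∞ fun q : E × ℝ => ψ q.2 := ψ.contDiff.comp contDiff_snd
    have h2 : ContDiff ℝ ∞ fun q : E × ℝ => f (q.1, 1 - q.2) :=
      hf.comp (contDiff_fst.prodMk (contDiff_const.sub contDiff_snd))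
    exact h1.smul h2
  have key := MeasureTheory.contDiffOn_convolution_right_with_param (μ := MeasureTheory.volume)
    (f := (Ioc (0 : ℝ) 1).indicator fun _ => (1 : ℝ)) (ContinuousLinearMap.lsmul ℝ ℝ)
    (g := g) (s := univ) (k := Metric.closedBall 0 2) (n := ⊤) isOpen_univ
    (isCompact_closedBall _ _)
    (fun p x _ hx => by
      have : ψ x = 0 := ψ.zero_of_le_dist (not_le.1 hx).le
      simp [g, this])
    ((MeasureTheory.integrable_indicator_iff measurableSet_Ioc).2
      (by simp)).locallyIntegrable
    hg.contDiffOn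
  rw [univ_prod_univ, contDiffOn_univ] at key
  have h3 := key.comp ((contDiff_id (E := E)).prodMk (contDiff_const (c := (1 : ℝ))))
  convert! h3 using 1
  funext p
  simp only [Function.comp, id, MeasureTheory.convolution]
  rw [intervalIntegral.integral_of_le zero_le_one,
    ← MeasureTheory.integral_indicator measurableSet_Ioc]
  congr 1
  funext t
  by_cases ht : t ∈ Ioc (0 : ℝ) 1
  · have h1 : ψ (1 - t) = 1 := by
      apply ψ.one_of_mem_closedBall
      change dist (1 - t) 0 ≤ 1
      rw [Real.dist_eq, abs_le]
      constructor <;> linarith [ht.1, ht.2]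
    simp [ht, g, h1]
  · simp [ht]

/-- Hadamard's lemma. -/
theorem exists_smooth_slope {E F : Type*} [NormedAddCommGroup E] [NormedSpace ℝ E]
    [NormedAddCommGroup F] [NormedSpace ℝ F] [CompleteSpace F] {f : E → F} (hf : ContDiff ℝ ∞ f)
    (y : E) :
    ∃ g : E → E →L[ℝ] F, ContDiff ℝ ∞ g ∧ g y = fderiv ℝ f y ∧
      ∀ z, f z = f y + g z (z - y) := by
  have hf' : ContDiff ℝ ∞ (fderiv ℝ f) := hf.fderiv_right (m := ∞) le_rfl
  have hG : ContDiff ℝ ∞ fun q : E × ℝ => fderiv ℝ f (y + q.2 • (q.1 - y)) :=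
    hf'.comp (contDiff_const.add (contDiff_snd.smul (contDiff_fst.sub contDiff_const)))
  -- The slope at `z` is the mean of the derivative of `f` over the segment from `y` to `z`.
  refine ⟨_, contDiff_integral_zero_one hG, by simp, fun z => ?_⟩
  have hd : ∀ t : ℝ, HasDerivAt (fun t : ℝ => f (y + t • (z - y)))
      (fderiv ℝ f (y + t • (z - y)) (z - y)) t := by
    intro t
    have h1 : HasDerivAt (fun t : ℝ => y + t • (z - y)) (z - y) t := by
      simpa using ((hasDerivAt_id t).smul_const (z - y)).const_add y
    exact ((hf.differentiable (by simp)) _).hasFDerivAt.comp_hasDerivAt t h1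
  have hc : Continuous fun t : ℝ => fderiv ℝ f (y + t • (z - y)) :=
    hG.continuous.comp (Continuous.prodMk_right z)
  have h2 := intervalIntegral.integral_eq_sub_of_hasDerivAt (a := 0) (b := 1)
    (fun t _ => hd t) ((hc.clm_apply continuous_const).intervalIntegrable 0 1)
  rw [ContinuousLinearMap.intervalIntegral_apply (hc.intervalIntegrable 0 1), h2]
  simp

end Calculus

/-! ### Smooth functions on a manifold near a point -/

section Manifold

variable {E : Type*} [NormedAddCommGroup E] [NormedSpace ℝ E]
  {B : Type*} [TopologicalSpace B] [ChartedSpace E B]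
  {F : Type*} [NormedAddCommGroup F] [NormedSpace ℝ F]

theorem contMDiff_prod_self_iff {f : ℝ × E → F} :
    ContMDiff (𝓘(ℝ, ℝ).prod 𝓘(ℝ, E)) 𝓘(ℝ, F) ∞ f ↔ ContDiff ℝ ∞ f := by
  rw [← modelWithCornersSelf_prod, chartedSpaceSelf_prod, contMDiff_iff_contDiff]

/-- Locally a smooth function on `ℝ × B` is the composition of a smooth function on a vector space
with a global chart. -/
theorem ContMDiff.prod_global_chart {a : ℝ × B → F}
    (ha : ContMDiff (𝓘(ℝ, ℝ).prod 𝓘(ℝ, E)) 𝓘(ℝ, F) ∞ a) {Θ : E → B}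
    (hΘ : ContMDiff 𝓘(ℝ, E) 𝓘(ℝ, E) ∞ Θ) : ContDiff ℝ ∞ fun q : ℝ × E => a (q.1, Θ q.2) :=
  contMDiff_prod_self_iff.1 (ha.comp (contMDiff_fst.prodMk (hΘ.comp contMDiff_snd)))

/-- The derivative in the first variable of a smooth function on `ℝ × B`. -/
def timeDeriv (a : ℝ × B → F) (q : ℝ × B) : F := deriv (fun s => a (s, q.2)) q.1

theorem ContMDiff.hasDerivAt_timeDeriv {a : ℝ × B → F}
    (ha : ContMDiff (𝓘(ℝ, ℝ).prod 𝓘(ℝ, E)) 𝓘(ℝ, F) ∞ a) (s : ℝ) (x : B) :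
    HasDerivAt (fun s => a (s, x)) (timeDeriv a (s, x)) s := by
  have h : ContMDiff 𝓘(ℝ, ℝ) 𝓘(ℝ, F) ∞ fun s : ℝ => a (s, x) :=
    ha.comp (contMDiff_id.prodMk contMDiff_const)
  exact (h.contDiff.differentiable (by simp) s).hasDerivAt

theorem hasDerivAt_fst {G : Type*} [NormedAddCommGroup G] [NormedSpace ℝ G] {b : ℝ × G → F}
    (hb : ContDiff ℝ ∞ b) (s : ℝ) (y : G) :
    HasDerivAt (fun s => b (s, y)) (fderiv ℝ b (s, y) (1, 0)) s :=
  ((hb.differentiable (by simp)) (s, y)).hasFDerivAt.comp_hasDerivAt s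
    ((hasDerivAt_id s).prodMk (hasDerivAt_const s y))

/-- Hadamard's lemma on a manifold. -/
theorem ContMDiff.exists_slope [CompleteSpace F] {a : B → F} {Θ : E → B} {Φ : B → E} {x : B}
    (ha : ContMDiff 𝓘(ℝ, E) 𝓘(ℝ, F) ∞ a) (hΘ : ContMDiff 𝓘(ℝ, E) 𝓘(ℝ, E) ∞ Θ)
    (hΦ : ContMDiff 𝓘(ℝ, E) 𝓘(ℝ, E) ∞ Φ)
    (e : ∀ᶠ z in 𝓝 x, Θ (Φ z) = z) :
    ∃ g : B → E →L[ℝ] F, ContMDiff 𝓘(ℝ, E) 𝓘(ℝ, E →L[ℝ] F) ∞ g ∧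
      g x = fderiv ℝ (fun y => a (Θ y)) (Φ x) ∧
      ∀ᶠ z in 𝓝 x, a z = a x + g z (Φ z - Φ x) := by
  obtain ⟨g, hg, hgx, h⟩ := exists_smooth_slope (f := fun y => a (Θ y)) (ha.comp hΘ).contDiff (Φ x)
  refine ⟨fun z => g (Φ z), hg.contMDiff.comp hΦ, hgx, ?_⟩
  filter_upwards [e] with z hz
  have h1 := h (Φ z)
  rwa [hz, e.self_of_nhds] at h1

variable [FiniteDimensional ℝ E] [IsManifold 𝓘(ℝ, E) ∞ B] [T2Space B]

/-- A chart at `x₀` and its inverse, replaced by globally defined smooth maps which agree with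
them near `x₀`. -/
theorem exists_global_chart (x₀ : B) :
    ∃ (Φ : B → E) (Θ : E → B), ContMDiff 𝓘(ℝ, E) 𝓘(ℝ, E) ∞ Φ ∧ ContMDiff 𝓘(ℝ, E) 𝓘(ℝ, E) ∞ Θ ∧
      ∀ᶠ x in 𝓝 x₀, Θ (Φ x) = x := by
  have f : SmoothBumpFunction 𝓘(ℝ, E) x₀ := Classical.choice inferInstance
  set e := extChartAt 𝓘(ℝ, E) x₀ with he
  obtain ⟨R, hR, hball⟩ := Metric.isOpen_iff.1 (isOpen_extChartAt_target (I := 𝓘(ℝ, E)) x₀)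
    (e x₀) (mem_extChartAt_target x₀)
  let ψ : ContDiffBump (e x₀) := ⟨R / 2, R, by positivity, by linarith⟩
  -- A smooth map of the whole space into the ball of radius `R` that is the identity on the ball of
  -- radius `R / 2`; it makes the inverse chart globally defined.
  let r : E → E := fun y => e x₀ + ψ y • (y - e x₀)
  have hr : ContDiff ℝ ∞ r :=
    contDiff_const.add (ψ.contDiff.smul (contDiff_id.sub contDiff_const))
  have hrt : ∀ y, r y ∈ e.target := by
    intro y
    apply hball
    rw [Metric.mem_ball, dist_eq_norm]
    simp only [r, add_sub_cancel_left, norm_smul, Real.norm_eq_abs, abs_of_nonneg ψ.nonneg]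
    by_cases hy : dist y (e x₀) < R
    · rw [dist_eq_norm] at hy
      calc ψ y * ‖y - e x₀‖ ≤ 1 * ‖y - e x₀‖ := by gcongr; exact ψ.le_one
        _ < R := by simpa using hy
    · rw [ψ.zero_of_le_dist (not_lt.1 hy)]
      simpa using hR
  refine ⟨fun x => f x • e x, fun y => e.symm (r y), ?_, ?_, ?_⟩
  · exact f.contMDiff_smul (contMDiffOn_extChartAt (I := 𝓘(ℝ, E)) (n := ∞) (x := x₀))
  · exact (contMDiffOn_extChartAt_symm x₀).comp_contMDiff hr.contMDiff hrt
  · have h1 : ∀ᶠ x in 𝓝 x₀, e x ∈ Metric.ball (e x₀) (R / 2) :=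
      (continuousAt_extChartAt x₀).eventually (Metric.ball_mem_nhds _ (by positivity))
    filter_upwards [f.eventuallyEq_one, h1, extChartAt_source_mem_nhds (I := 𝓘(ℝ, E)) x₀]
      with x h2 h3 h4
    have h5 : ψ (e x) = 1 := ψ.one_of_mem_closedBall (Metric.ball_subset_closedBall h3)
    simp only [h2, Pi.one_apply, one_smul, r, h5, add_sub_cancel]
    exact e.left_inv h4

/-- Smoothness is local in `B`, and near `x₀` the points satisfy `Θ (Φ x) = x`. It reduces the
smoothness of derivatives and primitives in time to calculus on `ℝ × E`. -/
theorem contMDiff_of_global_chart {a : ℝ × B → F}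
    (h : ∀ (x₀ : B) (Φ : B → E) (Θ : E → B), ContMDiff 𝓘(ℝ, E) 𝓘(ℝ, E) ∞ Φ →
      ContMDiff 𝓘(ℝ, E) 𝓘(ℝ, E) ∞ Θ → (∀ᶠ x in 𝓝 x₀, Θ (Φ x) = x) →
      ∃ b : ℝ × E → F, ContDiff ℝ ∞ b ∧ ∀ s, ∀ x, Θ (Φ x) = x → a (s, x) = b (s, Φ x)) :
    ContMDiff (𝓘(ℝ, ℝ).prod 𝓘(ℝ, E)) 𝓘(ℝ, F) ∞ a := by
  rintro ⟨s, x₀⟩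
  obtain ⟨Φ, Θ, hΦ, hΘ, e⟩ := exists_global_chart (E := E) x₀
  obtain ⟨b, hb, hab⟩ := h x₀ Φ Θ hΦ hΘ e
  have h1 : ContMDiff (𝓘(ℝ, ℝ).prod 𝓘(ℝ, E)) 𝓘(ℝ, F) ∞ fun q : ℝ × B => b (q.1, Φ q.2) :=
    (contMDiff_prod_self_iff.2 hb).comp (contMDiff_fst.prodMk (hΦ.comp contMDiff_snd))
  refine (h1 (s, x₀)).congr_of_eventuallyEq ?_
  filter_upwards [(continuous_snd.continuousAt (x := (s, x₀))).eventually e] with q hq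
  exact hab _ _ hq

theorem ContMDiff.timeDeriv {a : ℝ × B → F}
    (ha : ContMDiff (𝓘(ℝ, ℝ).prod 𝓘(ℝ, E)) 𝓘(ℝ, F) ∞ a) :
    ContMDiff (𝓘(ℝ, ℝ).prod 𝓘(ℝ, E)) 𝓘(ℝ, F) ∞ (timeDeriv a) := by
  refine contMDiff_of_global_chart fun x₀ Φ Θ hΦ hΘ e => ?_
  have hb := ha.prod_global_chart hΘ
  refine ⟨fun q => fderiv ℝ (fun q : ℝ × E => a (q.1, Θ q.2)) q (1, 0),
    (hb.fderiv_right (m := ∞) le_rfl).clm_apply contDiff_const, fun s x hx => ?_⟩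
  have h := (hasDerivAt_fst hb s (Φ x)).deriv
  simp only [hx] at h
  exact h

variable [CompleteSpace F]

/-- A smooth function on `ℝ × B` has a smooth primitive in the first variable. -/
theorem ContMDiff.exists_primitive {a : ℝ × B → F}
    (ha : ContMDiff (𝓘(ℝ, ℝ).prod 𝓘(ℝ, E)) 𝓘(ℝ, F) ∞ a) :
    ∃ A : ℝ × B → F, ContMDiff (𝓘(ℝ, ℝ).prod 𝓘(ℝ, E)) 𝓘(ℝ, F) ∞ A ∧
      (∀ x, A (0, x) = 0) ∧ ∀ s x, HasDerivAt (fun s => A (s, x)) (a (s, x)) s := by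
  refine ⟨fun q => ∫ τ in (0 : ℝ)..q.1, a (τ, q.2), ?_, fun x => by simp, fun s x => ?_⟩
  · refine contMDiff_of_global_chart fun x₀ Φ Θ hΦ hΘ e => ?_
    have hb := ha.prod_global_chart hΘ
    -- Rescaling the variable of integration moves the upper limit `s` into the integrand and leaves
    -- the fixed interval `[0,1]`.
    have hc : ContDiff ℝ ∞ fun p : (ℝ × E) × ℝ => p.1.1 • a (p.1.1 * p.2, Θ p.1.2) := by
      refine contDiff_fst.fst.smul ?_
      exact hb.comp ((contDiff_fst.fst.mul contDiff_snd).prodMk contDiff_fst.snd)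
    refine ⟨_, contDiff_integral_zero_one hc, fun s x hx => ?_⟩
    simp only [hx, intervalIntegral.integral_smul]
    rw [intervalIntegral.smul_integral_comp_mul_left (fun τ => a (τ, x))]
    simp
  · have hc : Continuous fun τ => a (τ, x) := ha.continuous.comp (Continuous.prodMk_left x)
    exact intervalIntegral.integral_hasDerivAt_right (hc.intervalIntegrable _ _)
      (hc.stronglyMeasurableAtFilter _ _) hc.continuousAt

end Manifold

end

noncomputable section

/-! ### Graded algebras -/

section GradedAlgebra

variable {k : Type*} {A : Type*} [CommRing k] [Ring A] [Algebra k A] {𝒜 : ℕ → Submodule k A}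

theorem DirectSum.IsInternal.homogeneous_induction (h : DirectSum.IsInternal 𝒜) {p : A → Prop}
    (mem : ∀ n, ∀ a ∈ 𝒜 n, p a) (add : ∀ a b, p a → p b → p (a + b)) (a : A) : p a := by
  have ha : a ∈ ⨆ n, 𝒜 n := h.submodule_iSup_eq_top ▸ Submodule.mem_top
  exact Submodule.iSup_induction 𝒜 (motive := p) ha mem (mem 0 0 (zero_mem _)) add

/-- A family of submodules is independent if there are projections to its members. -/
theorem iSupIndep_of_projections {M : Type*} [AddCommGroup M] [Module k M]
    {S : ℕ → Submodule k M} (π : ℕ → M →ₗ[k] M) (h1 : ∀ n, ∀ a ∈ S n, π n a = a)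
    (h2 : ∀ n m, m ≠ n → ∀ a ∈ S m, π n a = 0) : iSupIndep S := by
  intro n
  rw [Submodule.disjoint_def]
  intro a ha ha'
  have h3 : ⨆ j, ⨆ (_ : j ≠ n), S j ≤ LinearMap.ker (π n) :=
    iSup₂_le fun j hj b hb => h2 n j hj b hb
  rw [← h1 n a ha]
  exact h3 ha'

/-- The linear map that multiplies the elements of degree `n` by `ε n`. -/
def gradedScale (h : DirectSum.IsInternal 𝒜) (ε : ℕ → k) : A →ₗ[k] A :=
  DirectSum.toModule k ℕ A (fun n => ε n • (𝒜 n).subtype) ∘ₗ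
    (LinearEquiv.ofBijective (DirectSum.coeLinearMap 𝒜) h).symm.toLinearMap

theorem gradedScale_of_mem (h : DirectSum.IsInternal 𝒜) (ε : ℕ → k) {n : ℕ} {a : A}
    (ha : a ∈ 𝒜 n) : gradedScale h ε a = ε n • a := by
  have h1 : (LinearEquiv.ofBijective (DirectSum.coeLinearMap 𝒜) h).symm a =
      DirectSum.lof k ℕ (fun n => 𝒜 n) n ⟨a, ha⟩ := by
    rw [LinearEquiv.symm_apply_eq]
    exact (DirectSum.coeLinearMap_lof 𝒜 n ⟨a, ha⟩).symm
  rw [gradedScale, LinearMap.comp_apply, LinearEquiv.coe_coe, h1, DirectSum.toModule_lof]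
  rfl

/-- The projection to the elements of degree `n`. -/
def gradedProj (h : DirectSum.IsInternal 𝒜) (n : ℕ) : A →ₗ[k] A :=
  gradedScale h (Pi.single n 1)

theorem gradedProj_of_mem (h : DirectSum.IsInternal 𝒜) {n : ℕ} {a : A} (ha : a ∈ 𝒜 n) :
    gradedProj h n a = a := by
  simp [gradedProj, gradedScale_of_mem h _ ha]

theorem gradedProj_of_mem_ne (h : DirectSum.IsInternal 𝒜) {n m : ℕ} (hmn : m ≠ n) {a : A}
    (ha : a ∈ 𝒜 m) : gradedProj h n a = 0 := by
  simp [gradedProj, gradedScale_of_mem h _ ha, hmn]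

/-- The parity automorphism: multiplication by `(-1) ^ n` in degree `n`. -/
def parity [SetLike.GradedMonoid 𝒜] (h : DirectSum.IsInternal 𝒜) : A →ₐ[k] A :=
  AlgHom.ofLinearMap (gradedScale h fun n => (-1) ^ n)
    (by simpa using gradedScale_of_mem h (fun n => (-1) ^ n) (SetLike.GradedOne.one_mem (A := 𝒜)))
    (by
      intro a b
      refine h.homogeneous_induction (p := fun a => gradedScale h (fun n => (-1) ^ n) (a * b) =
        gradedScale h (fun n => (-1) ^ n) a * gradedScale h (fun n => (-1) ^ n) b)
        (fun n a ha => ?_) (fun a a' h1 h2 => by simp only [add_mul, map_add, h1, h2]) a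
      refine h.homogeneous_induction (p := fun b => gradedScale h (fun n => (-1) ^ n) (a * b) =
        gradedScale h (fun n => (-1) ^ n) a * gradedScale h (fun n => (-1) ^ n) b)
        (fun m b hb => ?_) (fun b b' h1 h2 => by simp only [mul_add, map_add, h1, h2]) b
      rw [gradedScale_of_mem h _ ha, gradedScale_of_mem h _ hb,
        gradedScale_of_mem h _ (SetLike.GradedMul.mul_mem ha hb), pow_add, smul_mul_smul_comm])

theorem parity_of_mem [SetLike.GradedMonoid 𝒜] (h : DirectSum.IsInternal 𝒜) {n : ℕ} {a : A}
    (ha : a ∈ 𝒜 n) : parity h a = (-1) ^ n * a := by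
  refine (gradedScale_of_mem h _ ha).trans ?_
  rcases Nat.even_or_odd n with hn | hn <;> simp [hn.neg_one_pow]

/-- The grading shifted by one. -/
def shiftDeg (𝒜 : ℕ → Submodule k A) : ℕ → Submodule k A
  | 0 => ⊥
  | n + 1 => 𝒜 n

theorem neg_one_pow_mul_mem (𝒜 : ℕ → Submodule k A) (m : ℕ) {n : ℕ} {a : A} (ha : a ∈ 𝒜 n) :
    (-1) ^ m * a ∈ 𝒜 n := by
  rcases neg_one_pow_eq_or A m with h | h <;> simp [h, ha]

/-- The algebra `A[σ]` of the elements `a + σ b` where `σ² = 0` and `a σ = σ (α a)`. -/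
def SuperExt (_α : A →ₐ[k] A) : Type _ := A × A

/-! ### Ring structure and grading of the extension by `σ` -/

namespace SuperExt

variable {α : A →ₐ[k] A}

instance : AddCommGroup (SuperExt α) := inferInstanceAs (AddCommGroup (A × A))

instance : Module k (SuperExt α) := inferInstanceAs (Module k (A × A))

/-- The element `a + σ b`. -/
def mk (α : A →ₐ[k] A) (a b : A) : SuperExt α := (a, b)

/-- The component `a` of `a + σ b`. -/
def fst : SuperExt α →ₗ[k] A := LinearMap.fst k A A

/-- The component `b` of `a + σ b`. -/
def snd : SuperExt α →ₗ[k] A := LinearMap.snd k A A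

@[ext] theorem ext {p q : SuperExt α} (h1 : p.fst = q.fst) (h2 : p.snd = q.snd) : p = q :=
  Prod.ext h1 h2

@[simp] theorem fst_mk (a b : A) : (mk α a b).fst = a := rfl

@[simp] theorem snd_mk (a b : A) : (mk α a b).snd = b := rfl

instance : One (SuperExt α) := ⟨mk α 1 0⟩

instance : Mul (SuperExt α) :=
  ⟨fun p q => mk α (p.fst * q.fst) (p.snd * q.fst + α p.fst * q.snd)⟩

@[simp] theorem fst_one : (1 : SuperExt α).fst = 1 := rfl

@[simp] theorem snd_one : (1 : SuperExt α).snd = 0 := rfl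

@[simp] theorem fst_mul (p q : SuperExt α) : (p * q).fst = p.fst * q.fst := rfl

@[simp] theorem snd_mul (p q : SuperExt α) : (p * q).snd = p.snd * q.fst + α p.fst * q.snd := rfl

instance : Ring (SuperExt α) where
  __ := (inferInstance : AddCommGroup (SuperExt α))
  mul_assoc p q r := by ext <;> simp <;> noncomm_ring
  one_mul p := by ext <;> simp
  mul_one p := by ext <;> simp
  left_distrib p q r := by ext <;> simp <;> noncomm_ring
  right_distrib p q r := by ext <;> simp <;> noncomm_ring
  zero_mul p := by ext <;> simp
  mul_zero p := by ext <;> simp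

instance : Algebra k (SuperExt α) :=
  Algebra.ofModule (fun r p q => by ext <;> simp) (fun r p q => by ext <;> simp)

theorem algebraMap_def (r : k) : algebraMap k (SuperExt α) r = mk α (algebraMap k A r) 0 := by
  rw [Algebra.algebraMap_eq_smul_one, Algebra.algebraMap_eq_smul_one]
  ext <;> simp

@[simp] theorem fst_algebraMap (r : k) : (algebraMap k (SuperExt α) r).fst = algebraMap k A r := by
  rw [algebraMap_def]; rfl

@[simp] theorem snd_algebraMap (r : k) : (algebraMap k (SuperExt α) r).snd = 0 := by
  rw [algebraMap_def]; rfl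

/-- The projection `a + σ b ↦ a`. -/
def fstHom (α : A →ₐ[k] A) : SuperExt α →ₐ[k] A :=
  AlgHom.ofLinearMap fst rfl fun _ _ => rfl

@[simp] theorem fstHom_apply (p : SuperExt α) : fstHom α p = p.fst := rfl

/-- The inclusion `a ↦ a`. -/
def inl (α : A →ₐ[k] A) : A →ₐ[k] SuperExt α :=
  AlgHom.ofLinearMap
    { toFun := fun a => mk α a 0
      map_add' := fun a b => by ext <;> simp
      map_smul' := fun r a => by ext <;> simp }
    rfl fun a b => by ext <;> simp

@[simp] theorem fst_inl (a : A) : (inl α a).fst = a := rfl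

@[simp] theorem snd_inl (a : A) : (inl α a).snd = 0 := rfl

/-- The generator `σ`. -/
def gen (α : A →ₐ[k] A) : SuperExt α := mk α 0 1

@[simp] theorem fst_gen : (gen α).fst = 0 := rfl

@[simp] theorem snd_gen : (gen α).snd = 1 := rfl

theorem neg_one_pow_mul_fst (n : ℕ) (p : SuperExt α) : ((-1) ^ n * p).fst = (-1) ^ n * p.fst := by
  rcases neg_one_pow_eq_or A n with h | h <;> rcases Nat.even_or_odd n with h' | h' <;>
    simp [h'.neg_one_pow]

theorem neg_one_pow_mul_snd (n : ℕ) (p : SuperExt α) : ((-1) ^ n * p).snd = (-1) ^ n * p.snd := by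
  rcases Nat.even_or_odd n with h' | h' <;> simp [h'.neg_one_pow]

/-- The grading in which `σ` has degree `1`. -/
def deg (α : A →ₐ[k] A) (𝒜 : ℕ → Submodule k A) (n : ℕ) : Submodule k (SuperExt α) :=
  (𝒜 n).comap fst ⊓ (shiftDeg 𝒜 n).comap snd

/-- The extension is the direct sum of `A` and a copy of `A` shifted by one; its homogeneous
projections are the projections of `A`, shifted in the second component. -/
theorem deg_internal (h : DirectSum.IsInternal 𝒜) : DirectSum.IsInternal (deg α 𝒜) := by
  rw [DirectSum.isInternal_submodule_iff_iSupIndep_and_iSup_eq_top]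
  constructor
  · let π' : ℕ → A →ₗ[k] A := fun n => n.casesOn 0 fun m => gradedProj h m
    refine iSupIndep_of_projections (fun n => LinearMap.prodMap (gradedProj h n) (π' n))
      (fun n p hp => ?_) (fun n m hmn p hp => ?_)
    · refine ext (gradedProj_of_mem h hp.1) ?_
      cases n with
      | zero => exact (show p.snd = 0 from hp.2).symm
      | succ n => exact gradedProj_of_mem h hp.2
    · refine ext (gradedProj_of_mem_ne h hmn hp.1) ?_
      cases n with
      | zero => rfl
      | succ n =>
        cases m with
        | zero =>
          have : p.snd = 0 := hp.2
          exact (congrArg (gradedProj h n) this).trans (map_zero _)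
        | succ m => exact gradedProj_of_mem_ne h (fun e => hmn (by rw [e])) hp.2
  · rw [eq_top_iff]
    rintro p -
    have h1 : mk α p.fst 0 ∈ ⨆ n, deg α 𝒜 n := by
      refine h.homogeneous_induction (p := fun a => mk α a 0 ∈ ⨆ n, deg α 𝒜 n)
        (fun n a ha => ?_) (fun a b ha hb => ?_) p.fst
      · exact Submodule.mem_iSup_of_mem n ⟨ha, zero_mem (shiftDeg 𝒜 n)⟩
      · convert! add_mem ha hb using 1
        ext <;> simp
    have h2 : mk α 0 p.snd ∈ ⨆ n, deg α 𝒜 n := by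
      refine h.homogeneous_induction (p := fun b => mk α 0 b ∈ ⨆ n, deg α 𝒜 n)
        (fun n b hb => ?_) (fun a b ha hb => ?_) p.snd
      · exact Submodule.mem_iSup_of_mem (n + 1) ⟨zero_mem (𝒜 (n + 1)), hb⟩
      · convert! add_mem ha hb using 1
        ext <;> simp
    convert! add_mem h1 h2 using 1
    ext <;> simp

section Parity

variable [SetLike.GradedMonoid 𝒜] {h : DirectSum.IsInternal 𝒜}

instance : SetLike.GradedMonoid (deg (parity h) 𝒜) where
  one_mem := ⟨SetLike.GradedOne.one_mem (A := 𝒜), zero_mem (shiftDeg 𝒜 0)⟩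
  mul_mem := by
    rintro n m p q ⟨hp, hp'⟩ ⟨hq, hq'⟩
    have hp : p.fst ∈ 𝒜 n := hp
    have hq : q.fst ∈ 𝒜 m := hq
    refine ⟨SetLike.GradedMul.mul_mem hp hq, ?_⟩
    change (p * q).snd ∈ shiftDeg 𝒜 (n + m)
    rw [snd_mul, parity_of_mem h hp]
    refine add_mem ?_ ?_
    · cases n with
      | zero =>
        have : p.snd = 0 := hp'
        simp [this]
      | succ n =>
        rw [Nat.add_right_comm]
        exact SetLike.GradedMul.mul_mem (A := 𝒜) hp' hq
    · cases m with
      | zero =>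
        have : q.snd = 0 := hq'
        simp [this]
      | succ m =>
        exact SetLike.GradedMul.mul_mem (A := 𝒜) (neg_one_pow_mul_mem 𝒜 n hp) hq'

/-- The sign from moving `σ` past `p.fst` or `q.fst` is built into the product by `parity`. Thus the
mixed terms `p.snd * q.fst` and `p.fst * q.snd` of one product match those of the other in crossed
order. -/
theorem graded_comm
    (comm : ∀ n m, ∀ a ∈ 𝒜 n, ∀ b ∈ 𝒜 m, a * b = (-1) ^ (n * m) * (b * a)) (n m : ℕ) :
    ∀ p ∈ deg (parity h) 𝒜 n, ∀ q ∈ deg (parity h) 𝒜 m, p * q = (-1) ^ (n * m) * (q * p) := by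
  rintro p ⟨hp, hp'⟩ q ⟨hq, hq'⟩
  have hp : p.fst ∈ 𝒜 n := hp
  have hq : q.fst ∈ 𝒜 m := hq
  ext
  · rw [neg_one_pow_mul_fst]
    exact comm n m _ hp _ hq
  · rw [neg_one_pow_mul_snd, snd_mul, snd_mul, parity_of_mem h hp, parity_of_mem h hq]
    have e1 : p.snd * q.fst = (-1) ^ (n * m) * ((-1) ^ m * q.fst * p.snd) := by
      cases n with
      | zero =>
        have : p.snd = 0 := hp'
        simp [this]
      | succ n =>
        -- Here `p.snd` has degree `n` while `p` has degree `n + 1`; the discrepancy of exponents is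
        -- the even number `2 * m`.
        rw [comm n m _ hp' _ hq, mul_assoc ((-1) ^ m), ← mul_assoc ((-1) ^ ((n + 1) * m)),
          ← pow_add,
          show (n + 1) * m + m = n * m + 2 * m by ring, pow_add, pow_mul (-1) 2]
        simp
    have e2 : (-1) ^ n * p.fst * q.snd = (-1) ^ (n * m) * (q.snd * p.fst) := by
      cases m with
      | zero =>
        have : q.snd = 0 := hq'
        simp [this]
      | succ m =>
        rw [mul_assoc, comm n m _ hp _ hq', ← mul_assoc, ← pow_add]
        congr 2
        ring
    rw [e1, e2, mul_add, add_comm]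

end Parity

theorem gen_mul_inl (a : A) : gen α * inl α a = mk α 0 a := by
  ext <;> simp

end SuperExt

/-- The exponents of the ordered monomials in generators of the given degrees. -/
abbrev Exponents {r : ℕ} (wt : Fin r → ℕ) : Type := {a : Fin r → ℕ // ∀ j, Odd (wt j) → a j ≤ 1}

/-! ### Ordered monomials in `σ` and further generators -/

namespace SuperExt

variable {α : A →ₐ[k] A} {r : ℕ}

theorem ordered_monomial (ξ : Fin r → A) (a : Fin (r + 1) → ℕ) :
    (List.ofFn fun j => (Fin.cons (gen α) (fun j => inl α (ξ j)) : Fin (r + 1) → SuperExt α) j ^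
      a j).prod = gen α ^ a 0 * inl α (List.ofFn fun j => ξ j ^ a j.succ).prod := by
  rw [List.ofFn_succ, List.prod_cons]
  simp only [Fin.cons_zero, Fin.cons_succ, map_list_prod, List.map_ofFn]
  congr 3
  funext j
  simp

variable {wt : Fin r → ℕ}

/-- An ordered monomial in `σ` and further generators is either free of `σ` or a multiple of it. -/
def splitExponents (a : Exponents (Fin.cons 1 wt : Fin (r + 1) → ℕ)) :
    Exponents wt ⊕ Exponents wt :=
  if a.1 0 = 0 then Sum.inl ⟨fun j => a.1 j.succ, fun j hj => a.2 j.succ (by simpa using hj)⟩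
  else Sum.inr ⟨fun j => a.1 j.succ, fun j hj => a.2 j.succ (by simpa using hj)⟩

theorem exponents_zero_le (a : Exponents (Fin.cons 1 wt : Fin (r + 1) → ℕ)) : a.1 0 ≤ 1 :=
  a.2 0 (by simp)

/-- Since `σ` has the odd weight `1`, its exponent is `0` or `1`, and the two cases are told apart
by the summand. -/
theorem splitExponents_bijective : Function.Bijective (splitExponents (wt := wt)) := by
  constructor
  · intro a b hab
    have ha := exponents_zero_le a
    have hb := exponents_zero_le b
    unfold splitExponents at hab
    have key : a.1 0 = b.1 0 ∧ (fun j : Fin r => a.1 j.succ) = fun j => b.1 j.succ := by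
      split_ifs at hab with h1 h2 h2
      · exact ⟨h1.trans h2.symm, congrArg Subtype.val (Sum.inl.inj hab)⟩
      · exact ⟨by omega, congrArg Subtype.val (Sum.inr.inj hab)⟩
    refine Subtype.ext (funext fun j => ?_)
    refine Fin.cases key.1 (fun j => congrFun key.2 j) j
  · rintro (a | a)
    · refine ⟨⟨Fin.cons 0 a.1, fun j => ?_⟩, ?_⟩
      · refine Fin.cases (by simp) (fun j => ?_) j
        simpa using a.2 j
      · simp [splitExponents]
    · refine ⟨⟨Fin.cons 1 a.1, fun j => ?_⟩, ?_⟩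
      · refine Fin.cases (by simp) (fun j => ?_) j
        simpa using a.2 j
      · simp [splitExponents]

/-- As `σ` stands first in every ordered monomial, the monomials are those of `A` placed in the
first or in the second factor of `A × A`. Freeness over the extension thereby becomes a statement on
bases of a product module. -/
theorem ordered_monomials_eq (ξ : Fin r → A) :
    (fun a : Exponents (Fin.cons 1 wt : Fin (r + 1) → ℕ) =>
      (List.ofFn fun j => (Fin.cons (gen α) (fun j => inl α (ξ j)) : Fin (r + 1) → SuperExt α) j ^
        a.1 j).prod) =
    Sum.elim (LinearMap.inl k A A ∘ fun a : Exponents wt => (List.ofFn fun j => ξ j ^ a.1 j).prod)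
      (LinearMap.inr k A A ∘ fun a : Exponents wt => (List.ofFn fun j => ξ j ^ a.1 j).prod) ∘
      splitExponents := by
  funext a
  rw [ordered_monomial]
  have ha := exponents_zero_le a
  by_cases h : a.1 0 = 0
  · simp only [h, pow_zero, one_mul, Function.comp, splitExponents, if_true, Sum.elim_inl]
    rfl
  · have h1 : a.1 0 = 1 := by omega
    simp only [h1, pow_one, Function.comp, splitExponents, one_ne_zero, if_false, Sum.elim_inr,
      gen_mul_inl]
    rfl

theorem linearIndependent_ordered_monomials {ξ : Fin r → A}
    (h : LinearIndependent k fun a : Exponents wt => (List.ofFn fun j => ξ j ^ a.1 j).prod) :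
    LinearIndependent k fun a : Exponents (Fin.cons 1 wt : Fin (r + 1) → ℕ) =>
      (List.ofFn fun j => (Fin.cons (gen α) (fun j => inl α (ξ j)) : Fin (r + 1) → SuperExt α) j ^
        a.1 j).prod := by
  rw [ordered_monomials_eq (k := k) (α := α) ξ]
  exact (linearIndependent_inl_union_inr' h h).comp _ splitExponents_bijective.1

theorem span_ordered_monomials {ξ : Fin r → A}
    (h : Submodule.span k (range fun a : Exponents wt => (List.ofFn fun j => ξ j ^ a.1 j).prod) =
      ⊤) :
    Submodule.span k (range fun a : Exponents (Fin.cons 1 wt : Fin (r + 1) → ℕ) =>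
      (List.ofFn fun j => (Fin.cons (gen α) (fun j => inl α (ξ j)) : Fin (r + 1) → SuperExt α) j ^
        a.1 j).prod) = ⊤ := by
  rw [ordered_monomials_eq (k := k) (α := α) ξ]
  change Submodule.span k (range (_ ∘ splitExponents)) = (⊤ : Submodule k (A × A))
  rw [splitExponents_bijective.2.range_comp,
    Sum.elim_range, Submodule.span_union, range_comp, range_comp,
    Submodule.span_image, Submodule.span_image, h, Submodule.map_top, Submodule.map_top,
    LinearMap.sup_range_inl_inr]

end SuperExt

end GradedAlgebra

end

noncomputable section

/-! ### Smooth families of sections -/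

namespace GradedCoords

variable {k : Type v} [RCLike k] {B : Type u} [TopologicalSpace B] {F : B → Type u}
  [∀ x, Ring (F x)] [∀ x, Algebra k (F x)] {deg : ∀ x, ℕ → Submodule k (F x)}

/-- A monomial in the coordinates, the factors being given by a list. -/
def word (c : GradedCoords k deg) (w : List (Fin c.rank)) (x : B) : F x :=
  (w.map fun j => c.coord j x).prod

/-- The degree of a monomial. -/
def wordDeg (c : GradedCoords k deg) (w : List (Fin c.rank)) : ℕ := (w.map c.wt).sum

theorem word_mem [∀ x, SetLike.GradedMonoid (deg x)] (c : GradedCoords k deg)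
    (w : List (Fin c.rank)) {x : B} (hx : x ∈ c.dom) : c.word w x ∈ deg x (c.wordDeg w) :=
  SetLike.list_prod_map_mem_graded w _ _ fun j _ => c.coord_mem x hx j

end GradedCoords

/-! ### Bump functions with values in `k` -/

section Bump

variable (k : Type*) [RCLike k] {E : Type*} [NormedAddCommGroup E] [NormedSpace ℝ E]
  [FiniteDimensional ℝ E] {B : Type*} [TopologicalSpace B] [ChartedSpace E B]
  [IsManifold 𝓘(ℝ, E) ∞ B] [T2Space B]

/-- The support is a closed subset of `U`, so `χ` vanishes on a neighbourhood of every point outside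
`U`, not only at the point. This is what allows sections smooth on `U` to be extended by zero. -/
theorem exists_smooth_bump {x₀ : B} {U : Set B} (hU : U ∈ 𝓝 x₀) :
    ∃ χ : B → k, ContMDiff 𝓘(ℝ, E) 𝓘(ℝ, k) ∞ χ ∧ (∀ᶠ x in 𝓝 x₀, χ x = 1) ∧
      ∀ x ∉ U, ∀ᶠ y in 𝓝 x, χ y = 0 := by
  obtain ⟨f, -, hf⟩ := (SmoothBumpFunction.nhds_basis_tsupport (I := 𝓘(ℝ, E)) x₀).mem_iff.1 hU
  refine ⟨fun x => RCLike.ofRealCLM (f x),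
    (RCLike.ofRealCLM (K := k)).contDiff.contMDiff.comp f.contMDiff, ?_, fun x hx => ?_⟩
  · filter_upwards [f.eventuallyEq_one] with x h
    simp [h]
  · filter_upwards [notMem_tsupport_iff_eventuallyEq.1 fun h => hx (hf h)] with y h
    simp [h]

theorem ContMDiff.mul_scalar {k : Type*} [RCLike k] {E H M : Type*} [NormedAddCommGroup E]
    [NormedSpace ℝ E] [TopologicalSpace H] {I : ModelWithCorners ℝ E H} [TopologicalSpace M]
    [ChartedSpace H M] {a b : M → k} (ha : ContMDiff I 𝓘(ℝ, k) ∞ a)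
    (hb : ContMDiff I 𝓘(ℝ, k) ∞ b) : ContMDiff I 𝓘(ℝ, k) ∞ fun x => a x * b x :=
  ((contDiff_fst.mul contDiff_snd : ContDiff ℝ ∞ fun p : k × k => p.1 * p.2).contMDiff).comp
    (ha.prodMk_space hb)

end Bump

namespace NManifold

variable {k : Type v} [RCLike k] {L : NManifold.{u} k}

theorem smoothAt_scalar {a : L.body → k} (ha : ContMDiff 𝓘(ℝ, L.E) 𝓘(ℝ, k) ∞ a) (x : L.body) :
    L.SmoothAt (fun x => algebraMap k (L.fiber x) (a x)) x :=
  fun _ _ _ => ⟨_, Algebra.subset_adjoin (Or.inl ⟨a, ha, rfl⟩), Eventually.of_forall fun _ => rfl⟩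

theorem SmoothAt.congr {s s' : ∀ x, L.fiber x} {x : L.body} (h : L.SmoothAt s x)
    (e : ∀ᶠ y in 𝓝 x, s' y = s y) : L.SmoothAt s' x := by
  intro c hc hx
  obtain ⟨p, hp, e'⟩ := h c hc hx
  refine ⟨p, hp, ?_⟩
  filter_upwards [e, e'] with y h1 h2
  rw [h1, h2]

theorem SmoothAt.sum {ι : Type*} (S : Finset ι) {f : ι → ∀ x, L.fiber x} {x : L.body}
    (h : ∀ i ∈ S, L.SmoothAt (f i) x) : L.SmoothAt (∑ i ∈ S, f i) x :=
  Finset.sum_induction f (fun s => L.SmoothAt s x) (fun _ _ => SmoothAt.add) (smoothAt_zero x) h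

theorem smoothAt_word {c : GradedCoords k L.deg} (hc : c ∈ L.atlas) (w : List (Fin c.rank))
    {x : L.body} (hx : x ∈ c.dom) : L.SmoothAt (c.word w) x := by
  induction w with
  | nil =>
    refine (smoothAt_scalar (L := L) (contMDiff_const (c := (1 : k))) x).congr
      (Eventually.of_forall fun y => ?_)
    simp [GradedCoords.word]
  | cons j w ih =>
    refine ((smoothAt_coord hc hx j).mul ih).congr (Eventually.of_forall fun y => ?_)
    simp [GradedCoords.word]

/-! ### Normal forms of smooth families over an arbitrary parameter manifold -/

section Families

variable {EP HP P : Type*} [NormedAddCommGroup EP] [NormedSpace ℝ EP] [TopologicalSpace HP]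
  [TopologicalSpace P] [ChartedSpace HP P] (I : ModelWithCorners ℝ EP HP)

/-- Near `(t, x)` the family `f` is a polynomial in the coordinates `c`, with smooth functions on
`P × L` as coefficients. -/
def NormalAt (c : GradedCoords k L.deg) (f : P → ∀ x, L.fiber x) (t : P) (x : L.body) : Prop :=
  ∃ (ι : Type) (_ : Fintype ι) (a : ι → P × L.body → k) (w : ι → List (Fin c.rank)),
    (∀ i, ContMDiff (I.prod 𝓘(ℝ, L.E)) 𝓘(ℝ, k) ∞ (a i)) ∧
      ∀ᶠ q in 𝓝 (t, x), f q.1 q.2 = ∑ i, a i q • c.word (w i) q.2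

/-- The family `f` is smooth at `(t, x)`. -/
def SmoothFamAt (f : P → ∀ x, L.fiber x) (t : P) (x : L.body) : Prop :=
  ∀ c ∈ L.atlas, x ∈ c.dom → NormalAt I c f t x

variable {I} {c : GradedCoords k L.deg} {f f' : P → ∀ x, L.fiber x} {t : P} {x : L.body}

theorem NormalAt.congr (h : NormalAt I c f t x) (e : ∀ᶠ q in 𝓝 (t, x), f' q.1 q.2 = f q.1 q.2) :
    NormalAt I c f' t x := by
  obtain ⟨ι, _, a, w, ha, h⟩ := h
  refine ⟨ι, inferInstance, a, w, ha, ?_⟩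
  filter_upwards [h, e] with q h1 h2
  rw [h2, h1]

theorem NormalAt.add (h : NormalAt I c f t x) (h' : NormalAt I c f' t x) :
    NormalAt I c (f + f') t x := by
  obtain ⟨ι, _, a, w, ha, h⟩ := h
  obtain ⟨ι', _, a', w', ha', h'⟩ := h'
  refine ⟨ι ⊕ ι', inferInstance, Sum.elim a a', Sum.elim w w', ?_, ?_⟩
  · rintro (i | i)
    exacts [ha i, ha' i]
  · filter_upwards [h, h'] with q h1 h2
    simp [h1, h2]

theorem NormalAt.mul (h : NormalAt I c f t x) (h' : NormalAt I c f' t x) :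
    NormalAt I c (f * f') t x := by
  obtain ⟨ι, _, a, w, ha, h⟩ := h
  obtain ⟨ι', _, a', w', ha', h'⟩ := h'
  refine ⟨ι × ι', inferInstance, fun i q => a i.1 q * a' i.2 q, fun i => w i.1 ++ w' i.2,
    fun i => (ha i.1).mul_scalar (ha' i.2), ?_⟩
  filter_upwards [h, h'] with q h1 h2
  simp only [Pi.mul_apply, h1, h2, Finset.sum_mul_sum, Fintype.sum_prod_type, GradedCoords.word,
    List.map_append, List.prod_append, smul_mul_smul_comm]

theorem normalAt_scalar {a : P × L.body → k} (ha : ContMDiff (I.prod 𝓘(ℝ, L.E)) 𝓘(ℝ, k) ∞ a)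
    (c : GradedCoords k L.deg) (t : P) (x : L.body) :
    NormalAt I c (fun t x => algebraMap k (L.fiber x) (a (t, x))) t x :=
  ⟨Unit, inferInstance, fun _ => a, fun _ => [], fun _ => ha, Eventually.of_forall fun q => by
    simp [GradedCoords.word, Algebra.algebraMap_eq_smul_one]⟩

theorem normalAt_coord (I : ModelWithCorners ℝ EP HP) (c : GradedCoords k L.deg)
    (j : Fin c.rank) (t : P) (x : L.body) : NormalAt I c (fun _ => c.coord j) t x :=
  ⟨Unit, inferInstance, fun _ _ => 1, fun _ => [j], fun _ => contMDiff_const,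
    Eventually.of_forall fun q => by simp [GradedCoords.word]⟩

/-- Normal forms contain scalars and coordinates and are closed under sums and products, so they
exhaust the subalgebra generated by these. The passage to explicit sums makes coefficients available
for differentiation and integration. -/
theorem SmoothAt.smoothFamAt {s : ∀ x, L.fiber x} (h : L.SmoothAt s x)
    (I : ModelWithCorners ℝ EP HP) (t : P) : SmoothFamAt I (fun _ => s) t x := by
  intro c hc hx
  obtain ⟨p, hp, e⟩ := h c hc hx
  refine NormalAt.congr (f := fun _ => p) ?_
    ((continuous_snd.continuousAt (x := (t, x))).eventually e)
  clear e
  unfold GradedCoords.polys at hp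
  induction hp using Algebra.adjoin_induction with
  | mem q hq =>
    rcases hq with ⟨a, ha, rfl⟩ | ⟨j, rfl⟩
    · exact normalAt_scalar (a := fun q => a q.2) (ha.comp contMDiff_snd) c t x
    · exact normalAt_coord I c j t x
  | algebraMap r => exact normalAt_scalar (a := fun _ => r) contMDiff_const c t x
  | add q q' _ _ h1 h2 => exact h1.add h2
  | mul q q' _ _ h1 h2 => exact h1.mul h2

theorem FamSmoothAt.smoothFamAt {f : unitInterval → ∀ x, L.fiber x} {t : unitInterval}
    (h : L.FamSmoothAt f t x) : SmoothFamAt (𝓡∂ 1) f t x := by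
  intro c hc hx
  obtain ⟨p, hp, e⟩ := h c hc hx
  refine NormalAt.congr (f := p) ?_ e
  clear e
  unfold GradedCoords.famPolys at hp
  induction hp using Algebra.adjoin_induction with
  | mem q hq =>
    rcases hq with ⟨a, ha, rfl⟩ | ⟨j, rfl⟩
    · exact normalAt_scalar ha c t x
    · exact normalAt_coord _ c j t x
  | algebraMap r => exact normalAt_scalar (a := fun _ => r) contMDiff_const c t x
  | add q q' _ _ h1 h2 => exact h1.add h2
  | mul q q' _ _ h1 h2 => exact h1.mul h2

theorem SmoothFamAt.congr (h : SmoothFamAt I f t x)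
    (e : ∀ᶠ q in 𝓝 (t, x), f' q.1 q.2 = f q.1 q.2) : SmoothFamAt I f' t x :=
  fun c hc hx => (h c hc hx).congr e

theorem SmoothFamAt.add (h : SmoothFamAt I f t x) (h' : SmoothFamAt I f' t x) :
    SmoothFamAt I (f + f') t x :=
  fun c hc hx => (h c hc hx).add (h' c hc hx)

theorem SmoothFamAt.mul (h : SmoothFamAt I f t x) (h' : SmoothFamAt I f' t x) :
    SmoothFamAt I (f * f') t x :=
  fun c hc hx => (h c hc hx).mul (h' c hc hx)

theorem smoothFamAt_scalar {a : P × L.body → k}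
    (ha : ContMDiff (I.prod 𝓘(ℝ, L.E)) 𝓘(ℝ, k) ∞ a) (t : P) (x : L.body) :
    SmoothFamAt I (fun t x => algebraMap k (L.fiber x) (a (t, x))) t x :=
  fun c _ _ => normalAt_scalar ha c t x

theorem SmoothFamAt.smul {a : P × L.body → k} (ha : ContMDiff (I.prod 𝓘(ℝ, L.E)) 𝓘(ℝ, k) ∞ a)
    (h : SmoothFamAt I f t x) : SmoothFamAt I (fun t x => a (t, x) • f t x) t x :=
  ((smoothFamAt_scalar ha t x).mul h).congr (Eventually.of_forall fun _ => Algebra.smul_def _ _)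

theorem smoothFamAt_zero (I : ModelWithCorners ℝ EP HP) (t : P) (x : L.body) :
    SmoothFamAt (L := L) I (fun _ => 0) t x :=
  (smoothAt_zero x).smoothFamAt I t

theorem SmoothFamAt.sum {ι : Type*} (S : Finset ι) {f : ι → P → ∀ x, L.fiber x}
    (h : ∀ i ∈ S, SmoothFamAt I (f i) t x) : SmoothFamAt I (fun t x => ∑ i ∈ S, f i t x) t x := by
  have := Finset.sum_induction f (fun s => SmoothFamAt I s t x) (fun _ _ => SmoothFamAt.add)
    (smoothFamAt_zero I t x) h
  refine this.congr (Eventually.of_forall fun q => ?_)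
  simp

theorem SmoothFamAt.neg (h : SmoothFamAt I f t x) : SmoothFamAt I (-f) t x :=
  (h.smul (a := fun _ => -1) contMDiff_const).congr (Eventually.of_forall fun q => by simp)

theorem SmoothFamAt.sub (h : SmoothFamAt I f t x) (h' : SmoothFamAt I f' t x) :
    SmoothFamAt I (f - f') t x := by
  rw [sub_eq_add_neg]
  exact h.add h'.neg

/-- A sum of products of smooth coefficients and smooth sections is smooth. -/
theorem smoothFamAt_of_eventually {ι : Type*} [Fintype ι] {a : ι → P × L.body → k}
    {m : ι → ∀ x, L.fiber x} (ha : ∀ i, ContMDiff (I.prod 𝓘(ℝ, L.E)) 𝓘(ℝ, k) ∞ (a i))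
    (hm : ∀ i, L.SmoothAt (m i) x)
    (h : ∀ᶠ q in 𝓝 (t, x), f q.1 q.2 = ∑ i, a i q • m i q.2) : SmoothFamAt I f t x :=
  (SmoothFamAt.sum Finset.univ fun i _ => ((hm i).smoothFamAt I t).smul (ha i)).congr h

/-- A smooth family of functions of degree `n` is locally a sum of products of smooth coefficients
and global functions of degree `n`. -/
theorem SmoothFamAt.exists_fn (h : SmoothFamAt I f t x) {n : ℕ}
    (hf : ∀ t x, f t x ∈ L.deg x n) :
    ∃ (ι : Type) (_ : Fintype ι) (a : ι → P × L.body → k) (m : ι → L.fn n),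
      (∀ i, ContMDiff (I.prod 𝓘(ℝ, L.E)) 𝓘(ℝ, k) ∞ (a i)) ∧
      ∀ᶠ q in 𝓝 (t, x), f q.1 q.2 = ∑ i, a i q • (m i).1 q.2 := by
  classical
  obtain ⟨c, hc, hx⟩ := L.atlas_cover x
  obtain ⟨ι, _, a, w, ha, h⟩ := h c hc hx
  obtain ⟨χ, hχ, hχ1, hχ0⟩ := exists_smooth_bump k (E := L.E) (c.isOpen_dom.mem_nhds hx)
  -- Words of the wrong degree are discarded, since the projection to degree `n` kills them. The
  -- others are cut off by `χ` to become global functions; nothing changes near `x`, where `χ = 1`.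
  let m : ι → ∀ y, L.fiber y := fun i y =>
    if c.wordDeg (w i) = n then χ y • c.word (w i) y else 0
  have hmem : ∀ i, m i ∈ L.fn n := by
    intro i
    by_cases hi : c.wordDeg (w i) = n
    · have hmi : m i = fun y => χ y • c.word (w i) y := by
        funext y; simp [m, hi]
      rw [hmi]
      refine ⟨fun y => ?_, fun y => ?_⟩
      · by_cases hy : y ∈ c.dom
        · exact Submodule.smul_mem _ _ (hi ▸ c.word_mem (w i) hy)
        · simp [(hχ0 y hy).self_of_nhds]
      · by_cases hy : y ∈ c.dom
        · exact ((smoothAt_scalar hχ y).mul (smoothAt_word hc (w i) hy)).congr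
            (Eventually.of_forall fun z => Algebra.smul_def _ _)
        · refine (smoothAt_zero y).congr ?_
          filter_upwards [hχ0 y hy] with z hz
          simp [hz]
    · have hmi : m i = 0 := by
        funext y; simp [m, hi]
      rw [hmi]
      exact zero_mem _
  refine ⟨ι, inferInstance, a, fun i => ⟨m i, hmem i⟩, ha, ?_⟩
  have h2 := (continuous_snd.continuousAt (x := (t, x))).eventually
    (hχ1.and (c.isOpen_dom.mem_nhds hx))
  filter_upwards [h, h2] with q h1 ⟨h3, h4⟩
  have h5 := congrArg (gradedProj (L.deg_internal q.2) n) h1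
  rw [gradedProj_of_mem _ (hf q.1 q.2), map_sum] at h5
  rw [h5]
  refine Finset.sum_congr rfl fun i _ => ?_
  rw [map_smul]
  by_cases hi : c.wordDeg (w i) = n
  · rw [gradedProj_of_mem _ (hi ▸ c.word_mem (w i) h4)]
    simp [m, hi, h3]
  · rw [gradedProj_of_mem_ne _ hi (c.word_mem (w i) h4)]
    simp [m, hi]

theorem SmoothFamAt.slice (h : SmoothFamAt I f t x) : L.SmoothAt (f t) x := by
  obtain ⟨c, hc, hx⟩ := L.atlas_cover x
  obtain ⟨ι, _, a, w, ha, h⟩ := h c hc hx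
  refine SmoothAt.congr (s := ∑ i, fun y => a i (t, y) • c.word (w i) y)
    (SmoothAt.sum Finset.univ fun i _ => ?_) ?_
  · refine ((smoothAt_scalar (L := L) ((ha i).comp
      ((contMDiff_const (c := t)).prodMk contMDiff_id)) x).mul
      (smoothAt_word hc (w i) hx)).congr (Eventually.of_forall fun z => ?_)
    exact Algebra.smul_def _ _
  · filter_upwards [(Continuous.prodMk_right t).continuousAt.eventually h] with y hy
    simpa using hy

/-- In normal form the pull-back acts separately on the coefficients, by composition with the base
map, and on the words, which do not depend on the parameter. -/
theorem SmoothFamAt.pull {M : NManifold.{u} k} (g : Hom L M) {f : P → ∀ y, M.fiber y}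
    (h : SmoothFamAt I f t (g.base x)) :
    SmoothFamAt I (fun τ y => g.pull y (f τ (g.base y))) t x := by
  obtain ⟨c, hc, hx⟩ := M.atlas_cover (g.base x)
  obtain ⟨ι, _, a, w, ha, h⟩ := h c hc hx
  refine smoothFamAt_of_eventually (a := fun i q => a i (q.1, g.base q.2))
    (m := fun i y => g.pull y (c.word (w i) (g.base y)))
    (fun i => (ha i).comp (contMDiff_fst.prodMk (g.base_smooth.comp contMDiff_snd)))
    (fun i => g.smooth _ x (smoothAt_word hc (w i) hx)) ?_
  have hcont : ContinuousAt (fun q : P × L.body => (q.1, g.base q.2)) (t, x) :=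
    (continuous_fst.prodMk (g.base_smooth.continuous.comp continuous_snd)).continuousAt
  filter_upwards [hcont.eventually h] with q hq
  simp only [hq, map_sum, map_smul]

end Families

end NManifold

end

noncomputable section

/-! ### Curves in vector spaces without a topology -/

section FiberDeriv

variable (k : Type*) [RCLike k] {V W : Type*} [AddCommGroup V] [Module k V] [AddCommGroup W]
  [Module k W]

/-- `f` is near `s` a curve in a finite-dimensional space, and its derivative at `s` within `S`
is `v`. -/
def HasFiberDeriv (f : ℝ → V) (v : V) (S : Set ℝ) (s : ℝ) : Prop :=
  ∃ (ι : Type) (_ : Fintype ι) (a : ι → ℝ → k) (a' : ι → k) (m : ι → V),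
    (∀ i, HasDerivWithinAt (a i) (a' i) S s) ∧ (∀ᶠ τ in 𝓝[S] s, f τ = ∑ i, a i τ • m i) ∧
      f s = ∑ i, a i s • m i ∧ v = ∑ i, a' i • m i

variable {k} {f g : ℝ → V} {v v' : V} {S : Set ℝ} {s : ℝ}

namespace HasFiberDeriv

theorem hasDerivWithinAt (h : HasFiberDeriv k f v S s) (l : V →ₗ[k] k) :
    HasDerivWithinAt (fun τ => l (f τ)) (l v) S s := by
  obtain ⟨ι, _, a, a', m, ha, h1, h2, rfl⟩ := h
  have h3 : HasDerivWithinAt (fun τ => ∑ i, a i τ * l (m i)) (∑ i, a' i * l (m i)) S s :=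
    HasDerivWithinAt.fun_sum fun i _ => (ha i).mul_const _
  simp only [map_sum, map_smul, smul_eq_mul]
  refine h3.congr_of_eventuallyEq ?_ (by simp [h2])
  filter_upwards [h1] with τ h
  simp [h]

/-- Linear functionals separate the points of a vector space over a field. The lemma turns
derivatives known only through functionals, as in `HasTimeDeriv`, into derivatives in the fibre. -/
theorem eq_of_forall_dual (hS : UniqueDiffWithinAt ℝ S s) (h : HasFiberDeriv k f v S s)
    (h' : ∀ l : V →ₗ[k] k, HasDerivWithinAt (fun τ => l (f τ)) (l v') S s) : v = v' := by
  rw [← sub_eq_zero, ← Module.forall_dual_apply_eq_zero_iff k]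
  intro l
  rw [map_sub, sub_eq_zero]
  exact hS.eq_deriv _ (h.hasDerivWithinAt l) (h' l)

theorem unique (hS : UniqueDiffWithinAt ℝ S s) (h : HasFiberDeriv k f v S s)
    (h' : HasFiberDeriv k f v' S s) : v = v' :=
  h.eq_of_forall_dual hS h'.hasDerivWithinAt

theorem congr (h : HasFiberDeriv k f v S s) (e : ∀ᶠ τ in 𝓝[S] s, g τ = f τ) (e' : g s = f s) :
    HasFiberDeriv k g v S s := by
  obtain ⟨ι, _, a, a', m, ha, h1, h2, rfl⟩ := h
  refine ⟨ι, inferInstance, a, a', m, ha, ?_, e'.trans h2, rfl⟩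
  filter_upwards [e, h1] with τ h3 h4
  rw [h3, h4]

theorem map (h : HasFiberDeriv k f v S s) (T : V →ₗ[k] W) :
    HasFiberDeriv k (fun τ => T (f τ)) (T v) S s := by
  obtain ⟨ι, _, a, a', m, ha, h1, h2, rfl⟩ := h
  refine ⟨ι, inferInstance, a, a', fun i => T (m i), ha, ?_, by simp [h2], by simp⟩
  filter_upwards [h1] with τ h
  simp [h]

theorem add (h : HasFiberDeriv k f v S s) (h' : HasFiberDeriv k g v' S s) :
    HasFiberDeriv k (fun τ => f τ + g τ) (v + v') S s := by
  obtain ⟨ι, _, a, a', m, ha, h1, h2, rfl⟩ := h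
  obtain ⟨ι', _, b, b', n, hb, h3, h4, rfl⟩ := h'
  refine ⟨ι ⊕ ι', inferInstance, Sum.elim a b, Sum.elim a' b', Sum.elim m n, ?_, ?_,
    by simp [h2, h4], by simp⟩
  · rintro (i | i)
    exacts [ha i, hb i]
  · filter_upwards [h1, h3] with τ h5 h6
    simp [h5, h6]

theorem smul {b : ℝ → k} {b' : k} (hb : HasDerivWithinAt b b' S s) (h : HasFiberDeriv k f v S s) :
    HasFiberDeriv k (fun τ => b τ • f τ) (b' • f s + b s • v) S s := by
  obtain ⟨ι, _, a, a', m, ha, h1, h2, rfl⟩ := h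
  refine ⟨ι, inferInstance, fun i τ => b τ * a i τ, fun i => b' * a i s + b s * a' i, m,
    fun i => hb.mul (ha i), ?_, ?_, ?_⟩
  · filter_upwards [h1] with τ h
    simp [h, Finset.smul_sum, mul_smul]
  · simp [h2, Finset.smul_sum, mul_smul]
  · simp [h2, Finset.smul_sum, mul_smul, add_smul, Finset.sum_add_distrib]

theorem neg (h : HasFiberDeriv k f v S s) : HasFiberDeriv k (fun τ => -f τ) (-v) S s :=
  h.map (-LinearMap.id)

theorem sub (h : HasFiberDeriv k f v S s) (h' : HasFiberDeriv k g v' S s) :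
    HasFiberDeriv k (fun τ => f τ - g τ) (v - v') S s := by
  simpa only [sub_eq_add_neg] using h.add h'.neg

theorem mul {A : Type*} [Ring A] [Algebra k A] {f g : ℝ → A} {v v' : A}
    (h : HasFiberDeriv k f v S s) (h' : HasFiberDeriv k g v' S s) :
    HasFiberDeriv k (fun τ => f τ * g τ) (v * g s + f s * v') S s := by
  obtain ⟨ι, _, a, a', m, ha, h1, h2, rfl⟩ := h
  obtain ⟨ι', _, b, b', n, hb, h3, h4, rfl⟩ := h'
  refine ⟨ι × ι', inferInstance, fun i τ => a i.1 τ * b i.2 τ,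
    fun i => a' i.1 * b i.2 s + a i.1 s * b' i.2, fun i => m i.1 * n i.2,
    fun i => (ha i.1).mul (hb i.2), ?_, ?_, ?_⟩
  · filter_upwards [h1, h3] with τ h5 h6
    simp only [h5, h6, Finset.sum_mul_sum, Fintype.sum_prod_type, smul_mul_smul_comm]
  · simp only [h2, h4, Finset.sum_mul_sum, Fintype.sum_prod_type, smul_mul_smul_comm]
  · simp only [h2, h4, Finset.sum_mul_sum, Fintype.sum_prod_type, smul_mul_smul_comm, add_smul,
      Finset.sum_add_distrib]

theorem comp {μ : ℝ → ℝ} {μ' r : ℝ} {T : Set ℝ} (h : HasFiberDeriv k f v S (μ r))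
    (hμ : HasDerivWithinAt μ μ' T r) (hT : MapsTo μ T S) :
    HasFiberDeriv k (fun τ => f (μ τ)) ((μ' : k) • v) T r := by
  obtain ⟨ι, _, a, a', m, ha, h1, h2, rfl⟩ := h
  refine ⟨ι, inferInstance, fun i τ => a i (μ τ), fun i => μ' • a' i, m,
    fun i => (ha i).scomp r hμ hT, ?_, h2, ?_⟩
  · exact (hμ.continuousWithinAt.tendsto_nhdsWithin hT).eventually h1
  · rw [Finset.smul_sum]
    refine Finset.sum_congr rfl fun i _ => ?_
    simp only [smul_smul, RCLike.real_smul_eq_coe_mul]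

end HasFiberDeriv

theorem hasFiberDeriv_const (v : V) (S : Set ℝ) (s : ℝ) :
    HasFiberDeriv k (fun _ => v) 0 S s :=
  ⟨Unit, inferInstance, fun _ _ => 1, fun _ => 0, fun _ => v, fun _ => hasDerivWithinAt_const _ _ _,
    by simp, by simp, by simp⟩

theorem hasFiberDeriv_sum {ι : Type} [Fintype ι] {a : ι → ℝ → k} {a' : ι → k} (m : ι → V)
    (ha : ∀ i, HasDerivWithinAt (a i) (a' i) S s) :
    HasFiberDeriv k (fun τ => ∑ i, a i τ • m i) (∑ i, a' i • m i) S s :=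
  ⟨ι, inferInstance, a, a', m, ha, Eventually.of_forall fun _ => rfl, rfl, rfl⟩

/-- Curves with the same derivative on an interval differ by a constant. -/
theorem eq_of_hasFiberDeriv_eq (hS : Convex ℝ S) {v : ℝ → V}
    (hf : ∀ s ∈ S, HasFiberDeriv k f (v s) S s) (hg : ∀ s ∈ S, HasFiberDeriv k g (v s) S s)
    {r : ℝ} (hr : r ∈ S) (hs : s ∈ S) : f s - g s = f r - g r := by
  rw [← sub_eq_zero, ← Module.forall_dual_apply_eq_zero_iff k]
  intro l
  -- After applying a functional the mean value inequality applies, with bound `0`.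
  have hd : ∀ s ∈ S, HasDerivWithinAt (fun τ => l (f τ - g τ)) 0 S s := fun s hs => by
    simpa using ((hf s hs).sub (hg s hs)).hasDerivWithinAt l
  have := hS.norm_image_sub_le_of_norm_hasDerivWithin_le (C := 0) hd (fun s _ => by simp) hr hs
  rw [zero_mul, norm_le_zero_iff] at this
  rw [map_sub, this]

end FiberDeriv

section Graded

variable {k : Type*} {A : Type*} [CommRing k] [Ring A] [Algebra k A] {𝒜 : ℕ → Submodule k A}

theorem gradedProj_mem (h : DirectSum.IsInternal 𝒜) (n : ℕ) (a : A) : gradedProj h n a ∈ 𝒜 n := by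
  refine h.homogeneous_induction (p := fun a => gradedProj h n a ∈ 𝒜 n) (fun m a ha => ?_)
    (fun a b ha hb => by rw [map_add]; exact add_mem ha hb) a
  by_cases hm : m = n
  · subst hm
    rwa [gradedProj_of_mem h ha]
  · rw [gradedProj_of_mem_ne h hm ha]
    exact zero_mem _

end Graded

/-! ### Derivatives and primitives of families of sections -/

namespace NManifold

variable {k : Type v} [RCLike k] {L : NManifold.{u} k} {f g : ℝ → ∀ x, L.fiber x} {s : ℝ}
  {x : L.body}

theorem SmoothFamAt.exists_hasFiberDeriv (h : SmoothFamAt 𝓘(ℝ, ℝ) f s x) :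
    ∃ f' : ℝ → ∀ x, L.fiber x, SmoothFamAt 𝓘(ℝ, ℝ) f' s x ∧
      ∀ᶠ q in 𝓝 (s, x), HasFiberDeriv k (fun τ => f τ q.2) (f' q.1 q.2) univ q.1 := by
  obtain ⟨c, hc, hx⟩ := L.atlas_cover x
  obtain ⟨ι, _, a, w, ha, h⟩ := h c hc hx
  refine ⟨fun s x => ∑ i, timeDeriv (a i) (s, x) • c.word (w i) x,
    smoothFamAt_of_eventually (fun i => (ha i).timeDeriv) (fun i => smoothAt_word hc (w i) hx)
      (Eventually.of_forall fun _ => rfl), ?_⟩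
  filter_upwards [h.eventually_nhds] with q hq
  have h1 := (Continuous.prodMk_left q.2).continuousAt.eventually hq
  exact (hasFiberDeriv_sum (fun i => c.word (w i) q.2) fun i =>
    ((ha i).hasDerivAt_timeDeriv q.1 q.2).hasDerivWithinAt).congr
    (h1.filter_mono nhdsWithin_le_nhds) h1.self_of_nhds

/-- The derivative of a family of sections. -/
def fiberDeriv (f : ℝ → ∀ x, L.fiber x) (s : ℝ) (x : L.body) : L.fiber x :=
  open Classical in
  if h : ∃ v, HasFiberDeriv k (fun τ => f τ x) v univ s then h.choose else 0

theorem _root_.HasFiberDeriv.fiberDeriv_eq {v : L.fiber x}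
    (h : HasFiberDeriv k (fun τ => f τ x) v univ s) : fiberDeriv f s x = v := by
  have h1 : ∃ v, HasFiberDeriv k (fun τ => f τ x) v univ s := ⟨v, h⟩
  rw [fiberDeriv, dif_pos h1]
  exact h1.choose_spec.unique uniqueDiffWithinAt_univ h

theorem SmoothFamAt.hasFiberDeriv (h : SmoothFamAt 𝓘(ℝ, ℝ) f s x) :
    HasFiberDeriv k (fun τ => f τ x) (fiberDeriv f s x) univ s := by
  obtain ⟨f', -, hf⟩ := h.exists_hasFiberDeriv
  have h2 := hf.self_of_nhds
  rwa [h2.fiberDeriv_eq]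

theorem SmoothFamAt.fiberDeriv (h : SmoothFamAt 𝓘(ℝ, ℝ) f s x) :
    SmoothFamAt 𝓘(ℝ, ℝ) (fiberDeriv f) s x := by
  obtain ⟨f', h1, h2⟩ := h.exists_hasFiberDeriv
  exact h1.congr (h2.mono fun q hq => hq.fiberDeriv_eq)

/-- The projection to degree `n` is linear and fixes the curve, hence fixes its derivative. -/
theorem fiberDeriv_mem {n : ℕ} (h : SmoothFamAt 𝓘(ℝ, ℝ) f s x) (hf : ∀ s, f s x ∈ L.deg x n) :
    fiberDeriv f s x ∈ L.deg x n := by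
  have h1 := h.hasFiberDeriv.map (gradedProj (L.deg_internal x) n)
  simp only [gradedProj_of_mem _ (hf _)] at h1
  rw [h.hasFiberDeriv.unique uniqueDiffWithinAt_univ h1]
  exact gradedProj_mem _ _ _

/-- The coefficients are smooth on the manifold with boundary `[0,1]`. Composed with `projIcc`, they
become functions on `ℝ` that are differentiable within `Icc 0 1`, also at its end points. -/
theorem FamSmoothAt.exists_hasFiberDeriv {f : unitInterval → ∀ x, L.fiber x} {t : unitInterval}
    (h : L.FamSmoothAt f t x) :
    ∃ v, HasFiberDeriv k (fun τ : ℝ => f (projIcc 0 1 zero_le_one τ) x) v (Icc 0 1) t := by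
  obtain ⟨c, hc, hx⟩ := L.atlas_cover x
  obtain ⟨ι, _, a, w, ha, h⟩ := h.smoothFamAt c hc hx
  have hd : ∀ i, DifferentiableWithinAt ℝ
      (fun τ : ℝ => a i (projIcc 0 1 zero_le_one τ, x)) (Icc 0 1) t := by
    intro i
    have h1 : ContMDiff (𝓡∂ 1) 𝓘(ℝ, k) ∞ fun τ : unitInterval => a i (τ, x) :=
      (ha i).comp (contMDiff_id.prodMk contMDiff_const)
    have h2 : ContDiffOn ℝ ∞ (fun τ : ℝ => a i (projIcc 0 1 zero_le_one τ, x)) (Icc 0 1) :=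
      contMDiffOn_iff_contDiffOn.1 (h1.comp_contMDiffOn contMDiffOn_projIcc)
    exact h2.differentiableOn (by simp) t t.2
  have h1 : Tendsto (fun τ : ℝ => (projIcc 0 1 zero_le_one τ, x)) (𝓝 (t : ℝ)) (𝓝 (t, x)) := by
    have : ContinuousAt (fun τ : ℝ => (projIcc 0 1 zero_le_one τ, x)) (t : ℝ) :=
      (continuous_projIcc.prodMk continuous_const).continuousAt
    simpa [ContinuousAt] using this
  have h2 := h1.eventually h
  exact ⟨_, (hasFiberDeriv_sum (fun i => c.word (w i) x) fun i =>
    (hd i).hasDerivWithinAt).congr (h2.filter_mono nhdsWithin_le_nhds) h2.self_of_nhds⟩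

end NManifold

/-- A cut-off function which is `1` on `[0,1]` and is supported in `[-1,2]`. -/
def unitCutoff : ContDiffBump (1 / 2 : ℝ) := ⟨1, 3 / 2, one_pos, by norm_num⟩

theorem unitCutoff_eq_one {s : ℝ} (hs : s ∈ Icc (0 : ℝ) 1) : unitCutoff s = 1 := by
  apply unitCutoff.one_of_mem_closedBall
  change dist s (1 / 2) ≤ 1
  rw [Real.dist_eq, abs_le]
  constructor <;> linarith [hs.1, hs.2]

theorem unitCutoff_eq_zero {s : ℝ} (hs : s ∉ Icc (-1 : ℝ) 2) : unitCutoff s = 0 := by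
  apply unitCutoff.zero_of_le_dist
  change 3 / 2 ≤ dist s (1 / 2)
  by_contra! h
  rw [Real.dist_eq, abs_lt] at h
  exact hs ⟨by linarith [h.1], by linarith [h.2]⟩

/-! ### Normal forms uniform in time, and primitives -/

namespace NManifold

variable {k : Type v} [RCLike k] {L : NManifold.{u} k} {f g : ℝ → ∀ x, L.fiber x}

/-- After multiplication with the cut-off function, a smooth family of sections is a polynomial in
the coordinates, with smooth coefficients, for all times and near a point of the body. -/
theorem exists_normal_form_cutoff (hg : ∀ s x, SmoothFamAt 𝓘(ℝ, ℝ) g s x)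
    {c : GradedCoords k L.deg} (hc : c ∈ L.atlas) {x : L.body} (hx : x ∈ c.dom) :
    ∃ (ι : Type) (_ : Fintype ι) (a : ι → ℝ × L.body → k) (w : ι → List (Fin c.rank)),
      (∀ i, ContMDiff (𝓘(ℝ, ℝ).prod 𝓘(ℝ, L.E)) 𝓘(ℝ, k) ∞ (a i)) ∧
      ∀ᶠ y in 𝓝 x, ∀ s, (unitCutoff s : k) • g s y = ∑ i, a i (s, y) • c.word (w i) y := by
  have h1 : ∀ s : ℝ, ∃ (U : Set ℝ) (W : Set L.body) (ι : Type) (_ : Fintype ι)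
      (a : ι → ℝ × L.body → k) (w : ι → List (Fin c.rank)), IsOpen U ∧ s ∈ U ∧ W ∈ 𝓝 x ∧
      (∀ i, ContMDiff (𝓘(ℝ, ℝ).prod 𝓘(ℝ, L.E)) 𝓘(ℝ, k) ∞ (a i)) ∧
      ∀ s ∈ U, ∀ y ∈ W, g s y = ∑ i, a i (s, y) • c.word (w i) y := by
    intro s
    obtain ⟨ι, _, a, w, ha, h⟩ := hg s x c hc hx
    obtain ⟨U, hU, W, hW, h⟩ := mem_nhds_prod_iff.1 h
    obtain ⟨U', hU', hUo, hs⟩ := mem_nhds_iff.1 hU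
    exact ⟨U', W, ι, inferInstance, a, w, hUo, hs, hW, ha,
      fun s hs y hy => h (mk_mem_prod (hU' hs) hy)⟩
  choose U W ι hι a w hU hsU hW ha hg' using h1
  -- The normal forms at single times live on neighbourhoods of `x` that may shrink with time.
  -- Compactness of `[-1,2]`, which contains the support of the cut-off, leaves finitely many, to be
  -- glued by a partition of unity in time.
  obtain ⟨T, hT⟩ := (isCompact_Icc (a := (-1 : ℝ)) (b := 2)).elim_finite_subcover U hU
    fun s _ => mem_iUnion.2 ⟨s, hsU s⟩
  obtain ⟨ψ, hψ⟩ := SmoothPartitionOfUnity.exists_isSubordinate 𝓘(ℝ, ℝ)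
    (isClosed_Icc (a := (-1 : ℝ)) (b := 2)) (fun i : T => U i) (fun i => hU i)
    (fun s hs => by simpa using hT hs)
  refine ⟨Σ i : T, ι i, inferInstance,
    fun i q => ((unitCutoff q.1 * ψ i.1 q.1 : ℝ) : k) * a i.1 i.2 q, fun i => w i.1 i.2, ?_, ?_⟩
  · intro i
    refine ContMDiff.mul_scalar ?_ (ha _ _)
    have h2 : ContDiff ℝ ∞ fun s : ℝ => RCLike.ofRealCLM (K := k) (unitCutoff s * ψ i.1 s) :=
      (RCLike.ofRealCLM (K := k)).contDiff.comp
        (unitCutoff.contDiff.mul (ψ i.1).contMDiff.contDiff)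
    exact h2.contMDiff.comp contMDiff_fst
  · have h3 : ∀ᶠ y in 𝓝 x, ∀ i : T, y ∈ W i := eventually_all.2 fun i => hW i
    filter_upwards [h3] with y hy s
    rw [Fintype.sum_sigma]
    by_cases hs : s ∈ Icc (-1 : ℝ) 2
    · have h4 : ∑ i : T, ψ i s = 1 := by
        rw [← finsum_eq_sum_of_fintype]
        exact ψ.sum_eq_one hs
      have h5 : ∀ i : T, ((unitCutoff s * ψ i s : ℝ) : k) • g s y =
          ∑ j, (((unitCutoff s * ψ i s : ℝ) : k) * a i j (s, y)) • c.word (w i j) y := by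
        intro i
        by_cases hi : s ∈ U i
        · rw [hg' i s hi y (hy i), Finset.smul_sum]
          simp only [mul_smul]
        · have : ψ i s = 0 := by
            by_contra h6
            exact hi (hψ i (subset_tsupport _ h6))
          simp [this]
      rw [← Finset.sum_congr rfl fun i _ => h5 i, ← Finset.sum_smul, ← RCLike.ofReal_sum,
        ← Finset.mul_sum, h4, mul_one]
    · simp [unitCutoff_eq_zero hs]

/-- A smooth family, multiplied with the cut-off function, has a smooth primitive. -/
theorem exists_primitive (hg : ∀ s x, SmoothFamAt 𝓘(ℝ, ℝ) g s x) {n : ℕ}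
    (hn : ∀ s x, g s x ∈ L.deg x n) :
    ∃ G : ℝ → ∀ x, L.fiber x, (∀ s x, SmoothFamAt 𝓘(ℝ, ℝ) G s x) ∧
      (∀ s x, G s x ∈ L.deg x n) ∧ (∀ x, G 0 x = 0) ∧
      ∀ s x, HasFiberDeriv k (fun τ => G τ x) ((unitCutoff s : k) • g s x) univ s := by
  have h1 : ∀ x : L.body, ∀ c ∈ L.atlas, x ∈ c.dom → ∃ (ι : Type) (_ : Fintype ι)
      (A : ι → ℝ × L.body → k) (w : ι → List (Fin c.rank)),
      (∀ i, ContMDiff (𝓘(ℝ, ℝ).prod 𝓘(ℝ, L.E)) 𝓘(ℝ, k) ∞ (A i)) ∧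
      ∀ᶠ y in 𝓝 x, ∑ i, A i (0, y) • c.word (w i) y = 0 ∧
        ∀ s, HasFiberDeriv k (fun τ => ∑ i, A i (τ, y) • c.word (w i) y)
          ((unitCutoff s : k) • g s y) univ s := by
    intro x c hc hx
    obtain ⟨ι, _, a, w, ha, h⟩ := exists_normal_form_cutoff hg hc hx
    choose A hA hA0 hAd using fun i => (ha i).exists_primitive
    refine ⟨ι, inferInstance, A, w, hA, ?_⟩
    filter_upwards [h] with y hy
    refine ⟨by simp [hA0], fun s => ?_⟩
    rw [hy s]
    exact hasFiberDeriv_sum _ fun i => (hAd i s y).hasDerivWithinAt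
  have h2 : ∀ x : L.body, ∃ G : ℝ → L.fiber x, G 0 = 0 ∧
      ∀ s, HasFiberDeriv k G ((unitCutoff s : k) • g s x) univ s := by
    intro x
    obtain ⟨c, hc, hx⟩ := L.atlas_cover x
    obtain ⟨ι, _, A, w, -, h⟩ := h1 x c hc hx
    exact ⟨fun τ => ∑ i, A i (τ, x) • c.word (w i) x, h.self_of_nhds⟩
  choose G hG0 hG using h2
  -- A primitive vanishing at time `0` is unique. Hence the pointwise choices `G x` agree with the
  -- smooth local primitives of `h1`.
  have huniq : ∀ x (G' : ℝ → L.fiber x), G' 0 = 0 →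
      (∀ s, HasFiberDeriv k G' ((unitCutoff s : k) • g s x) univ s) → G' = G x := by
    intro x G' h0 h'
    funext s
    have := eq_of_hasFiberDeriv_eq convex_univ (fun s _ => h' s) (fun s _ => hG x s)
      (mem_univ 0) (mem_univ s)
    rwa [h0, hG0, sub_zero, sub_eq_zero] at this
  refine ⟨fun s x => G x s, fun s x c hc hx => ?_, fun s x => ?_, hG0, fun s x => hG x s⟩
  · obtain ⟨ι, _, A, w, hA, h⟩ := h1 x c hc hx
    refine ⟨ι, inferInstance, A, w, hA, ?_⟩
    filter_upwards [(continuous_snd.continuousAt (x := (s, x))).eventually h] with q hq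
    rw [← huniq q.2 _ hq.1 hq.2]
  · have h3 := huniq x (fun s => gradedProj (L.deg_internal x) n (G x s)) (by simp [hG0])
      fun s => by
        have h4 := (hG x s).map (gradedProj (L.deg_internal x) n)
        rwa [map_smul, gradedProj_of_mem _ (hn s x)] at h4
    have h4 : gradedProj (L.deg_internal x) n (G x s) = G x s := congrFun h3 s
    change G x s ∈ L.deg x n
    rw [← h4]
    exact gradedProj_mem _ _ _

end NManifold

end

noncomputable section

/-! ### Directional derivatives of smooth functions on `ℝ × B` -/

section DirDeriv

variable {E : Type*} [NormedAddCommGroup E] [NormedSpace ℝ E] {B : Type*} [TopologicalSpace B]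
  [ChartedSpace E B] {F : Type*} [NormedAddCommGroup F] [NormedSpace ℝ F]

/-- The derivative of `a` in the direction `e` of a global chart `Φ` with inverse `Θ`. -/
def dirDeriv (Φ : B → E) (Θ : E → B) (e : E) (a : ℝ × B → F) (q : ℝ × B) : F :=
  fderiv ℝ (fun p : ℝ × E => a (p.1, Θ p.2)) (q.1, Φ q.2) (0, e)

variable {Φ : B → E} {Θ : E → B} {a : ℝ × B → F}

theorem ContMDiff.dirDeriv (ha : ContMDiff (𝓘(ℝ, ℝ).prod 𝓘(ℝ, E)) 𝓘(ℝ, F) ∞ a)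
    (hΦ : ContMDiff 𝓘(ℝ, E) 𝓘(ℝ, E) ∞ Φ) (hΘ : ContMDiff 𝓘(ℝ, E) 𝓘(ℝ, E) ∞ Θ) (e : E) :
    ContMDiff (𝓘(ℝ, ℝ).prod 𝓘(ℝ, E)) 𝓘(ℝ, F) ∞ (dirDeriv Φ Θ e a) := by
  have h1 : ContDiff ℝ ∞ fun q : ℝ × E =>
      fderiv ℝ (fun p : ℝ × E => a (p.1, Θ p.2)) q (0, e) :=
    ((ha.prod_global_chart hΘ).fderiv_right (m := ∞) le_rfl).clm_apply contDiff_const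
  exact (contMDiff_prod_self_iff.2 h1).comp (contMDiff_fst.prodMk (hΦ.comp contMDiff_snd))

theorem ContMDiff.dirDeriv_eq (ha : ContMDiff (𝓘(ℝ, ℝ).prod 𝓘(ℝ, E)) 𝓘(ℝ, F) ∞ a)
    (hΘ : ContMDiff 𝓘(ℝ, E) 𝓘(ℝ, E) ∞ Θ) (e : E) (s : ℝ) (x : B) :
    _root_.dirDeriv Φ Θ e a (s, x) = fderiv ℝ (fun y => a (s, Θ y)) (Φ x) e := by
  have h1 := (((ha.prod_global_chart hΘ).differentiable (by simp)) (s, Φ x)).hasFDerivAt.comp (Φ x)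
    ((hasFDerivAt_const s (Φ x)).prodMk (hasFDerivAt_id (Φ x)))
  have h2 : fderiv ℝ (fun y => a (s, Θ y)) (Φ x) = _ := h1.fderiv
  rw [h2]
  simp [_root_.dirDeriv]

/-- Time and space derivatives commute because the second derivative is symmetric (`h3`). This is
the analytic source of the commutation of `Q` with `∂_s`. -/
theorem ContMDiff.hasDerivAt_dirDeriv (ha : ContMDiff (𝓘(ℝ, ℝ).prod 𝓘(ℝ, E)) 𝓘(ℝ, F) ∞ a)
    (hΘ : ContMDiff 𝓘(ℝ, E) 𝓘(ℝ, E) ∞ Θ) (e : E) (s : ℝ) (x : B) :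
    HasDerivAt (fun s => _root_.dirDeriv Φ Θ e a (s, x))
      (_root_.dirDeriv Φ Θ e (_root_.timeDeriv a) (s, x)) s := by
  have hb := ha.prod_global_chart hΘ
  have hb' := hb.fderiv_right (m := ∞) le_rfl
  have h1 : (fun p : ℝ × E => _root_.timeDeriv a (p.1, Θ p.2)) =
      fun p => fderiv ℝ (fun p : ℝ × E => a (p.1, Θ p.2)) p (1, 0) := by
    funext p
    exact (hasDerivAt_fst hb p.1 p.2).deriv
  have h2 := (hasDerivAt_fst hb' s (Φ x)).clm_apply (hasDerivAt_const s ((0 : ℝ), e))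
  have h3 : IsSymmSndFDerivAt ℝ (fun p : ℝ × E => a (p.1, Θ p.2)) (s, Φ x) :=
    hb.contDiffAt.isSymmSndFDerivAt (by simpa using (show (2 : ℕ∞ω) ≤ ∞ from WithTop.coe_le_coe.2 (le_top : (2 : ℕ∞) ≤ ⊤)))
  have h4 : HasFDerivAt (fun p => fderiv ℝ (fun p : ℝ × E => a (p.1, Θ p.2)) p (1, 0))
      ((fderiv ℝ (fderiv ℝ fun p : ℝ × E => a (p.1, Θ p.2)) (s, Φ x)).flip (1, 0)) (s, Φ x) := by
    refine ((((hb'.differentiable (by simp)) (s, Φ x)).hasFDerivAt).clm_apply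
      (hasFDerivAt_const ((1 : ℝ), (0 : E)) (s, Φ x))).congr_fderiv ?_
    refine ContinuousLinearMap.ext fun v => ?_
    rw [ContinuousLinearMap.comp_zero, zero_add]
  rw [_root_.dirDeriv, h1, h4.fderiv, ContinuousLinearMap.flip_apply, h3.eq]
  simp only [map_zero, add_zero] at h2
  exact h2

end DirDeriv

/-! ### Homological vector fields -/

namespace NManifold

variable {k : Type v} [RCLike k] {L : NManifold.{u} k}

theorem scalar_mem_fn {a : L.body → k} (ha : ContMDiff 𝓘(ℝ, L.E) 𝓘(ℝ, k) ∞ a) :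
    (fun x => algebraMap k (L.fiber x) (a x)) ∈ L.fn 0 :=
  ⟨fun x => by
    beta_reduce
    rw [Algebra.algebraMap_eq_smul_one]
    exact Submodule.smul_mem _ _ (SetLike.GradedOne.one_mem (A := L.deg x)),
    smoothAt_scalar ha⟩

theorem mul_mem_fn {n m : ℕ} {f g : ∀ x, L.fiber x} (hf : f ∈ L.fn n) (hg : g ∈ L.fn m) :
    f * g ∈ L.fn (n + m) :=
  (fnMul ⟨f, hf⟩ ⟨g, hg⟩).2

theorem smul_mem_fn {n : ℕ} {a : L.body → k} (ha : ContMDiff 𝓘(ℝ, L.E) 𝓘(ℝ, k) ∞ a)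
    {f : ∀ x, L.fiber x} (hf : f ∈ L.fn n) : (fun x => a x • f x) ∈ L.fn n := by
  have h := mul_mem_fn (scalar_mem_fn ha) hf
  rw [zero_add] at h
  convert! h using 1
  funext x
  exact Algebra.smul_def _ _

end NManifold

/-! ### Locality and coordinate formula of the homological vector field -/

namespace NQManifold

open NManifold

variable {k : Type v} [RCLike k] {L : NQManifold.{u} k}

variable (L) in
/-- The homological vector field on homogeneous functions, without reference to the degree. -/
def vf (f : ∀ x, L.fiber x) : ∀ x, L.fiber x :=
  open Classical in if h : ∃ n, f ∈ L.fn n then (L.Q h.choose ⟨f, h.choose_spec⟩).1 else 0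

variable {n m : ℕ} {f g : ∀ x, L.fiber x}

/-- Only the zero function is homogeneous of two different degrees, so the degree chosen in `vf`
does not matter. Working with `vf` avoids casts between degrees such as `n + 1 + m` and `n + m + 1`.
-/
theorem vf_eq (hf : f ∈ L.fn n) : L.vf f = (L.Q n ⟨f, hf⟩).1 := by
  have h : ∃ n, f ∈ L.fn n := ⟨n, hf⟩
  rw [vf, dif_pos h]
  have key : ∀ m (hm : f ∈ L.fn m), (L.Q m ⟨f, hm⟩).1 = (L.Q n ⟨f, hf⟩).1 := by
    intro m hm
    by_cases hmn : m = n
    · subst hmn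
      rfl
    · have h0 : f = 0 := by
        funext x
        rw [← gradedProj_of_mem (L.deg_internal x) (hf.1 x),
          gradedProj_of_mem_ne (L.deg_internal x) hmn (hm.1 x)]
        rfl
      subst h0
      have e1 : (⟨0, hm⟩ : L.fn m) = 0 := rfl
      have e2 : (⟨0, hf⟩ : L.fn n) = 0 := rfl
      rw [e1, e2, map_zero, map_zero]
      rfl
  exact key _ _

theorem vf_val (f : L.fn n) : L.vf f.1 = (L.Q n f).1 := vf_eq f.2

theorem vf_mem (hf : f ∈ L.fn n) : L.vf f ∈ L.fn (n + 1) := vf_eq hf ▸ (L.Q n ⟨f, hf⟩).2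

theorem vf_add (hf : f ∈ L.fn n) (hg : g ∈ L.fn n) : L.vf (f + g) = L.vf f + L.vf g := by
  rw [vf_eq hf, vf_eq hg, vf_eq (add_mem hf hg)]
  exact congrArg Subtype.val ((L.Q n).map_add ⟨f, hf⟩ ⟨g, hg⟩)

theorem vf_smul (r : k) (hf : f ∈ L.fn n) : L.vf (r • f) = r • L.vf f := by
  rw [vf_eq hf, vf_eq (Submodule.smul_mem _ r hf)]
  exact congrArg Subtype.val ((L.Q n).map_smul r ⟨f, hf⟩)

theorem vf_zero : L.vf 0 = 0 := by
  rw [vf_eq (zero_mem (L.fn 0))]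
  exact congrArg Subtype.val ((L.Q 0).map_zero)

theorem vf_sum {ι : Type*} (S : Finset ι) {f : ι → ∀ x, L.fiber x}
    (hf : ∀ i ∈ S, f i ∈ L.fn n) : L.vf (∑ i ∈ S, f i) = ∑ i ∈ S, L.vf (f i) := by
  classical
  induction S using Finset.induction_on with
  | empty => simp [vf_zero]
  | insert i S hi ih =>
    rw [Finset.sum_insert hi, Finset.sum_insert hi,
      vf_add (hf i (Finset.mem_insert_self i S))
        (sum_mem fun j hj => hf j (Finset.mem_insert_of_mem hj)),
      ih fun j hj => hf j (Finset.mem_insert_of_mem hj)]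

theorem vf_mul (hf : f ∈ L.fn n) (hg : g ∈ L.fn m) :
    L.vf (f * g) = L.vf f * g + (-1) ^ n * (f * L.vf g) := by
  rw [vf_eq hf, vf_eq hg, vf_eq (mul_mem_fn hf hg)]
  exact L.Q_mul n m ⟨f, hf⟩ ⟨g, hg⟩

theorem vf_vf (hf : f ∈ L.fn n) : L.vf (L.vf f) = 0 := by
  rw [vf_eq (vf_mem hf)]
  simp only [vf_eq hf]
  exact congrArg Subtype.val (L.Q_sq n ⟨f, hf⟩)

/-- A derivation is local: for a bump `χ` supported where `f = g` one has `χ f = χ g`. In the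
Leibniz rule at `x` the terms with the derivative of `χ` agree on both sides, since `f x = g x`. -/
theorem vf_congr {x : L.body} (hf : f ∈ L.fn n) (hg : g ∈ L.fn n) (e : ∀ᶠ y in 𝓝 x, f y = g y) :
    L.vf f x = L.vf g x := by
  obtain ⟨χ, hχ, hχ1, hχ0⟩ := exists_smooth_bump k (E := L.E) e
  have hχm := scalar_mem_fn (L := L.toNManifold) hχ
  have h1 : (fun y => algebraMap k (L.fiber y) (χ y)) * f =
      (fun y => algebraMap k (L.fiber y) (χ y)) * g := by
    funext y
    by_cases hy : f y = g y
    · simp [hy]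
    · simp [(hχ0 y hy).self_of_nhds]
  have h2 := congrFun (congrArg L.vf h1) x
  rw [vf_mul hχm hf, vf_mul hχm hg] at h2
  simpa [e.self_of_nhds, hχ1.self_of_nhds] using h2

theorem vf_smul_fun {a : L.body → k} (ha : ContMDiff 𝓘(ℝ, L.E) 𝓘(ℝ, k) ∞ a) (hf : f ∈ L.fn n)
    (x : L.body) :
    L.vf (fun x => a x • f x) x =
      L.vf (fun x => algebraMap k (L.fiber x) (a x)) x * f x + a x • L.vf f x := by
  have h1 : (fun x => a x • f x) = (fun x => algebraMap k (L.fiber x) (a x)) * f := by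
    funext x
    exact Algebra.smul_def _ _
  rw [h1, vf_mul (scalar_mem_fn ha) hf]
  simp [Algebra.smul_def]

theorem vf_const (r : k) : L.vf (fun x => algebraMap k (L.fiber x) r) = 0 := by
  have h1 : L.vf (1 : ∀ x, L.fiber x) = 0 := by
    have h0 : (1 : ∀ x, L.fiber x) ∈ L.fn 0 := by
      convert! scalar_mem_fn (L := L.toNManifold) (contMDiff_const (c := (1 : k))) using 1
      funext x
      simp
    -- From `1 = 1 * 1` the Leibniz rule gives `Q 1 = 2 Q 1`.
    have h2 := vf_mul h0 h0
    simpa using h2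
  have h0 : (1 : ∀ x, L.fiber x) ∈ L.fn 0 := by
    convert! scalar_mem_fn (L := L.toNManifold) (contMDiff_const (c := (1 : k))) using 1
    funext x
    simp
  have h3 : (fun x => algebraMap k (L.fiber x) r) = r • (1 : ∀ x, L.fiber x) := by
    funext x
    simp [Algebra.algebraMap_eq_smul_one]
  rw [h3, vf_smul r h0, h1, smul_zero]

/-- The coordinates of a global chart as functions on an NQ-manifold. -/
def chartCoord (L : NQManifold.{u} k) (Φ : L.body → L.E) (j : Fin (Module.finrank ℝ L.E)) :
    L.body → k :=
  fun z => (((Module.finBasis ℝ L.E).repr (Φ z) j : ℝ) : k)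

theorem contMDiff_chartCoord {Φ : L.body → L.E} (hΦ : ContMDiff 𝓘(ℝ, L.E) 𝓘(ℝ, L.E) ∞ Φ)
    (j : Fin (Module.finrank ℝ L.E)) : ContMDiff 𝓘(ℝ, L.E) 𝓘(ℝ, k) ∞ (L.chartCoord Φ j) := by
  have h1 : ContDiff ℝ ∞ fun y : L.E =>
      RCLike.ofRealCLM (K := k) (LinearMap.toContinuousLinearMap
        ((Module.finBasis ℝ L.E).coord j) y) :=
    (RCLike.ofRealCLM (K := k)).contDiff.comp (ContinuousLinearMap.contDiff _)
  exact h1.contMDiff.comp hΦ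

/-- The homological vector field on functions on the body, in coordinates. -/
theorem vf_scalar {Φ : L.body → L.E} {Θ : L.E → L.body} {x : L.body}
    (hΦ : ContMDiff 𝓘(ℝ, L.E) 𝓘(ℝ, L.E) ∞ Φ) (hΘ : ContMDiff 𝓘(ℝ, L.E) 𝓘(ℝ, L.E) ∞ Θ)
    (e : ∀ᶠ z in 𝓝 x, Θ (Φ z) = z) {a : L.body → k} (ha : ContMDiff 𝓘(ℝ, L.E) 𝓘(ℝ, k) ∞ a) :
    L.vf (fun x => algebraMap k (L.fiber x) (a x)) x =
      ∑ j, fderiv ℝ (fun y => a (Θ y)) (Φ x) (Module.finBasis ℝ L.E j) •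
        L.vf (fun x => algebraMap k (L.fiber x) (L.chartCoord Φ j x)) x := by
  -- Near `x`, Hadamard's lemma writes `a` as the constant `a x` plus a sum of smooth `g_j` times
  -- `ξ_j - ξ_j(x)`. The second factors vanish at `x`, so only the terms `g_j(x) Q ξ_j` survive.
  obtain ⟨g, hg, hgx, h⟩ := ha.exists_slope hΘ hΦ e
  have hξ := contMDiff_chartCoord (L := L) hΦ
  have hgj : ∀ j, ContMDiff 𝓘(ℝ, L.E) 𝓘(ℝ, k) ∞ fun z => g z (Module.finBasis ℝ L.E j) := by
    intro j
    have h1 : ContDiff ℝ ∞ fun G : L.E →L[ℝ] k => G (Module.finBasis ℝ L.E j) :=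
      contDiff_id.clm_apply contDiff_const
    exact h1.contMDiff.comp hg
  have hξ' : ∀ j, ContMDiff 𝓘(ℝ, L.E) 𝓘(ℝ, k) ∞
      fun z => L.chartCoord Φ j z + -L.chartCoord Φ j x := by
    intro j
    have h1 : ContDiff ℝ ∞ fun r : k => r + -L.chartCoord Φ j x :=
      contDiff_id.add contDiff_const
    exact h1.contMDiff.comp (hξ j)
  let T : Fin (Module.finrank ℝ L.E) → ∀ z, L.fiber z := fun j z =>
    g z (Module.finBasis ℝ L.E j) •
      algebraMap k (L.fiber z) (L.chartCoord Φ j z + -L.chartCoord Φ j x)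
  have hT : ∀ j, T j ∈ L.fn 0 := fun j => smul_mem_fn (hgj j) (scalar_mem_fn (hξ' j))
  have hax := scalar_mem_fn (L := L.toNManifold) (contMDiff_const (c := a x))
  have hsum : (∑ j, T j) ∈ L.fn 0 := sum_mem fun j _ => hT j
  have e1 : ∀ᶠ z in 𝓝 x, algebraMap k (L.fiber z) (a z) =
      ((fun z => algebraMap k (L.fiber z) (a x)) + ∑ j, T j) z := by
    filter_upwards [h] with z hz
    have h1 : g z (Φ z - Φ x) =
        ∑ j, (L.chartCoord Φ j z + -L.chartCoord Φ j x) * g z (Module.finBasis ℝ L.E j) := by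
      conv_lhs => rw [← (Module.finBasis ℝ L.E).sum_repr (Φ z - Φ x)]
      rw [map_sum]
      refine Finset.sum_congr rfl fun j _ => ?_
      rw [map_smul, RCLike.real_smul_eq_coe_mul]
      simp [chartCoord, sub_eq_add_neg]
    rw [hz, h1, map_add, map_sum, Pi.add_apply, Finset.sum_apply]
    congr 1
    refine Finset.sum_congr rfl fun j _ => ?_
    rw [mul_comm, map_mul, ← Algebra.smul_def]
  rw [vf_congr (scalar_mem_fn ha) (add_mem hax hsum) e1, vf_add hax hsum, vf_const, zero_add,
    vf_sum _ fun j _ => hT j, Finset.sum_apply]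
  refine Finset.sum_congr rfl fun j _ => ?_
  have h2 : L.vf (fun z => algebraMap k (L.fiber z) (L.chartCoord Φ j z + -L.chartCoord Φ j x)) =
      L.vf (fun z => algebraMap k (L.fiber z) (L.chartCoord Φ j z)) := by
    have h3 : (fun z => algebraMap k (L.fiber z) (L.chartCoord Φ j z + -L.chartCoord Φ j x)) =
        (fun z => algebraMap k (L.fiber z) (L.chartCoord Φ j z)) +
          fun z => algebraMap k (L.fiber z) (-L.chartCoord Φ j x) := by
      funext z
      simp
    rw [h3, vf_add (scalar_mem_fn (hξ j)) (scalar_mem_fn contMDiff_const), vf_const, add_zero]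
  rw [vf_smul_fun (hgj j) (scalar_mem_fn (hξ' j)), h2, hgx]
  simp

variable {F : ℝ → ∀ x, L.fiber x}

/-- The homological vector field on a smooth family of functions, in coordinates. -/
theorem vf_family {Φ : L.body → L.E} {Θ : L.E → L.body} {x : L.body}
    (hΦ : ContMDiff 𝓘(ℝ, L.E) 𝓘(ℝ, L.E) ∞ Φ) (hΘ : ContMDiff 𝓘(ℝ, L.E) 𝓘(ℝ, L.E) ∞ Θ)
    (e : ∀ᶠ z in 𝓝 x, Θ (Φ z) = z) {ι : Type} [Fintype ι] {a : ι → ℝ × L.body → k}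
    {m : ι → L.fn n} (ha : ∀ i, ContMDiff (𝓘(ℝ, ℝ).prod 𝓘(ℝ, L.E)) 𝓘(ℝ, k) ∞ (a i)) {s : ℝ}
    (hf : f ∈ L.fn n) (h : ∀ᶠ z in 𝓝 x, f z = ∑ i, a i (s, z) • (m i).1 z) :
    L.vf f x = ∑ p : ι × Fin (Module.finrank ℝ L.E),
        dirDeriv Φ Θ (Module.finBasis ℝ L.E p.2) (a p.1) (s, x) •
          (L.vf (fun x => algebraMap k (L.fiber x) (L.chartCoord Φ p.2 x)) x * (m p.1).1 x) +
      ∑ i, a i (s, x) • L.vf (m i).1 x := by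
  have has : ∀ i, ContMDiff 𝓘(ℝ, L.E) 𝓘(ℝ, k) ∞ fun z => a i (s, z) := fun i =>
    (ha i).comp (contMDiff_const.prodMk contMDiff_id)
  have hm : ∀ i, (fun z => a i (s, z) • (m i).1 z) ∈ L.fn n := fun i => smul_mem_fn (has i) (m i).2
  have h' : ∀ᶠ z in 𝓝 x, f z = (∑ i, fun z => a i (s, z) • (m i).1 z) z := by
    filter_upwards [h] with z hz
    rw [hz, Finset.sum_apply]
  rw [vf_congr hf (sum_mem fun i _ => hm i) h', vf_sum _ fun i _ => hm i, Finset.sum_apply,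
    Fintype.sum_prod_type, ← Finset.sum_add_distrib]
  refine Finset.sum_congr rfl fun i _ => ?_
  rw [vf_smul_fun (has i) (m i).2, vf_scalar hΦ hΘ e (has i), Finset.sum_mul]
  congr 1
  refine Finset.sum_congr rfl fun j _ => ?_
  rw [(ha i).dirDeriv_eq hΘ, smul_mul_assoc]

theorem smoothFamAt_mem_fn (hF : ∀ s x, SmoothFamAt 𝓘(ℝ, ℝ) F s x)
    (hn : ∀ s x, F s x ∈ L.deg x n) (s : ℝ) : F s ∈ L.fn n :=
  ⟨hn s, fun x => (hF s x).slice⟩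

/-- The formula of `vf_family` holds at all nearby times and points with the same global functions
`m i`, so time enters only through `a i` and its space derivatives. These are smooth, and
differentiating them in time gives the same formula for the family with coefficients `timeDeriv (a
i)`. -/
theorem smoothFamAt_vf_aux (hF : ∀ s x, SmoothFamAt 𝓘(ℝ, ℝ) F s x)
    (hn : ∀ s x, F s x ∈ L.deg x n) (s : ℝ) (x : L.body) :
    SmoothFamAt 𝓘(ℝ, ℝ) (fun s => L.vf (F s)) s x ∧
      HasFiberDeriv k (fun τ => L.vf (F τ) x) (L.vf (fiberDeriv F s) x) univ s := by
  obtain ⟨Φ, Θ, hΦ, hΘ, e⟩ := exists_global_chart (E := L.E) x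
  obtain ⟨ι, _, a, m, ha, h⟩ := (hF s x).exists_fn hn
  have hmem := smoothFamAt_mem_fn hF hn
  have hξ : ∀ j, L.vf (fun x => algebraMap k (L.fiber x) (L.chartCoord Φ j x)) ∈ L.fn 1 := fun j =>
    vf_mem (scalar_mem_fn (contMDiff_chartCoord hΦ j))
  have key : ∀ᶠ q : ℝ × L.body in 𝓝 (s, x), L.vf (F q.1) q.2 =
      ∑ p : ι × Fin (Module.finrank ℝ L.E),
        dirDeriv Φ Θ (Module.finBasis ℝ L.E p.2) (a p.1) q •
          (L.vf (fun x => algebraMap k (L.fiber x) (L.chartCoord Φ p.2 x)) q.2 * (m p.1).1 q.2) +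
      ∑ i, a i q • L.vf (m i).1 q.2 := by
    filter_upwards [h.eventually_nhds,
      (continuous_snd.continuousAt (x := (s, x))).eventually e.eventually_nhds] with q h1 h2
    exact vf_family hΦ hΘ h2 ha (hmem q.1)
      ((Continuous.prodMk_right q.1).continuousAt.eventually h1)
  have e1 := (Continuous.prodMk_left x).continuousAt.eventually key
  constructor
  · have h1 : SmoothFamAt 𝓘(ℝ, ℝ) (fun s x => ∑ p : ι × Fin (Module.finrank ℝ L.E),
        dirDeriv Φ Θ (Module.finBasis ℝ L.E p.2) (a p.1) (s, x) •
          (L.vf (fun x => algebraMap k (L.fiber x) (L.chartCoord Φ p.2 x)) x * (m p.1).1 x)) s x :=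
      smoothFamAt_of_eventually
        (m := fun (p : ι × Fin (Module.finrank ℝ L.E)) x =>
          L.vf (fun x => algebraMap k (L.fiber x) (L.chartCoord Φ p.2 x)) x * (m p.1).1 x)
        (fun p => (ha p.1).dirDeriv hΦ hΘ _)
        (fun p => ((hξ p.2).2 x).mul ((m p.1).2.2 x)) (Eventually.of_forall fun _ => rfl)
    have h2 : SmoothFamAt 𝓘(ℝ, ℝ) (fun s x => ∑ i, a i (s, x) • L.vf (m i).1 x) s x :=
      smoothFamAt_of_eventually ha (m := fun i => L.vf (m i).1)
        (fun i => (vf_mem (m i).2).2 x) (Eventually.of_forall fun _ => rfl)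
    exact (h1.add h2).congr key
  · have hd : ∀ᶠ z in 𝓝 x, fiberDeriv F s z = ∑ i, timeDeriv (a i) (s, z) • (m i).1 z := by
      have h1 : ∀ᶠ q in 𝓝 (s, x), fiberDeriv F q.1 q.2 = ∑ i, timeDeriv (a i) q • (m i).1 q.2 := by
        filter_upwards [h.eventually_nhds] with q hq
        have h2 := (Continuous.prodMk_left q.2).continuousAt.eventually hq
        exact ((hasFiberDeriv_sum (fun i => (m i).1 q.2) fun i =>
          ((ha i).hasDerivAt_timeDeriv q.1 q.2).hasDerivWithinAt).congr
          (h2.filter_mono nhdsWithin_le_nhds) h2.self_of_nhds).fiberDeriv_eq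
      exact (Continuous.prodMk_right s).continuousAt.eventually h1
    rw [vf_family hΦ hΘ e (fun i => (ha i).timeDeriv)
      (smoothFamAt_mem_fn (F := fiberDeriv F) (fun s x => (hF s x).fiberDeriv)
        (fun s x => fiberDeriv_mem (hF s x) fun s => hn s x) s) hd]
    have d1 : HasFiberDeriv k (fun τ => ∑ p : ι × Fin (Module.finrank ℝ L.E),
        dirDeriv Φ Θ (Module.finBasis ℝ L.E p.2) (a p.1) (τ, x) •
          (L.vf (fun x => algebraMap k (L.fiber x) (L.chartCoord Φ p.2 x)) x * (m p.1).1 x)) _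
        univ s :=
      hasFiberDeriv_sum (fun p : ι × Fin (Module.finrank ℝ L.E) =>
        L.vf (fun x => algebraMap k (L.fiber x) (L.chartCoord Φ p.2 x)) x * (m p.1).1 x) fun p =>
        ((ha p.1).hasDerivAt_dirDeriv (Φ := Φ) hΘ (Module.finBasis ℝ L.E p.2) s x).hasDerivWithinAt
    have d2 : HasFiberDeriv k (fun τ => ∑ i, a i (τ, x) • L.vf (m i).1 x) _ univ s :=
      hasFiberDeriv_sum (fun i => L.vf (m i).1 x) fun i =>
        ((ha i).hasDerivAt_timeDeriv s x).hasDerivWithinAt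
    exact (d1.add d2).congr (e1.filter_mono nhdsWithin_le_nhds) e1.self_of_nhds

/-- The homological vector field takes smooth families to smooth families. -/
theorem smoothFamAt_vf (hF : ∀ s x, SmoothFamAt 𝓘(ℝ, ℝ) F s x)
    (hn : ∀ s x, F s x ∈ L.deg x n) (s : ℝ) (x : L.body) :
    SmoothFamAt 𝓘(ℝ, ℝ) (fun s => L.vf (F s)) s x :=
  (smoothFamAt_vf_aux hF hn s x).1

/-- The homological vector field commutes with the derivative of families. -/
theorem hasFiberDeriv_vf (hF : ∀ s x, SmoothFamAt 𝓘(ℝ, ℝ) F s x)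
    (hn : ∀ s x, F s x ∈ L.deg x n) (s : ℝ) (x : L.body) :
    HasFiberDeriv k (fun τ => L.vf (F τ) x) (L.vf (fiberDeriv F s) x) univ s :=
  (smoothFamAt_vf_aux hF hn s x).2

end NQManifold

end

noncomputable section

/-! ### The graded manifold `T[1]ℝ × L` -/

section ProdModel

variable {E : Type*} [NormedAddCommGroup E] [NormedSpace ℝ E] {B : Type*} [TopologicalSpace B]
  [ChartedSpace E B]

/-- `ℝ × B` as a manifold modelled on `ℝ × E`. -/
abbrev lineProdCharted (E : Type*) [NormedAddCommGroup E] [NormedSpace ℝ E] (B : Type*)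
    [TopologicalSpace B] [ChartedSpace E B] : ChartedSpace (ℝ × E) (ℝ × B) :=
  prodChartedSpace ℝ ℝ E B

theorem isManifold_lineProd [IsManifold 𝓘(ℝ, E) ∞ B] :
    @IsManifold ℝ _ (ℝ × E) _ _ (ℝ × E) _ 𝓘(ℝ, ℝ × E) ∞ (ℝ × B) _ (lineProdCharted E B) := by
  rw [modelWithCornersSelf_prod]
  exact IsManifold.prod (I := 𝓘(ℝ, ℝ)) (I' := 𝓘(ℝ, E)) ℝ B

variable {E' H' M : Type*} [NormedAddCommGroup E'] [NormedSpace ℝ E'] [TopologicalSpace H']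
  {I : ModelWithCorners ℝ E' H'} [TopologicalSpace M] [ChartedSpace H' M]

theorem contMDiff_lineProd_dom_iff {f : ℝ × B → M} :
    @ContMDiff ℝ _ (ℝ × E) _ _ (ℝ × E) _ 𝓘(ℝ, ℝ × E) (ℝ × B) _ (lineProdCharted E B) E' _ _ H' _ I
      M _ _ ∞ f ↔ ContMDiff (𝓘(ℝ, ℝ).prod 𝓘(ℝ, E)) I ∞ f := by
  rw [modelWithCornersSelf_prod]

theorem contMDiff_lineProd_cod_iff {f : M → ℝ × B} :
    @ContMDiff ℝ _ E' _ _ H' _ I M _ _ (ℝ × E) _ _ (ℝ × E) _ 𝓘(ℝ, ℝ × E) (ℝ × B) _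
      (lineProdCharted E B) ∞ f ↔ ContMDiff I (𝓘(ℝ, ℝ).prod 𝓘(ℝ, E)) ∞ f := by
  rw [modelWithCornersSelf_prod]

variable {E'' H'' P : Type*} [NormedAddCommGroup E''] [NormedSpace ℝ E''] [TopologicalSpace H'']
  {J : ModelWithCorners ℝ E'' H''} [TopologicalSpace P] [ChartedSpace H'' P]

theorem contMDiff_prod_lineProd_iff {f : P × (ℝ × B) → M} :
    @ContMDiff ℝ _ (E'' × (ℝ × E)) _ _ (ModelProd H'' (ℝ × E)) _ (J.prod 𝓘(ℝ, ℝ × E)) (P × (ℝ × B))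
      _ (@prodChartedSpace H'' _ P _ _ (ℝ × E) _ (ℝ × B) _ (lineProdCharted E B)) E' _ _ H' _ I
      M _ _ ∞ f ↔ ContMDiff (J.prod (𝓘(ℝ, ℝ).prod 𝓘(ℝ, E))) I ∞ f := by
  rw [modelWithCornersSelf_prod]

end ProdModel

namespace NManifold

variable {k : Type v} [RCLike k]

section Cylinder

variable (L : NManifold.{u} k)

/-- The parity automorphism of a fibre. -/
abbrev par (x : L.body) : L.fiber x →ₐ[k] L.fiber x := parity (L.deg_internal x)

/-- The fibres of `T[1]ℝ × L`. -/
abbrev CylFiber (q : ℝ × L.body) : Type u := SuperExt (L.par q.2)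

/-- The grading of the fibres of `T[1]ℝ × L`. -/
abbrev cylDeg (q : ℝ × L.body) (n : ℕ) : Submodule k (L.CylFiber q) :=
  SuperExt.deg (L.par q.2) (L.deg q.2) n

variable {L}

/-- Graded coordinates on `T[1]ℝ × L`. -/
def cylCoords (c : GradedCoords k L.deg) : GradedCoords k (F := L.CylFiber) L.cylDeg where
  dom := Prod.snd ⁻¹' c.dom
  isOpen_dom := c.isOpen_dom.preimage continuous_snd
  rank := c.rank + 1
  wt := Fin.cons 1 c.wt
  wt_pos j := Fin.cases one_pos c.wt_pos j
  coord j q := (Fin.cons (SuperExt.gen (L.par q.2))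
    (fun j => SuperExt.inl (L.par q.2) (c.coord j q.2)) : Fin (c.rank + 1) → L.CylFiber q) j
  coord_mem q hq j := by
    refine Fin.cases ?_ (fun j => ?_) j
    · exact ⟨zero_mem (L.deg q.2 1), SetLike.GradedOne.one_mem (A := L.deg q.2)⟩
    · exact ⟨c.coord_mem q.2 hq j, zero_mem (shiftDeg (L.deg q.2) _)⟩
  linearIndependent q hq := SuperExt.linearIndependent_ordered_monomials (c.linearIndependent q.2 hq)
  span_eq_top q hq := SuperExt.span_ordered_monomials (c.span_eq_top q.2 hq)

attribute [local instance] lineProdCharted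

theorem inl_mem_polys_cylCoords (c : GradedCoords k L.deg) {p : ∀ x, L.fiber x}
    (hp : p ∈ c.polys L.E) :
    (fun q : ℝ × L.body => SuperExt.inl (L.par q.2) (p q.2)) ∈ (cylCoords c).polys (ℝ × L.E) := by
  unfold GradedCoords.polys at hp
  induction hp using Algebra.adjoin_induction with
  | mem q hq =>
    rcases hq with ⟨a, ha, rfl⟩ | ⟨j, rfl⟩
    · simp only [AlgHom.commutes]
      exact Algebra.subset_adjoin (Or.inl ⟨fun q => a q.2,
        contMDiff_lineProd_dom_iff.2 (ha.comp contMDiff_snd), rfl⟩)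
    · exact Algebra.subset_adjoin (Or.inr ⟨j.succ, rfl⟩)
  | algebraMap r =>
    convert! Subalgebra.algebraMap_mem ((cylCoords c).polys (ℝ × L.E)) r using 1
    funext q
    exact AlgHom.commutes _ _
  | add q q' _ _ h1 h2 =>
    simp only [Pi.add_apply, map_add]
    exact add_mem h1 h2
  | mul q q' _ _ h1 h2 =>
    simp only [Pi.mul_apply, map_mul]
    exact mul_mem h1 h2

variable (L) in
/-- The graded manifold `T[1]ℝ × L`. -/
def cyl : NManifold.{u} k where
  E := ℝ × L.E
  body := ℝ × L.body
  instManifold := isManifold_lineProd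
  fiber := L.CylFiber
  deg := L.cylDeg
  deg_internal q := SuperExt.deg_internal (L.deg_internal q.2)
  graded_comm q n m := SuperExt.graded_comm (L.graded_comm q.2) n m
  atlas := cylCoords '' L.atlas
  atlas_cover q := by
    obtain ⟨c, hc, hq⟩ := L.atlas_cover q.2
    exact ⟨_, mem_image_of_mem _ hc, hq⟩
  atlas_compat := by
    rintro _ ⟨c, hc, rfl⟩ _ ⟨c', hc', rfl⟩ q ⟨hq, hq'⟩ j
    refine Fin.cases ?_ (fun j => ?_) j
    · exact ⟨(cylCoords c).coord (0 : Fin (c.rank + 1)),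
        Algebra.subset_adjoin (Or.inr ⟨(0 : Fin (c.rank + 1)), rfl⟩),
        Eventually.of_forall fun _ => rfl⟩
    · obtain ⟨p, hp, e⟩ := L.atlas_compat c hc c' hc' q.2 ⟨hq, hq'⟩ j
      refine ⟨_, inl_mem_polys_cylCoords c hp, ?_⟩
      filter_upwards [(continuous_snd.continuousAt (x := q)).eventually e] with q h
      exact congrArg (SuperExt.inl (L.par q.2)) h

end Cylinder

end NManifold

end

/-! ### Smooth sections of `T[1]ℝ × L` in components -/

noncomputable section

namespace NManifold

variable {k : Type v} [RCLike k] {L : NManifold.{u} k}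

section Families

variable {EP HP P : Type*} [NormedAddCommGroup EP] [NormedSpace ℝ EP] [TopologicalSpace HP]
  [TopologicalSpace P] [ChartedSpace HP P] {I : ModelWithCorners ℝ EP HP}
  {EP' HP' P' : Type*} [NormedAddCommGroup EP'] [NormedSpace ℝ EP'] [TopologicalSpace HP']
  [TopologicalSpace P'] [ChartedSpace HP' P'] {I' : ModelWithCorners ℝ EP' HP'}

/-- Each word is homogeneous on the domain of the coordinates, so the parity automorphism only
changes signs of coefficients. It is needed because products in `SuperExt` involve the parity. -/
theorem NormalAt.parity {c : GradedCoords k L.deg} {f : P → ∀ x, L.fiber x} {t : P} {x : L.body}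
    (h : NormalAt I c f t x) (hx : x ∈ c.dom) : NormalAt I c (fun t x => L.par x (f t x)) t x := by
  obtain ⟨ι, _, a, w, ha, h⟩ := h
  refine ⟨ι, inferInstance, fun i q => (-1) ^ c.wordDeg (w i) * a i q, w,
    fun i => ContMDiff.mul_scalar contMDiff_const (ha i), ?_⟩
  filter_upwards [h, (continuous_snd.continuousAt (x := (t, x))).eventually
    (c.isOpen_dom.mem_nhds hx)] with q h1 h2
  rw [h1, map_sum]
  refine Finset.sum_congr rfl fun i _ => ?_
  rw [map_smul, parity_of_mem _ (c.word_mem (w i) h2), mul_comm, mul_smul]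
  congr 1
  rcases neg_one_pow_eq_or k (c.wordDeg (w i)) with h3 | h3 <;>
    rcases Nat.even_or_odd (c.wordDeg (w i)) with h4 | h4 <;> simp [h4.neg_one_pow]

theorem SmoothFamAt.comp_param {f : P → ∀ x, L.fiber x} {μ : P' → P} (hμ : ContMDiff I' I ∞ μ)
    {t : P'} {x : L.body} (h : SmoothFamAt I f (μ t) x) :
    SmoothFamAt I' (fun t => f (μ t)) t x := by
  intro c hc hx
  obtain ⟨ι, _, a, w, ha, h⟩ := h c hc hx
  refine ⟨ι, inferInstance, fun i q => a i (μ q.1, q.2), w,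
    fun i => (ha i).comp ((hμ.comp contMDiff_fst).prodMk contMDiff_snd), ?_⟩
  have hc : ContinuousAt (fun q : P' × L.body => (μ q.1, q.2)) (t, x) :=
    ((hμ.continuous.comp continuous_fst).prodMk continuous_snd).continuousAt
  exact hc.eventually h

end Families

section Cylinder

attribute [local instance] lineProdCharted

theorem word_mem_polys (c : GradedCoords k L.deg) (w : List (Fin c.rank)) :
    c.word w ∈ c.polys L.E := by
  have h : c.word w = (w.map fun j => c.coord j).prod := by
    induction w with
    | nil => rfl
    | cons j w ih =>
      funext x
      have := congrFun ih x
      simp only [GradedCoords.word, List.map_cons, List.prod_cons, Pi.mul_apply] at this ⊢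
      rw [this]
  rw [h]
  refine Subalgebra.list_prod_mem _ fun y hy => ?_
  obtain ⟨j, -, rfl⟩ := List.mem_map.1 hy
  exact Algebra.subset_adjoin (Or.inr ⟨j, rfl⟩)

theorem scalar_mem_polys_cylCoords (c : GradedCoords k L.deg) {a : ℝ × L.body → k}
    (ha : ContMDiff (𝓘(ℝ, ℝ).prod 𝓘(ℝ, L.E)) 𝓘(ℝ, k) ∞ a) :
    (fun q => algebraMap k (L.CylFiber q) (a q)) ∈ (cylCoords c).polys (ℝ × L.E) :=
  Algebra.subset_adjoin (Or.inl ⟨a, contMDiff_lineProd_dom_iff.2 ha, rfl⟩)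

theorem gen_mem_polys_cylCoords (c : GradedCoords k L.deg) :
    (fun q : ℝ × L.body => SuperExt.gen (L.par q.2)) ∈ (cylCoords c).polys (ℝ × L.E) :=
  Algebra.subset_adjoin (Or.inr ⟨(0 : Fin (c.rank + 1)), rfl⟩)

theorem NormalAt.exists_mem_polys_cylCoords {c : GradedCoords k L.deg} {f : ℝ → ∀ x, L.fiber x}
    {s : ℝ} {x : L.body} (h : NormalAt 𝓘(ℝ, ℝ) c f s x) :
    ∃ p ∈ (cylCoords c).polys (ℝ × L.E),
      ∀ᶠ q in 𝓝 (s, x), SuperExt.inl (L.par q.2) (f q.1 q.2) = p q := by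
  obtain ⟨ι, _, a, w, ha, h⟩ := h
  refine ⟨∑ i, (fun q => algebraMap k (L.CylFiber q) (a i q)) *
    (fun q : ℝ × L.body => SuperExt.inl (L.par q.2) (c.word (w i) q.2)),
    sum_mem fun i _ => mul_mem (scalar_mem_polys_cylCoords c (ha i))
      (inl_mem_polys_cylCoords c (word_mem_polys c (w i))), ?_⟩
  filter_upwards [h] with q hq
  rw [hq, map_sum, Finset.sum_apply]
  refine Finset.sum_congr rfl fun i _ => ?_
  rw [map_smul, Algebra.smul_def]
  rfl

theorem normalAt_of_mem_polys_cylCoords {c : GradedCoords k L.deg} {s : ℝ} {x : L.body}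
    (hx : x ∈ c.dom) {p : ∀ q, L.CylFiber q} (hp : p ∈ (cylCoords c).polys (ℝ × L.E)) :
    NormalAt 𝓘(ℝ, ℝ) c (fun s x => (p (s, x)).fst) s x ∧
      NormalAt 𝓘(ℝ, ℝ) c (fun s x => (p (s, x)).snd) s x := by
  have hzero : NormalAt (L := L) 𝓘(ℝ, ℝ) c (fun _ _ => 0) s x :=
    (normalAt_scalar (a := fun _ => (0 : k)) contMDiff_const c s x).congr
      (Eventually.of_forall fun q => by simp)
  unfold GradedCoords.polys at hp
  induction hp using Algebra.adjoin_induction with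
  | mem q hq =>
    rcases hq with ⟨a, ha, rfl⟩ | ⟨j, rfl⟩
    · simp only [SuperExt.fst_algebraMap, SuperExt.snd_algebraMap]
      exact ⟨normalAt_scalar (contMDiff_lineProd_dom_iff.1 ha) c s x, hzero⟩
    · refine Fin.cases ?_ (fun j => ?_) j
      · refine ⟨hzero, ?_⟩
        exact (normalAt_scalar (a := fun _ => (1 : k)) contMDiff_const c s x).congr
          (Eventually.of_forall fun q => (map_one _).symm)
      · exact ⟨normalAt_coord _ c j s x, hzero⟩
  | algebraMap r =>
    constructor
    · exact (normalAt_scalar (a := fun _ => r) contMDiff_const c s x).congr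
        (Eventually.of_forall fun q => SuperExt.fst_algebraMap (α := L.par q.2) r)
    · exact hzero.congr (Eventually.of_forall fun q => SuperExt.snd_algebraMap (α := L.par q.2) r)
  | add q q' _ _ h1 h2 => exact ⟨h1.1.add h2.1, h1.2.add h2.2⟩
  | mul q q' _ _ h1 h2 => exact ⟨h1.1.mul h2.1, (h1.2.mul h2.1).add ((h1.1.parity hx).mul h2.2)⟩

theorem _root_.SuperExt.eq_inl_add_gen_mul {A : Type*} [Ring A] [Algebra k A] {α : A →ₐ[k] A}
    (p : SuperExt α) : p = SuperExt.inl α p.fst + SuperExt.gen α * SuperExt.inl α p.snd := by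
  ext <;> simp

/-- A section on `T[1]ℝ × L` is smooth if its components are smooth families of sections. -/
theorem smoothAt_cyl_iff {f : ∀ q, L.CylFiber q} {s : ℝ} {x : L.body} :
    L.cyl.SmoothAt f (s, x) ↔ SmoothFamAt 𝓘(ℝ, ℝ) (fun s x => (f (s, x)).fst) s x ∧
      SmoothFamAt 𝓘(ℝ, ℝ) (fun s x => (f (s, x)).snd) s x := by
  constructor
  · intro h
    have key : ∀ c ∈ L.atlas, x ∈ c.dom →
        NormalAt 𝓘(ℝ, ℝ) c (fun s x => (f (s, x)).fst) s x ∧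
          NormalAt 𝓘(ℝ, ℝ) c (fun s x => (f (s, x)).snd) s x := by
      intro c hc hx
      obtain ⟨p, hp, e⟩ := h (cylCoords c) (mem_image_of_mem _ hc) hx
      obtain ⟨h1, h2⟩ := normalAt_of_mem_polys_cylCoords (s := s) hx hp
      exact ⟨h1.congr (e.mono fun q hq => congrArg SuperExt.fst hq),
        h2.congr (e.mono fun q hq => congrArg SuperExt.snd hq)⟩
    exact ⟨fun c hc hx => (key c hc hx).1, fun c hc hx => (key c hc hx).2⟩
  · rintro ⟨h1, h2⟩ _ ⟨c, hc, rfl⟩ hx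
    obtain ⟨p, hp, e⟩ := (h1 c hc hx).exists_mem_polys_cylCoords
    obtain ⟨p', hp', e'⟩ := (h2 c hc hx).exists_mem_polys_cylCoords
    refine ⟨p + (fun q : ℝ × L.body => SuperExt.gen (L.par q.2)) * p',
      add_mem hp (mul_mem (gen_mem_polys_cylCoords c) hp'), ?_⟩
    filter_upwards [e, e'] with q h3 h4
    rw [SuperExt.eq_inl_add_gen_mul (f q)]
    exact congrArg₂ (fun a b => a + SuperExt.gen (L.par q.2) * b) h3 h4

theorem inl_mem_famPolys_cylCoords (c : GradedCoords k L.deg) {p : ∀ q, L.CylFiber q}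
    (hp : p ∈ (cylCoords c).polys (ℝ × L.E)) :
    (fun (_ : unitInterval) q => p q) ∈ (cylCoords c).famPolys (ℝ × L.E) := by
  unfold GradedCoords.polys at hp
  induction hp using Algebra.adjoin_induction with
  | mem q hq =>
    rcases hq with ⟨a, ha, rfl⟩ | ⟨j, rfl⟩
    · exact Algebra.subset_adjoin (Or.inl ⟨fun q => a q.2, ha.comp contMDiff_snd, rfl⟩)
    · exact Algebra.subset_adjoin (Or.inr ⟨j, rfl⟩)
  | algebraMap r => exact Subalgebra.algebraMap_mem ((cylCoords c).famPolys (ℝ × L.E)) r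
  | add q q' _ _ h1 h2 => exact add_mem h1 h2
  | mul q q' _ _ h1 h2 => exact mul_mem h1 h2

theorem NormalAt.exists_mem_famPolys_cylCoords {c : GradedCoords k L.deg}
    {f : unitInterval × ℝ → ∀ x, L.fiber x} {t : unitInterval} {s : ℝ} {x : L.body}
    (h : NormalAt ((𝓡∂ 1).prod 𝓘(ℝ, ℝ)) c f (t, s) x) :
    ∃ p ∈ (cylCoords c).famPolys (ℝ × L.E),
      ∀ᶠ q : unitInterval × (ℝ × L.body) in 𝓝 (t, (s, x)),
        SuperExt.inl (L.par q.2.2) (f (q.1, q.2.1) q.2.2) = p q.1 q.2 := by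
  obtain ⟨ι, _, a, w, ha, h⟩ := h
  have hassoc : ContMDiff ((𝓡∂ 1).prod (𝓘(ℝ, ℝ).prod 𝓘(ℝ, L.E)))
      (((𝓡∂ 1).prod 𝓘(ℝ, ℝ)).prod 𝓘(ℝ, L.E)) ∞
      fun q : unitInterval × (ℝ × L.body) => ((q.1, q.2.1), q.2.2) :=
    (contMDiff_fst.prodMk (contMDiff_fst.comp contMDiff_snd)).prodMk
      (contMDiff_snd.comp contMDiff_snd)
  refine ⟨∑ i, (fun t q => algebraMap k (L.CylFiber q) (a i ((t, q.1), q.2))) *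
    (fun (_ : unitInterval) (q : ℝ × L.body) => SuperExt.inl (L.par q.2) (c.word (w i) q.2)),
    sum_mem fun i _ => mul_mem (Algebra.subset_adjoin (Or.inl ⟨fun q => a i ((q.1, q.2.1), q.2.2),
      contMDiff_prod_lineProd_iff.2 ((ha i).comp hassoc), rfl⟩))
      (inl_mem_famPolys_cylCoords c (inl_mem_polys_cylCoords c (word_mem_polys c (w i)))), ?_⟩
  filter_upwards [(hassoc.continuous.continuousAt (x := (t, (s, x)))).eventually h] with q hq
  rw [hq, map_sum, Finset.sum_apply, Finset.sum_apply]
  refine Finset.sum_congr rfl fun i _ => ?_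
  rw [map_smul, Algebra.smul_def]
  rfl

/-- A family over `[0,1]` of sections on `T[1]ℝ × L` is smooth if its components are smooth
families, parametrised by `[0,1] × ℝ`, of sections on `L`. -/
theorem famSmoothAt_cyl {f : unitInterval → ∀ q, L.CylFiber q} {t : unitInterval} {s : ℝ}
    {x : L.body}
    (h1 : SmoothFamAt ((𝓡∂ 1).prod 𝓘(ℝ, ℝ)) (fun (p : unitInterval × ℝ) x => (f p.1 (p.2, x)).fst)
      (t, s) x)
    (h2 : SmoothFamAt ((𝓡∂ 1).prod 𝓘(ℝ, ℝ)) (fun (p : unitInterval × ℝ) x => (f p.1 (p.2, x)).snd)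
      (t, s) x) :
    L.cyl.FamSmoothAt f t (s, x) := by
  rintro _ ⟨c, hc, rfl⟩ hx
  obtain ⟨p, hp, e⟩ := (h1 c hc hx).exists_mem_famPolys_cylCoords
  obtain ⟨p', hp', e'⟩ := (h2 c hc hx).exists_mem_famPolys_cylCoords
  have hg := inl_mem_famPolys_cylCoords c (gen_mem_polys_cylCoords c)
  have hmem := add_mem hp (mul_mem hg hp')
  have e2 : ∀ᶠ q : unitInterval × (ℝ × L.body) in 𝓝 (t, (s, x)),
      f q.1 q.2 = p q.1 q.2 + SuperExt.gen (L.par q.2.2) * p' q.1 q.2 := by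
    filter_upwards [e, e'] with q h3 h4
    rw [← h3, ← h4]
    exact SuperExt.eq_inl_add_gen_mul _
  exact ⟨_, hmem, e2⟩

end Cylinder

end NManifold

end

noncomputable section

/-! ### The homological vector field of `T[1]ℝ × L` -/

namespace NManifold

variable {k : Type v} [RCLike k] {L : NManifold.{u} k}

/-- The component `a` of a section `a + σ b` on `T[1]ℝ × L`, as a family of sections on `L`. -/
def cylFst (f : ∀ q, L.CylFiber q) (s : ℝ) (x : L.body) : L.fiber x := (f (s, x)).fst

/-- The component `b` of a section `a + σ b` on `T[1]ℝ × L`, as a family of sections on `L`. -/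
def cylSnd (f : ∀ q, L.CylFiber q) (s : ℝ) (x : L.body) : L.fiber x := (f (s, x)).snd

theorem mem_fn_cyl {f : ∀ q, L.CylFiber q} {n : ℕ} :
    f ∈ L.cyl.fn n ↔ ((∀ s x, SmoothFamAt 𝓘(ℝ, ℝ) (cylFst f) s x) ∧
      ∀ s x, cylFst f s x ∈ L.deg x n) ∧ (∀ s x, SmoothFamAt 𝓘(ℝ, ℝ) (cylSnd f) s x) ∧
      ∀ s x, cylSnd f s x ∈ shiftDeg (L.deg x) n := by
  constructor
  · rintro ⟨h1, h2⟩
    exact ⟨⟨fun s x => (smoothAt_cyl_iff.1 (h2 (s, x))).1, fun s x => (h1 (s, x)).1⟩,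
      fun s x => (smoothAt_cyl_iff.1 (h2 (s, x))).2, fun s x => (h1 (s, x)).2⟩
  · rintro ⟨⟨h1, h2⟩, h3, h4⟩
    exact ⟨fun q => ⟨h2 q.1 q.2, h4 q.1 q.2⟩, fun q => smoothAt_cyl_iff.2 ⟨h1 q.1 q.2, h3 q.1 q.2⟩⟩

variable (L) in
/-- The functions of degree `n - 1`. -/
def fnShift : ℕ → Submodule k (∀ x, L.fiber x)
  | 0 => ⊥
  | n + 1 => L.fn n

theorem mem_fnShift {F : ℝ → ∀ x, L.fiber x} {n : ℕ}
    (hF : ∀ s x, SmoothFamAt 𝓘(ℝ, ℝ) F s x) (hn : ∀ s x, F s x ∈ shiftDeg (L.deg x) n) (s : ℝ) :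
    F s ∈ L.fnShift n := by
  cases n with
  | zero => exact funext fun x => hn s x
  | succ n => exact ⟨hn s, fun x => (hF s x).slice⟩

theorem neg_one_pow_mul_mem_fnShift {n : ℕ} (m : ℕ) {f : ∀ x, L.fiber x} (hf : f ∈ L.fnShift n) :
    (-1) ^ m * f ∈ L.fnShift n := by
  rcases neg_one_pow_eq_or (∀ x, L.fiber x) m with h | h <;> simp [h, hf]

end NManifold

namespace NQManifold

open NManifold

variable {k : Type v} [RCLike k] {L : NQManifold.{u} k} {n m : ℕ} {f g : ∀ x, L.fiber x}

theorem vf_mem_of_shift (hf : f ∈ L.fnShift n) : L.vf f ∈ L.fn n := by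
  cases n with
  | zero =>
    rw [(hf : f = 0), vf_zero]
    exact zero_mem _
  | succ n => exact vf_mem (n := n) hf

theorem vf_vf_of_shift (hf : f ∈ L.fnShift n) : L.vf (L.vf f) = 0 := by
  cases n with
  | zero => rw [(hf : f = 0), vf_zero, vf_zero]
  | succ n => exact vf_vf (n := n) hf

theorem vf_add_of_shift (hf : f ∈ L.fnShift n) (hg : g ∈ L.fnShift n) :
    L.vf (f + g) = L.vf f + L.vf g := by
  cases n with
  | zero => rw [(hf : f = 0), (hg : g = 0), add_zero, vf_zero, add_zero]
  | succ n => exact vf_add (n := n) hf hg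

theorem vf_smul_of_shift (r : k) (hf : f ∈ L.fnShift n) : L.vf (r • f) = r • L.vf f := by
  cases n with
  | zero => rw [(hf : f = 0), smul_zero, vf_zero, smul_zero]
  | succ n => exact vf_smul (n := n) r hf

theorem vf_neg (hf : f ∈ L.fn n) : L.vf (-f) = -L.vf f := by
  rw [← neg_one_smul k f, vf_smul _ hf, neg_one_smul]

theorem vf_sub (hf : f ∈ L.fn n) (hg : g ∈ L.fn n) : L.vf (f - g) = L.vf f - L.vf g := by
  rw [sub_eq_add_neg, vf_add hf (neg_mem hg), vf_neg hg, sub_eq_add_neg]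

theorem vf_neg_one_pow_mul_of_shift (hf : f ∈ L.fnShift n) (m : ℕ) :
    L.vf ((-1) ^ m * f) = (-1) ^ m * L.vf f := by
  rcases Nat.even_or_odd m with h | h
  · simp [h.neg_one_pow]
  · have := vf_smul_of_shift (-1 : k) hf
    simpa [h.neg_one_pow] using this

theorem mul_mem_fnShift_left (hf : f ∈ L.fnShift n) (hg : g ∈ L.fn m) :
    f * g ∈ L.fnShift (n + m) := by
  cases n with
  | zero =>
    rw [(hf : f = 0), zero_mul]
    exact zero_mem _
  | succ n =>
    rw [Nat.add_right_comm]
    exact mul_mem_fn (n := n) hf hg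

theorem mul_mem_fnShift_right (hf : f ∈ L.fn n) (hg : g ∈ L.fnShift m) :
    f * g ∈ L.fnShift (n + m) := by
  cases m with
  | zero =>
    rw [(hg : g = 0), mul_zero]
    exact zero_mem _
  | succ m => exact mul_mem_fn (m := m) hf hg

theorem vf_mul_of_shift_left (hf : f ∈ L.fnShift n) (hg : g ∈ L.fn m) :
    L.vf (f * g) = L.vf f * g - (-1) ^ n * (f * L.vf g) := by
  cases n with
  | zero => rw [(hf : f = 0), zero_mul, vf_zero, zero_mul, zero_mul, mul_zero, sub_zero]
  | succ n =>
    rw [vf_mul (n := n) hf hg, pow_succ]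
    noncomm_ring

theorem vf_mul_of_shift_right (hf : f ∈ L.fn n) (hg : g ∈ L.fnShift m) :
    L.vf (f * g) = L.vf f * g + (-1) ^ n * (f * L.vf g) := by
  cases m with
  | zero => rw [(hg : g = 0), mul_zero, vf_zero, mul_zero, mul_zero, mul_zero, add_zero]
  | succ m => exact vf_mul (m := m) hf hg

variable {F G : ℝ → ∀ x, L.fiber x}

theorem smoothFamAt_vf_of_shift (hF : ∀ s x, SmoothFamAt 𝓘(ℝ, ℝ) F s x)
    (hn : ∀ s x, F s x ∈ shiftDeg (L.deg x) n) (s : ℝ) (x : L.body) :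
    SmoothFamAt 𝓘(ℝ, ℝ) (fun s => L.vf (F s)) s x := by
  cases n with
  | zero =>
    have : ∀ s, F s = 0 := fun s => funext fun x => hn s x
    simp only [this, vf_zero]
    exact smoothFamAt_zero _ _ _
  | succ n => exact smoothFamAt_vf hF hn s x

theorem _root_.NManifold.fiberDeriv_add {L : NManifold.{u} k} {F G : ℝ → ∀ x, L.fiber x} {s : ℝ}
    {x : L.body} (hF : SmoothFamAt 𝓘(ℝ, ℝ) F s x) (hG : SmoothFamAt 𝓘(ℝ, ℝ) G s x) :
    fiberDeriv (F + G) s x = fiberDeriv F s x + fiberDeriv G s x :=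
  (hF.hasFiberDeriv.add hG.hasFiberDeriv).fiberDeriv_eq

theorem _root_.NManifold.fiberDeriv_smul {L : NManifold.{u} k} {F : ℝ → ∀ x, L.fiber x} {s : ℝ}
    {x : L.body} (r : k) (hF : SmoothFamAt 𝓘(ℝ, ℝ) F s x) :
    fiberDeriv (r • F) s x = r • fiberDeriv F s x :=
  (hF.hasFiberDeriv.map (r • LinearMap.id)).fiberDeriv_eq

theorem _root_.NManifold.fiberDeriv_mul {L : NManifold.{u} k} {F G : ℝ → ∀ x, L.fiber x} {s : ℝ}
    {x : L.body} (hF : SmoothFamAt 𝓘(ℝ, ℝ) F s x) (hG : SmoothFamAt 𝓘(ℝ, ℝ) G s x) :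
    fiberDeriv (F * G) s x = fiberDeriv F s x * G s x + F s x * fiberDeriv G s x :=
  (hF.hasFiberDeriv.mul hG.hasFiberDeriv).fiberDeriv_eq

variable (L) in
/-- The vector field `σ ∂_s + Q_L` on sections on `T[1]ℝ × L`. -/
def cylVf (f : ∀ q, L.CylFiber q) : ∀ q, L.CylFiber q := fun q =>
  SuperExt.mk _ (L.vf (cylFst f q.1) q.2) (fiberDeriv (cylFst f) q.1 q.2 - L.vf (cylSnd f q.1) q.2)

variable {φ ψ : ∀ q, L.CylFiber q}

theorem cylVf_mem (hφ : φ ∈ L.cyl.fn n) : L.cylVf φ ∈ L.cyl.fn (n + 1) := by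
  obtain ⟨⟨h1, h2⟩, h3, h4⟩ := mem_fn_cyl.1 hφ
  refine mem_fn_cyl.2 ⟨⟨fun s x => smoothFamAt_vf h1 h2 s x,
    fun s x => (vf_mem (smoothFamAt_mem_fn h1 h2 s)).1 x⟩,
    fun s x => (h1 s x).fiberDeriv.sub (smoothFamAt_vf_of_shift h3 h4 s x), fun s x => ?_⟩
  exact sub_mem (fiberDeriv_mem (h1 s x) fun s => h2 s x)
    ((vf_mem_of_shift (mem_fnShift h3 h4 s)).1 x)

theorem cylVf_add (hφ : φ ∈ L.cyl.fn n) (hψ : ψ ∈ L.cyl.fn n) :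
    L.cylVf (φ + ψ) = L.cylVf φ + L.cylVf ψ := by
  obtain ⟨⟨h1, h2⟩, h3, h4⟩ := mem_fn_cyl.1 hφ
  obtain ⟨⟨h1', h2'⟩, h3', h4'⟩ := mem_fn_cyl.1 hψ
  funext ⟨s, x⟩
  refine SuperExt.ext ?_ ?_
  · exact congrFun (vf_add (smoothFamAt_mem_fn h1 h2 s) (smoothFamAt_mem_fn h1' h2' s)) x
  · change fiberDeriv (cylFst φ + cylFst ψ) s x - L.vf (cylSnd φ s + cylSnd ψ s) x =
      fiberDeriv (cylFst φ) s x - L.vf (cylSnd φ s) x +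
        (fiberDeriv (cylFst ψ) s x - L.vf (cylSnd ψ s) x)
    rw [fiberDeriv_add (h1 s x) (h1' s x),
      vf_add_of_shift (mem_fnShift h3 h4 s) (mem_fnShift h3' h4' s), Pi.add_apply]
    abel

theorem cylVf_smul (r : k) (hφ : φ ∈ L.cyl.fn n) : L.cylVf (r • φ) = r • L.cylVf φ := by
  obtain ⟨⟨h1, h2⟩, h3, h4⟩ := mem_fn_cyl.1 hφ
  funext ⟨s, x⟩
  refine SuperExt.ext ?_ ?_
  · exact congrFun (vf_smul r (smoothFamAt_mem_fn h1 h2 s)) x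
  · change fiberDeriv (r • cylFst φ) s x - L.vf (r • cylSnd φ s) x =
      r • (fiberDeriv (cylFst φ) s x - L.vf (cylSnd φ s) x)
    rw [fiberDeriv_smul r (h1 s x), vf_smul_of_shift r (mem_fnShift h3 h4 s), smul_sub,
      Pi.smul_apply]

/-- On `a + σ b` the component of `σ` is `∂_s Q a - Q (∂_s a - Q b)`; it vanishes because `Q`
commutes with `∂_s` and squares to zero. -/
theorem cylVf_cylVf (hφ : φ ∈ L.cyl.fn n) : L.cylVf (L.cylVf φ) = 0 := by
  obtain ⟨⟨h1, h2⟩, h3, h4⟩ := mem_fn_cyl.1 hφ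
  funext ⟨s, x⟩
  refine SuperExt.ext ?_ ?_
  · exact congrFun (vf_vf (smoothFamAt_mem_fn h1 h2 s)) x
  · change fiberDeriv (fun s => L.vf (cylFst φ s)) s x -
      L.vf (fiberDeriv (cylFst φ) s - L.vf (cylSnd φ s)) x = 0
    have hd : fiberDeriv (cylFst φ) s ∈ L.fn n :=
      smoothFamAt_mem_fn (fun s x => (h1 s x).fiberDeriv)
        (fun s x => fiberDeriv_mem (h1 s x) fun s => h2 s x) s
    rw [vf_sub hd (vf_mem_of_shift (mem_fnShift h3 h4 s)),
      vf_vf_of_shift (mem_fnShift h3 h4 s), sub_zero,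
      (hasFiberDeriv_vf h1 h2 s x).fiberDeriv_eq, sub_self]

/-- In the component of `σ` the ordinary Leibniz rule of `∂_s` meets the signed one of `Q`. The
factor `cylSnd φ s` has degree `n - 1`, hence the opposite sign in `vf_mul_of_shift_left`. -/
theorem cylVf_mul (hφ : φ ∈ L.cyl.fn n) (hψ : ψ ∈ L.cyl.fn m) :
    L.cylVf (φ * ψ) = L.cylVf φ * ψ + (-1) ^ n * (φ * L.cylVf ψ) := by
  obtain ⟨⟨h1, h2⟩, h3, h4⟩ := mem_fn_cyl.1 hφ
  obtain ⟨⟨h1', h2'⟩, h3', h4'⟩ := mem_fn_cyl.1 hψ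
  funext ⟨s, x⟩
  have m1 := smoothFamAt_mem_fn h1 h2 s
  have m2 := mem_fnShift h3 h4 s
  have m1' := smoothFamAt_mem_fn h1' h2' s
  have m2' := mem_fnShift h3' h4' s
  rw [Pi.add_apply, Pi.mul_apply, Pi.mul_apply, Pi.mul_apply, Pi.pow_apply, Pi.neg_apply,
    Pi.one_apply]
  refine SuperExt.ext ?_ ?_
  · rw [map_add, SuperExt.neg_one_pow_mul_fst]
    exact congrFun (vf_mul m1 m1') x
  · rw [map_add, SuperExt.neg_one_pow_mul_snd]
    have hsnd : cylSnd (φ * ψ) s =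
        cylSnd φ s * cylFst ψ s + (-1) ^ n * (cylFst φ s * cylSnd ψ s) := by
      funext y
      change cylSnd φ s y * cylFst ψ s y + L.par y (cylFst φ s y) * cylSnd ψ s y = _
      rw [parity_of_mem _ (h2 s y), mul_assoc]
      rfl
    have e1 : (L.cylVf (φ * ψ) (s, x)).snd = fiberDeriv (cylFst φ * cylFst ψ) s x -
        L.vf (cylSnd (φ * ψ) s) x := rfl
    have e2 : (L.cylVf φ (s, x) * ψ (s, x)).snd =
        (fiberDeriv (cylFst φ) s x - L.vf (cylSnd φ s) x) * cylFst ψ s x +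
          L.par x (L.vf (cylFst φ s) x) * cylSnd ψ s x := rfl
    have e3 : (φ (s, x) * L.cylVf ψ (s, x)).snd = cylSnd φ s x * L.vf (cylFst ψ s) x +
        L.par x (cylFst φ s x) * (fiberDeriv (cylFst ψ) s x - L.vf (cylSnd ψ s) x) := rfl
    rw [e1, e2, e3, fiberDeriv_mul (h1 s x) (h1' s x), hsnd,
      vf_add_of_shift (mul_mem_fnShift_left m2 m1')
        (neg_one_pow_mul_mem_fnShift n (mul_mem_fnShift_right m1 m2')),
      vf_neg_one_pow_mul_of_shift (mul_mem_fnShift_right m1 m2'),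
      vf_mul_of_shift_left m2 m1', vf_mul_of_shift_right m1 m2',
      parity_of_mem _ (h2 s x), parity_of_mem _ ((vf_mem m1).1 x), pow_succ]
    simp only [Pi.add_apply, Pi.sub_apply, Pi.mul_apply, Pi.pow_apply, Pi.neg_apply, Pi.one_apply]
    rcases Nat.even_or_odd n with h | h <;> simp only [h.neg_one_pow] <;> noncomm_ring

variable (L) in
/-- The NQ-manifold `T[1]ℝ × L`. -/
def cyl : NQManifold.{u} k where
  toNManifold := L.toNManifold.cyl
  Q _ :=
    { toFun := fun f => ⟨L.cylVf f.1, cylVf_mem f.2⟩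
      map_add' := fun f g => Subtype.ext (cylVf_add f.2 g.2)
      map_smul' := fun r f => Subtype.ext (cylVf_smul r f.2) }
  Q_mul _ _ f g := cylVf_mul f.2 g.2
  Q_sq _ f := Subtype.ext (cylVf_cylVf f.2)

/-! ### Morphisms to and between the NQ-manifolds `T[1]ℝ × L` -/

theorem Hom.vf_pull {L M : NQManifold.{u} k} (g : Hom L M) {n : ℕ} {f : ∀ y, M.fiber y}
    (hf : f ∈ M.fn n) (x : L.body) :
    g.pull x (M.vf f (g.base x)) = L.vf (fun y => g.pull y (f (g.base y))) x := by
  have h := congrFun (congrArg Subtype.val (g.map_Q n ⟨f, hf⟩)) x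
  rw [vf_eq hf]
  exact h.trans (congrFun (vf_val (g.toHom.map n ⟨f, hf⟩)).symm x)

theorem Hom.vf_pull_of_shift {L M : NQManifold.{u} k} (g : Hom L M) {n : ℕ} {f : ∀ y, M.fiber y}
    (hf : f ∈ M.fnShift n) (x : L.body) :
    g.pull x (M.vf f (g.base x)) = L.vf (fun y => g.pull y (f (g.base y))) x := by
  cases n with
  | zero =>
    rw [(hf : f = 0), vf_zero]
    simp only [Pi.zero_apply, map_zero]
    exact (congrFun vf_zero x).symm
  | succ n => exact g.vf_pull (n := n) hf x

variable (L) in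
/-- The inclusion `L → T[1]ℝ × L` at time `s`. -/
def atTime (s : ℝ) : Hom L L.cyl where
  base x := (s, x)
  base_smooth := contMDiff_lineProd_cod_iff.2 (contMDiff_const.prodMk contMDiff_id)
  pull x := SuperExt.fstHom (L.par x)
  pull_mem _ _ _ ha := ha.1
  smooth _ _ h := (smoothAt_cyl_iff.1 h).1.slice
  map_Q _ f := Subtype.ext (funext fun x => by
    have h := mem_fn_cyl.1 f.2
    exact congrFun (vf_eq (smoothFamAt_mem_fn h.1.1 h.1.2 s)) x)

end NQManifold

/-! ### Functoriality of `T[1]ℝ × L` in `L` -/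

section SuperExtMap

variable {k A A' : Type*} [CommRing k] [Ring A] [Algebra k A] [Ring A'] [Algebra k A']
  {α : A →ₐ[k] A} {α' : A' →ₐ[k] A'}

/-- The extension of a homomorphism to the adjunction of `σ`. -/
def SuperExt.map (φ : A →ₐ[k] A') (h : ∀ a, φ (α a) = α' (φ a)) :
    SuperExt α →ₐ[k] SuperExt α' :=
  AlgHom.ofLinearMap
    { toFun := fun p => SuperExt.mk α' (φ p.fst) (φ p.snd)
      map_add' := fun p q => by ext <;> simp
      map_smul' := fun r p => by ext <;> simp }
    (by ext <;> simp) (fun p q => by ext <;> simp [h])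

end SuperExtMap

namespace NManifold

variable {k : Type v} [RCLike k] {L M : NManifold.{u} k}

theorem Hom.pull_par (g : Hom L M) (x : L.body) (a : M.fiber (g.base x)) :
    g.pull x (M.par _ a) = L.par x (g.pull x a) := by
  refine (M.deg_internal (g.base x)).homogeneous_induction
    (p := fun a => g.pull x (M.par _ a) = L.par x (g.pull x a)) (fun n a ha => ?_)
    (fun a b ha hb => by simp only [map_add, ha, hb]) a
  rw [parity_of_mem _ ha, parity_of_mem _ (g.pull_mem x n a ha)]
  simp

end NManifold

namespace NQManifold

open NManifold

variable {k : Type v} [RCLike k] {L M : NQManifold.{u} k}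

/-- The product of the identity of `T[1]ℝ` and a morphism. -/
def Hom.cyl (g : Hom L M) : Hom L.cyl M.cyl where
  base q := (q.1, g.base q.2)
  base_smooth := contMDiff_lineProd_cod_iff.2 (contMDiff_lineProd_dom_iff.2
    (contMDiff_fst.prodMk (g.base_smooth.comp contMDiff_snd)))
  pull (q : ℝ × L.body) := SuperExt.map (k := k) (A := M.fiber (g.base q.2)) (A' := L.fiber q.2)
    (α := M.par (g.base q.2)) (α' := L.par q.2) (g.pull q.2) (g.pull_par q.2)
  pull_mem (q : ℝ × L.body) n (p : M.CylFiber (q.1, g.base q.2)) hp := by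
    refine ⟨g.pull_mem q.2 n p.fst hp.1, ?_⟩
    cases n with
    | zero => exact (congrArg (g.pull q.2) (hp.2 : p.snd = 0)).trans (map_zero (g.pull q.2))
    | succ n => exact g.pull_mem q.2 n p.snd hp.2
  smooth f q h := smoothAt_cyl_iff.2 ⟨(smoothAt_cyl_iff.1 h).1.pull g.toHom,
    (smoothAt_cyl_iff.1 h).2.pull g.toHom⟩
  map_Q n f := by
    obtain ⟨⟨h1, h2⟩, h3, h4⟩ := mem_fn_cyl.1 f.2
    refine Subtype.ext (funext fun (q : ℝ × L.body) => SuperExt.ext (α := L.par q.2) ?_ ?_)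
    · exact g.vf_pull (smoothFamAt_mem_fn h1 h2 q.1) q.2
    · have e1 := g.vf_pull_of_shift (mem_fnShift h3 h4 q.1) q.2
      have e2 := ((h1 q.1 (g.base q.2)).hasFiberDeriv.map
        (g.pull q.2).toLinearMap).fiberDeriv_eq (f := fun s y => g.pull y (cylFst f.1 s (g.base y)))
      refine (map_sub (g.pull q.2) _ _).trans ?_
      rw [e1]
      exact congrArg (· - _) e2.symm

end NQManifold

end

noncomputable section

/-! ### The contraction of super-curves to their initial points -/

/-- A smooth map from the line to the unit interval which is `0` up to time `0` and `1` from time `1`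
on. -/
def ramp (s : ℝ) : unitInterval :=
  ⟨Real.smoothTransition s, Real.smoothTransition.nonneg s, Real.smoothTransition.le_one s⟩

theorem contDiff_ramp : ContDiff ℝ ∞ fun s => (ramp s : ℝ) := Real.smoothTransition.contDiff

/-- The derivative of `ramp`. -/
def rampDeriv (s : ℝ) : ℝ := deriv (fun s => (ramp s : ℝ)) s

theorem contDiff_rampDeriv : ContDiff ℝ ∞ rampDeriv :=
  (contDiff_infty_iff_deriv.1 contDiff_ramp).2

theorem hasDerivAt_ramp (s : ℝ) : HasDerivAt (fun s => (ramp s : ℝ)) (rampDeriv s) s :=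
  (contDiff_ramp.differentiable (by simp) s).hasDerivAt

theorem ramp_zero : ramp 0 = 0 := Subtype.ext Real.smoothTransition.zero

theorem ramp_one : ramp 1 = 1 := Subtype.ext Real.smoothTransition.one

theorem contMDiff_unitInterval_coe : ContMDiff (𝓡∂ 1) 𝓘(ℝ, ℝ) ∞ fun t : unitInterval => (t : ℝ) :=
  contMDiff_subtypeVal_Icc

theorem continuous_ramp : Continuous ramp :=
  continuous_induced_rng.2 contDiff_ramp.continuous

/-- The contraction of the interval: since `ramp` takes values in `[0,1]`, the product stays there
for every real `s`. -/
theorem contMDiff_mul_ramp : ContMDiff ((𝓡∂ 1).prod 𝓘(ℝ, ℝ)) (𝓡∂ 1) ∞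
    fun p : unitInterval × ℝ => p.1 * ramp p.2 := by
  refine contMDiff_iff_comp_subtypeVal_Icc.2
    ⟨continuous_fst.mul (continuous_ramp.comp continuous_snd), ?_⟩
  have h : ContDiff ℝ ∞ fun p : ℝ × ℝ => p.1 * (ramp p.2 : ℝ) :=
    contDiff_fst.mul (contDiff_ramp.comp contDiff_snd)
  exact h.contMDiff.comp
    ((contMDiff_unitInterval_coe.comp contMDiff_fst).prodMk_space contMDiff_snd)

theorem contMDiff_mul_rampDeriv {k : Type*} [RCLike k] :
    ContMDiff ((𝓡∂ 1).prod 𝓘(ℝ, ℝ)) 𝓘(ℝ, k) ∞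
      fun p : unitInterval × ℝ => ((p.1 * rampDeriv p.2 : ℝ) : k) := by
  have h : ContDiff ℝ ∞ fun p : ℝ × ℝ => RCLike.ofRealCLM (K := k) (p.1 * rampDeriv p.2) :=
    (RCLike.ofRealCLM (K := k)).contDiff.comp
      (contDiff_fst.mul (contDiff_rampDeriv.comp contDiff_snd))
  exact h.contMDiff.comp
    ((contMDiff_unitInterval_coe.comp contMDiff_fst).prodMk_space contMDiff_snd)

namespace NManifold

variable {k : Type v} [RCLike k] {L M : NManifold.{u} k}

namespace SuperMap

attribute [local instance] lineProdCharted

theorem odd_mul_par (φ : SuperMap L M) (t : unitInterval) (x : L.body)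
    (a b : M.fiber (φ.base t x)) :
    φ.odd t x (a * b) = φ.odd t x a * φ.even t x b + L.par x (φ.even t x a) * φ.odd t x b := by
  refine (M.deg_internal (φ.base t x)).homogeneous_induction
    (p := fun a => φ.odd t x (a * b) =
      φ.odd t x a * φ.even t x b + L.par x (φ.even t x a) * φ.odd t x b) (fun n a ha => ?_)
    (fun a a' h h' => ?_) a
  · rw [φ.odd_mul t x n a ha, parity_of_mem _ (φ.even_mem t x n a ha), mul_assoc]
  · simp only [add_mul, map_add, h, h']
    abel

/-- The even component of `SuperMap.contract`. -/
def contractEven (φ : SuperMap L M) (t : unitInterval) (q : ℝ × L.body) :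
    M.fiber (φ.base (t * ramp q.1) q.2) →ₐ[k] L.CylFiber q :=
  AlgHom.ofLinearMap
    { toFun := fun a => SuperExt.mk (L.par q.2) (φ.even (t * ramp q.1) q.2 a)
        (((t * rampDeriv q.1 : ℝ) : k) • φ.odd (t * ramp q.1) q.2 a)
      map_add' := fun a b => by ext <;> simp
      map_smul' := fun r a => by ext <;> simp [smul_comm r] }
    (by
      ext
      · simp
      · simp [φ.odd_zero _ _ 1 (SetLike.GradedOne.one_mem (A := M.deg _))])
    (fun a b => by
      ext
      · simp
      · simp [odd_mul_par, smul_add])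

/-- The odd component of `SuperMap.contract`. -/
def contractOdd (φ : SuperMap L M) (t : unitInterval) (q : ℝ × L.body) :
    M.fiber (φ.base (t * ramp q.1) q.2) →ₗ[k] L.CylFiber q where
  toFun a := SuperExt.mk (L.par q.2) (((ramp q.1 : ℝ) : k) • φ.odd (t * ramp q.1) q.2 a) 0
  map_add' a b := by ext <;> simp
  map_smul' r a := by ext <;> simp [smul_comm r]

section

variable (φ : SuperMap L M) (t : unitInterval) (q : ℝ × L.body)
  (a : M.fiber (φ.base (t * ramp q.1) q.2))

@[simp] theorem fst_contractEven :
    (φ.contractEven t q a).fst = φ.even (t * ramp q.1) q.2 a := rfl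

@[simp] theorem snd_contractEven : (φ.contractEven t q a).snd =
    ((t * rampDeriv q.1 : ℝ) : k) • φ.odd (t * ramp q.1) q.2 a := rfl

@[simp] theorem fst_contractOdd :
    (φ.contractOdd t q a).fst = ((ramp q.1 : ℝ) : k) • φ.odd (t * ramp q.1) q.2 a := rfl

@[simp] theorem snd_contractOdd : (φ.contractOdd t q a).snd = 0 := rfl

end

theorem contractOdd_mul (φ : SuperMap L M) (t : unitInterval) (q : ℝ × L.body) (n : ℕ)
    (a : M.fiber (φ.base (t * ramp q.1) q.2)) (ha : a ∈ M.deg _ n)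
    (b : M.fiber (φ.base (t * ramp q.1) q.2)) :
    φ.contractOdd t q (a * b) = φ.contractOdd t q a * φ.contractEven t q b +
      (-1) ^ n * (φ.contractEven t q a * φ.contractOdd t q b) := by
  refine SuperExt.ext ?_ ?_
  · rw [map_add, SuperExt.neg_one_pow_mul_fst, fst_contractOdd, φ.odd_mul _ _ n a ha b]
    simp [smul_add]
  · rw [map_add, SuperExt.neg_one_pow_mul_snd]
    -- The product of the two odd components appears twice in the coefficient of `σ`, once with the
    -- parity of `φ.odd a`. As `φ.odd` lowers the degree by one, the two signs are opposite and the
    -- terms cancel.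
    have h : L.par q.2 (φ.odd (t * ramp q.1) q.2 a) =
        -((-1) ^ n * φ.odd (t * ramp q.1) q.2 a) := by
      cases n with
      | zero => simp [φ.odd_zero _ _ a ha]
      | succ n =>
        rw [parity_of_mem _ (φ.odd_mem _ _ n a ha), pow_succ]
        simp
    simp only [SuperExt.snd_mul, fst_contractOdd, snd_contractOdd, fst_contractEven,
      snd_contractEven, zero_mul, zero_add, mul_zero, add_zero, map_smul, h]
    simp [smul_smul, mul_comm, mul_assoc]

/-- The composition of `φ : T[1][0,1] × L → M` with the map
`T[1][0,1] × T[1]ℝ × L → T[1][0,1] × L` induced by `(t, s) ↦ t * ramp s`. -/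
def contract (φ : SuperMap L M) : SuperMap L.cyl M where
  base t q := φ.base (t * ramp q.1) q.2
  base_smooth := by
    refine contMDiff_prod_lineProd_iff.2 ?_
    have h : ContMDiff ((𝓡∂ 1).prod (𝓘(ℝ, ℝ).prod 𝓘(ℝ, L.E))) ((𝓡∂ 1).prod 𝓘(ℝ, L.E)) ∞
        fun p : unitInterval × (ℝ × L.body) => (p.1 * ramp p.2.1, p.2.2) :=
      (contMDiff_mul_ramp.comp (contMDiff_fst.prodMk (contMDiff_fst.comp contMDiff_snd))).prodMk
        (contMDiff_snd.comp contMDiff_snd)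
    exact φ.base_smooth.comp h
  even := φ.contractEven
  odd := φ.contractOdd
  even_mem t q n a ha := by
    refine ⟨φ.even_mem _ _ n a ha, ?_⟩
    refine Submodule.smul_mem _ _ ?_
    cases n with
    | zero => exact φ.odd_zero _ _ a ha
    | succ n => exact φ.odd_mem _ _ n a ha
  odd_zero t (q : ℝ × L.body) a ha := by
    refine SuperExt.ext (α := L.par q.2) ?_ rfl
    exact (congrArg (((ramp q.1 : ℝ) : k) • ·) (φ.odd_zero _ _ a ha)).trans
      (smul_zero (A := L.fiber q.2) _)
  odd_mem t q n a ha :=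
    ⟨Submodule.smul_mem _ _ (φ.odd_mem _ _ n a ha), zero_mem (shiftDeg (L.deg q.2) n)⟩
  odd_mul t q n a ha b := φ.contractOdd_mul t q n a ha b
  even_smooth σ t (q : ℝ × L.body) h := by
    have h1 : SmoothFamAt ((𝓡∂ 1).prod 𝓘(ℝ, ℝ)) (fun (p : unitInterval × ℝ) y =>
        φ.even (p.1 * ramp p.2) y (σ (φ.base (p.1 * ramp p.2) y))) (t, q.1) q.2 :=
      SmoothFamAt.comp_param (f := fun τ y => φ.even τ y (σ (φ.base τ y))) (t := (t, q.1))
        contMDiff_mul_ramp (φ.even_smooth σ (t * ramp q.1) q.2 h).smoothFamAt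
    have h2 : SmoothFamAt ((𝓡∂ 1).prod 𝓘(ℝ, ℝ)) (fun (p : unitInterval × ℝ) y =>
        φ.odd (p.1 * ramp p.2) y (σ (φ.base (p.1 * ramp p.2) y))) (t, q.1) q.2 :=
      SmoothFamAt.comp_param (f := fun τ y => φ.odd τ y (σ (φ.base τ y))) (t := (t, q.1))
        contMDiff_mul_ramp (φ.odd_smooth σ (t * ramp q.1) q.2 h).smoothFamAt
    refine famSmoothAt_cyl h1 ?_
    refine SmoothFamAt.smul (a := fun p => ((p.1.1 * rampDeriv p.1.2 : ℝ) : k)) ?_ h2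
    exact contMDiff_mul_rampDeriv.comp contMDiff_fst
  odd_smooth σ t (q : ℝ × L.body) h := by
    have h2 : SmoothFamAt ((𝓡∂ 1).prod 𝓘(ℝ, ℝ)) (fun (p : unitInterval × ℝ) y =>
        φ.odd (p.1 * ramp p.2) y (σ (φ.base (p.1 * ramp p.2) y))) (t, q.1) q.2 :=
      SmoothFamAt.comp_param (f := fun τ y => φ.odd τ y (σ (φ.base τ y))) (t := (t, q.1))
        contMDiff_mul_ramp (φ.odd_smooth σ (t * ramp q.1) q.2 h).smoothFamAt
    refine famSmoothAt_cyl ?_ (smoothFamAt_zero _ _ _)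
    refine SmoothFamAt.smul (a := fun p => ((ramp p.1.2 : ℝ) : k)) ?_ h2
    have h3 : ContDiff ℝ ∞ fun p : ℝ => RCLike.ofRealCLM (K := k) (ramp p) :=
      (RCLike.ofRealCLM (K := k)).contDiff.comp contDiff_ramp
    exact h3.contMDiff.comp (contMDiff_snd.comp contMDiff_fst)

end SuperMap

end NManifold

end

/-! ### Compatibility of the contraction with the homological vector fields -/

noncomputable section

namespace NQManifold

open NManifold

variable {k : Type v} [RCLike k]

namespace SuperCurve

variable {L L' M : NQManifold.{u} k}

/-- The odd component of the superfield of a section. -/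
def oddSec (φ : SuperCurve L M) (t : unitInterval) (f : ∀ y, M.fiber y) (x : L.body) : L.fiber x :=
  φ.odd t x (f (φ.base t x))

theorem oddSec_mem (φ : SuperCurve L M) (t : unitInterval) {n : ℕ} {f : ∀ y, M.fiber y}
    (hf : f ∈ M.fn n) : φ.oddSec t f ∈ L.fnShift n := by
  cases n with
  | zero => exact funext fun x => φ.odd_zero t x _ (hf.1 _)
  | succ n => exact (φ.oddPart t n ⟨f, hf⟩).2

/-- Smoothness of the even part provides some derivative in the fibre; the conditions of a
super-curve, tested on functionals, identify it. With `vf` and `oddSec` the case of degree `0` needs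
no separate form. -/
theorem hasFiberDeriv_even (φ : SuperCurve L M) {n : ℕ} {f : ∀ y, M.fiber y} (hf : f ∈ M.fn n)
    (t : unitInterval) (x : L.body) :
    HasFiberDeriv k (fun τ : ℝ => φ.even (projIcc 0 1 zero_le_one τ) x (f (φ.base _ x)))
      (φ.oddSec t (M.vf f) x + L.vf (φ.oddSec t f) x) (Icc 0 1) t := by
  obtain ⟨v, hv⟩ := (φ.even_smooth f t x (hf.2 _)).exists_hasFiberDeriv
  convert hv using 1
  refine (hv.eq_of_forall_dual (uniqueDiffOn_Icc one_pos t t.2) fun l => ?_).symm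
  rw [vf_eq hf]
  cases n with
  | zero =>
    have h0 : φ.oddSec t f = 0 := φ.oddSec_mem t hf
    rw [h0, vf_zero, Pi.zero_apply, add_zero]
    exact φ.deriv_even_zero t ⟨f, hf⟩ x l
  | succ n =>
    rw [vf_eq (φ.oddSec_mem t hf : φ.oddSec t f ∈ L.fn n)]
    exact φ.deriv_even_succ t n ⟨f, hf⟩ x l

theorem vf_even (φ : SuperCurve L M) {n : ℕ} {f : ∀ y, M.fiber y} (hf : f ∈ M.fn n)
    (t : unitInterval) (x : L.body) :
    φ.even t x (M.vf f (φ.base t x)) = L.vf (fun x => φ.even t x (f (φ.base t x))) x := by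
  have h := congrFun (congrArg Subtype.val (φ.even_Q t n ⟨f, hf⟩)) x
  rw [vf_eq hf]
  exact h.trans (congrFun (vf_val (φ.evenPart t n ⟨f, hf⟩)).symm x)

theorem hasFiberDeriv_mul_ramp {V : Type*} [AddCommGroup V] [Module k V] {g : unitInterval → V}
    {v : V} {t : unitInterval} {s : ℝ}
    (h : HasFiberDeriv k (fun τ : ℝ => g (projIcc 0 1 zero_le_one τ)) v (Icc 0 1)
      (t * ramp s : unitInterval)) :
    HasFiberDeriv k (fun s => g (t * ramp s)) (((t * rampDeriv s : ℝ) : k) • v) univ s := by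
  have h1 : HasDerivWithinAt (fun s => (t * ramp s : ℝ)) (t * rampDeriv s) univ s :=
    ((hasDerivAt_ramp s).const_mul _).hasDerivWithinAt
  have h2 := HasFiberDeriv.comp (μ := fun s => (t * ramp s : ℝ)) h h1
    fun r _ => (t * ramp r : unitInterval).2
  have e : ∀ r : ℝ, projIcc (0 : ℝ) 1 zero_le_one (t * ramp r) = t * ramp r := fun r =>
    projIcc_val zero_le_one (t * ramp r : unitInterval)
  simpa only [e] using h2

theorem hasFiberDeriv_mul_left {V : Type*} [AddCommGroup V] [Module k V] {g : unitInterval → V}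
    {v : V} {t r : unitInterval}
    (h : HasFiberDeriv k (fun τ : ℝ => g (projIcc 0 1 zero_le_one τ)) v (Icc 0 1)
      (t * r : unitInterval)) :
    HasFiberDeriv k (fun τ : ℝ => g (projIcc 0 1 zero_le_one τ * r)) (((r : ℝ) : k) • v)
      (Icc 0 1) t := by
  have h1 : HasDerivWithinAt (fun τ : ℝ => τ * r) r (Icc 0 1) (t : ℝ) := by
    simpa using (hasDerivWithinAt_id (t : ℝ) (Icc 0 1)).mul_const (r : ℝ)
  have h2 := HasFiberDeriv.comp (μ := fun τ : ℝ => τ * r) h h1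
    fun τ hτ => (⟨τ, hτ⟩ * r : unitInterval).2
  have e : ∀ τ ∈ Icc (0 : ℝ) 1,
      projIcc (0 : ℝ) 1 zero_le_one τ * r = projIcc (0 : ℝ) 1 zero_le_one (τ * r) := fun τ hτ => by
    rw [projIcc_of_mem _ hτ]
    exact (projIcc_val zero_le_one (⟨τ, hτ⟩ * r : unitInterval)).symm
  refine h2.congr ?_ (congrArg g (e t t.2))
  filter_upwards [self_mem_nhdsWithin] with τ hτ
  rw [e τ hτ]

theorem hasFiberDeriv_mk {A : Type*} [Ring A] [Algebra k A] (α : A →ₐ[k] A) {f g : ℝ → A} {v w : A}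
    {S : Set ℝ} {s : ℝ} (hf : HasFiberDeriv k f v S s) (hg : HasFiberDeriv k g w S s) :
    HasFiberDeriv k (fun s => SuperExt.mk α (f s) (g s)) (SuperExt.mk α v w) S s := by
  let i : A →ₗ[k] SuperExt α := LinearMap.inl k A A
  let j : A →ₗ[k] SuperExt α := LinearMap.inr k A A
  have h : ∀ a b, SuperExt.mk α a b = i a + j b := fun a b => SuperExt.ext
    (by change a = a + 0; rw [add_zero]) (by change b = 0 + b; rw [zero_add])
  simp only [h]
  exact (hf.map i).add (hg.map j)

/-- The component of `σ` rests on the identity `∂_t (t r'(s) φ_1(t r(s))) = ∂_s (r(s) φ_1(t r(s)))`: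
both sides are `r' φ_1 + t r r' φ_1'`. Written as a derivative in `s`, it is the term that `Q` of
`T[1]ℝ × L` produces from the odd part of the contraction. -/
theorem hasFiberDeriv_contractEven (φ : SuperCurve L M) {n : ℕ} {f : ∀ y, M.fiber y}
    (hf : f ∈ M.fn n) (t : unitInterval) (q : ℝ × L.body) :
    HasFiberDeriv k
      (fun τ : ℝ => φ.contractEven (projIcc 0 1 zero_le_one τ) q (f (φ.base _ q.2)))
      (SuperExt.mk (L.par q.2)
        (((ramp q.1 : ℝ) : k) •
          (φ.oddSec (t * ramp q.1) (M.vf f) q.2 + L.vf (φ.oddSec (t * ramp q.1) f) q.2))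
        (fiberDeriv (fun s x => ((ramp s : ℝ) : k) • φ.oddSec (t * ramp s) f x) q.1 q.2))
      (Icc 0 1) t := by
  have h1 := hasFiberDeriv_mul_left (g := fun τ => φ.even τ q.2 (f (φ.base τ q.2)))
    (φ.hasFiberDeriv_even hf (t * ramp q.1) q.2)
  obtain ⟨w, hw⟩ := (φ.odd_smooth f (t * ramp q.1) q.2 (hf.2 _)).exists_hasFiberDeriv
  have h2 := hasFiberDeriv_mul_left (g := fun τ => φ.odd τ q.2 (f (φ.base τ q.2))) hw
  have h3 := hasFiberDeriv_mul_ramp (g := fun τ => φ.odd τ q.2 (f (φ.base τ q.2))) hw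
  have d1 : HasDerivWithinAt (fun τ : ℝ => ((τ * rampDeriv q.1 : ℝ) : k)) ((rampDeriv q.1 : ℝ) : k)
      (Icc 0 1) (t : ℝ) := by
    have := (RCLike.ofRealCLM (K := k)).hasFDerivAt.comp_hasDerivWithinAt (t : ℝ)
      ((hasDerivWithinAt_id (t : ℝ) (Icc 0 1)).mul_const (rampDeriv q.1))
    rw [one_mul] at this
    exact this
  have d2 : HasDerivWithinAt (fun s : ℝ => ((ramp s : ℝ) : k)) ((rampDeriv q.1 : ℝ) : k)
      univ q.1 := by
    have := (RCLike.ofRealCLM (K := k)).hasFDerivAt.comp_hasDerivWithinAt q.1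
      ((hasDerivAt_ramp q.1).hasDerivWithinAt (s := univ))
    exact this
  have h4 := HasFiberDeriv.smul d1 h2
  have h5 := (HasFiberDeriv.smul d2 h3).fiberDeriv_eq
    (f := fun s x => ((ramp s : ℝ) : k) • φ.oddSec (t * ramp s) f x)
  rw [h5]
  have h6 := hasFiberDeriv_mk (L.par q.2) h1 h4
  rw [projIcc_val, smul_comm] at h6
  have e : ∀ τ ∈ Icc (0 : ℝ) 1, ((projIcc (0 : ℝ) 1 zero_le_one τ : ℝ) * rampDeriv q.1 : ℝ) =
      τ * rampDeriv q.1 := fun τ hτ => by rw [projIcc_of_mem _ hτ]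
  have e2 : ∀ τ ∈ Icc (0 : ℝ) 1,
      φ.contractEven (projIcc 0 1 zero_le_one τ) q (f (φ.base _ q.2)) =
      SuperExt.mk (L.par q.2)
        (φ.even (projIcc 0 1 zero_le_one τ * ramp q.1) q.2 (f (φ.base _ q.2)))
        (((τ * rampDeriv q.1 : ℝ) : k) •
          φ.odd (projIcc 0 1 zero_le_one τ * ramp q.1) q.2 (f (φ.base _ q.2))) := fun τ hτ => by
    rw [← e τ hτ]
    rfl
  exact h6.congr (eventually_nhdsWithin_of_forall e2) (e2 t t.2)

/-- The contraction of a super-curve to its initial point. -/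
def contract (φ : SuperCurve L M) : SuperCurve L.cyl M where
  toSuperMap := φ.toSuperMap.contract
  even_Q t n f := by
    refine Subtype.ext (funext fun (q : ℝ × L.body) => SuperExt.ext (α := L.par q.2) ?_ ?_)
    · have h := φ.vf_even f.2 (t * ramp q.1) q.2
      rw [vf_val] at h
      exact h
    -- The component of `σ` of `Q` applied to the even part is `∂_s` of `φ_0 f` minus `Q` of `t r'
    -- φ_1 f`. The first is `t r' (φ_1 (Q f) + Q (φ_1 f))`, so `t r' φ_1 (Q f)` remains.
    · have h := (hasFiberDeriv_mul_ramp
        (g := fun τ => φ.even τ q.2 (f.1 (φ.base τ q.2)))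
        (φ.hasFiberDeriv_even f.2 (t * ramp q.1) q.2)).fiberDeriv_eq
        (f := fun s x => φ.even (t * ramp s) x (f.1 (φ.base _ x)))
      have h2 := congrFun (vf_smul_of_shift ((t * rampDeriv q.1 : ℝ) : k)
        (φ.oddSec_mem (t * ramp q.1) f.2)) q.2
      rw [vf_val] at h
      refine Eq.trans ?_ (congrArg₂ (· - ·) h h2).symm
      rw [Pi.smul_apply, smul_add, add_sub_cancel_right]
      rfl
  deriv_even_zero t f := by
    intro (q : ℝ × L.body) l
    have h0 : ∀ t, φ.oddSec t f.1 = 0 := fun t => φ.oddSec_mem t f.2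
    have h := (φ.hasFiberDeriv_contractEven f.2 t q).hasDerivWithinAt l
    refine h.congr_deriv (congrArg l (SuperExt.ext (α := L.par q.2) ?_ ?_))
    · rw [SuperExt.fst_mk, h0, vf_zero, vf_val, Pi.zero_apply, add_zero]
      rfl
    · rw [SuperExt.snd_mk]
      simp only [h0, Pi.zero_apply, smul_zero]
      exact (hasFiberDeriv_const _ _ _).fiberDeriv_eq
  deriv_even_succ t n f := by
    intro (q : ℝ × L.body) l
    have h := (φ.hasFiberDeriv_contractEven f.2 t q).hasDerivWithinAt l
    refine h.congr_deriv (congrArg l (SuperExt.ext (α := L.par q.2) ?_ ?_))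
    · have h2 := congrFun (vf_smul_of_shift ((ramp q.1 : ℝ) : k)
        (φ.oddSec_mem (t * ramp q.1) f.2)) q.2
      rw [SuperExt.fst_mk, smul_add, vf_val]
      exact congrArg (fun z : L.fiber q.2 => _ + z) h2.symm
    -- The odd part of the contraction has no component of `σ`. Hence the odd part of `Q f`
    -- contributes nothing here, and `Q` of the odd part of `f` contributes only its derivative in
    -- `s`.
    · have h3 := congrFun (vf_zero (L := L)) q.2
      refine Eq.trans ?_ (zero_add _).symm
      exact ((congrArg (fun z : L.fiber q.2 => _ - z) h3).trans (sub_zero _)).symm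

end SuperCurve

end NQManifold

end

/-! ### Naturality and end points of the contraction -/

noncomputable section

namespace NManifold

variable {k : Type v} [RCLike k] {L M : NManifold.{u} k}

theorem SuperMap.ext_of_heq {φ ψ : SuperMap L M} (hb : φ.base = ψ.base) (he : HEq φ.even ψ.even)
    (ho : HEq φ.odd ψ.odd) : φ = ψ := by
  cases φ
  cases ψ
  subst hb
  cases he
  cases ho
  rfl

end NManifold

namespace NQManifold

open NManifold

variable {k : Type v} [RCLike k] {L L' M : NQManifold.{u} k}

namespace SuperCurve

theorem toSuperMap_injective :
    Function.Injective (toSuperMap : SuperCurve L M → SuperMap L.toNManifold M.toNManifold) := by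
  rintro ⟨φ, _, _, _⟩ ⟨ψ, _, _, _⟩ rfl
  rfl

/-- The contraction acts on `T[1][0,1]` and the change of test manifold on `L`, so they commute;
only the linearity of `g.pull` enters. This makes the homotopy operator natural. -/
theorem contract_comp (φ : SuperCurve L M) (g : Hom L' L) :
    (φ.comp g).contract = φ.contract.comp g.cyl := by
  refine toSuperMap_injective (SuperMap.ext_of_heq rfl (heq_of_eq ?_) (heq_of_eq ?_))
  · funext t q
    refine AlgHom.ext fun a => ?_
    let p : ℝ × L'.body := q
    exact SuperExt.ext (α := L'.par p.2) rfl (map_smul (g.pull p.2) _ _).symm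
  · funext t q
    refine LinearMap.ext fun a => ?_
    let p : ℝ × L'.body := q
    exact SuperExt.ext (α := L'.par p.2) (map_smul (g.pull p.2) _ _).symm
      (map_zero (g.pull p.2)).symm

theorem contract_comp_atTime_one (φ : SuperCurve L M) : φ.contract.comp (atTime L 1) = φ := by
  have hν : (fun t : unitInterval => t * ramp 1) = id := by
    funext t
    rw [ramp_one, mul_one, id]
  refine toSuperMap_injective (SuperMap.ext_of_heq ?_ ?_ ?_)
  · exact congrArg (fun ν : unitInterval → unitInterval => fun t => φ.base (ν t)) hν
  -- The fibres depend on the reparametrised time. It is therefore generalised to a variable `ν`,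
  -- for which the equation with `id` can be substituted.
  · have h : ∀ ν : unitInterval → unitInterval, ν = id →
        HEq (fun t x => φ.even (ν t) x) φ.even := by
      rintro _ rfl
      rfl
    exact h _ hν
  · have h : ∀ (ν : unitInterval → unitInterval) (r : k), ν = id → r = 1 →
        HEq (fun t x => r • φ.odd (ν t) x) φ.odd := by
      rintro _ _ rfl rfl
      simp only [one_smul]
      rfl
    exact h _ ((ramp 1 : ℝ) : k) hν (by simp [ramp_one])

/-- Since `ramp 0 = 0`, every time is sent to `0`, and the odd part, which carries the factor `ramp
0`, disappears. -/
theorem contract_comp_atTime_zero (φ : SuperCurve L M) :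
    φ.contract.comp (atTime L 0) = (const M).comp φ.initial := by
  have hν : (fun t : unitInterval => t * ramp 0) = fun _ => 0 := by
    funext t
    rw [ramp_zero, mul_zero]
  refine toSuperMap_injective (SuperMap.ext_of_heq ?_ ?_ ?_)
  · exact congrArg (fun ν : unitInterval → unitInterval => fun t => φ.base (ν t)) hν
  · have h : ∀ ν : unitInterval → unitInterval, ν = (fun _ => 0) →
        HEq (fun t x => φ.even (ν t) x) (fun (_ : unitInterval) x => φ.even 0 x) := by
      rintro _ rfl
      rfl
    exact h _ hν
  · have h : ∀ (ν : unitInterval → unitInterval) (r : k), ν = (fun _ => 0) → r = 0 →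
        HEq (fun t x => r • φ.odd (ν t) x)
          (fun (_ : unitInterval) x => (0 : M.fiber (φ.base 0 x) →ₗ[k] L.fiber x)) := by
      rintro _ _ rfl rfl
      simp only [zero_smul]
      rfl
    refine (h _ ((ramp 0 : ℝ) : k) hν (by simp [ramp_zero])).trans (heq_of_eq ?_)
    funext t x
    exact LinearMap.ext fun a => (map_zero (φ.even 0 x)).symm

end SuperCurve

/-! ### The homotopy operator -/

variable {n : ℕ}

variable (L) in
/-- `G` is the primitive, vanishing at time `0`, of a family with a cut-off. -/
structure IsPrimitive (g G : ℝ → ∀ x, L.fiber x) : Prop where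
  zero : ∀ x, G 0 x = 0
  hasFiberDeriv : ∀ s x, HasFiberDeriv k (fun τ => G τ x) ((unitCutoff s : k) • g s x) univ s

/-- Frees the fibre integral from the choice of a primitive; together with `IsPrimitive.pull` it
yields naturality in `L`. -/
theorem IsPrimitive.unique {g G G' : ℝ → ∀ x, L.fiber x} (h : L.IsPrimitive g G)
    (h' : L.IsPrimitive g G') (s : ℝ) (x : L.body) : G s x = G' s x := by
  have := eq_of_hasFiberDeriv_eq convex_univ (fun s _ => h.hasFiberDeriv s x)
    (fun s _ => h'.hasFiberDeriv s x) (mem_univ 0) (mem_univ s)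
  rw [h.zero, h'.zero, sub_self, sub_eq_zero] at this
  exact this

theorem IsPrimitive.pull {g G : ℝ → ∀ x, L.fiber x} (h : L.IsPrimitive g G) (a : Hom L' L) :
    L'.IsPrimitive (fun s x => a.pull x (g s (a.base x))) (fun s x => a.pull x (G s (a.base x))) where
  zero x := by rw [h.zero, map_zero]
  hasFiberDeriv s x := by
    have := (h.hasFiberDeriv s (a.base x)).map (a.pull x).toLinearMap
    simpa using this

theorem exists_isPrimitive (f : L.cyl.fn (n + 1)) : ∃ G : ℝ → ∀ x, L.fiber x,
    ((∀ s x, SmoothFamAt 𝓘(ℝ, ℝ) G s x) ∧ ∀ s x, G s x ∈ L.deg x n) ∧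
      L.IsPrimitive (cylSnd f.1) G := by
  obtain ⟨-, h3, h4⟩ := mem_fn_cyl.1 f.2
  obtain ⟨G, h5, h6, h7, h8⟩ := exists_primitive h3 h4
  exact ⟨G, ⟨h5, h6⟩, h7, h8⟩

/-- The integral over the fibres of `T[1][0,1] × L → L`. -/
def fiberIntegral (f : L.cyl.fn (n + 1)) : L.fn n :=
  ⟨(exists_isPrimitive f).choose 1,
    smoothFamAt_mem_fn (exists_isPrimitive f).choose_spec.1.1
      (exists_isPrimitive f).choose_spec.1.2 1⟩

theorem fiberIntegral_val {f : L.cyl.fn (n + 1)} {G : ℝ → ∀ x, L.fiber x}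
    (h : L.IsPrimitive (cylSnd f.1) G) : (fiberIntegral f).1 = G 1 :=
  funext fun x => (exists_isPrimitive f).choose_spec.2.unique h 1 x

theorem fiberIntegral_map (g : Hom L' L) (f : L.cyl.fn (n + 1)) :
    fiberIntegral (g.cyl.toHom.map (n + 1) f) = g.toHom.map n (fiberIntegral f) := by
  obtain ⟨G, -, hG⟩ := exists_isPrimitive f
  refine Subtype.ext ((fiberIntegral_val (hG.pull g)).trans ?_)
  funext x
  exact (congrArg (fun F => g.pull x (F (g.base x))) (fiberIntegral_val hG)).symm

/-- If `(α + σ β)` is closed, the derivative of `α` is `Q β`. -/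
theorem fiberDeriv_cylFst_of_closed {f : L.cyl.fn n} (hf : L.cyl.Q n f = 0) (s : ℝ) (x : L.body) :
    fiberDeriv (cylFst f.1) s x = L.vf (cylSnd f.1 s) x := by
  have h := congrFun (congrArg Subtype.val hf) (s, x)
  exact sub_eq_zero.1 (congrArg (SuperExt.snd (α := L.par x)) h)

theorem _root_.HasFiberDeriv.mono {V : Type*} [AddCommGroup V] [Module k V] {f : ℝ → V} {v : V}
    {S T : Set ℝ} {s : ℝ} (h : HasFiberDeriv k f v S s) (hT : T ⊆ S) : HasFiberDeriv k f v T s := by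
  obtain ⟨ι, _, a, a', m, ha, h1, h2, rfl⟩ := h
  exact ⟨ι, inferInstance, a, a', m, fun i => (ha i).mono hT,
    h1.filter_mono (nhdsWithin_mono s hT), h2, rfl⟩

/-- Stokes' formula. -/
theorem Q_fiberIntegral {f : L.cyl.fn (n + 1)} (hf : L.cyl.Q (n + 1) f = 0) :
    L.Q n (fiberIntegral f) =
      (atTime L 1).toHom.map (n + 1) f - (atTime L 0).toHom.map (n + 1) f := by
  obtain ⟨G, ⟨h1, h2⟩, hG⟩ := exists_isPrimitive f
  obtain ⟨⟨h3, -⟩, h5, h6⟩ := mem_fn_cyl.1 f.2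
  refine Subtype.ext (funext fun x => ?_)
  rw [← vf_val, fiberIntegral_val hG]
  change L.vf (G 1) x = cylFst f.1 1 x - cylFst f.1 0 x
  -- On `[0,1]` the cut-off is `1`, so `∂_s Q G = Q ∂_s G = Q β = ∂_s α`. Thus `Q G` and `α` differ
  -- by a constant, and `Q (G 0) = 0` determines it.
  have hG' : ∀ s ∈ Icc (0 : ℝ) 1,
      HasFiberDeriv k (fun τ => L.vf (G τ) x) (fiberDeriv (cylFst f.1) s x) (Icc 0 1) s := by
    intro s hs
    have h := (hasFiberDeriv_vf h1 h2 s x).mono (subset_univ (Icc 0 1))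
    convert h using 1
    have e : fiberDeriv G s = cylSnd f.1 s := by
      funext y
      rw [(hG.hasFiberDeriv s y).fiberDeriv_eq, unitCutoff_eq_one hs, RCLike.ofReal_one, one_smul]
    rw [e, fiberDeriv_cylFst_of_closed hf]
  have hα : ∀ s ∈ Icc (0 : ℝ) 1,
      HasFiberDeriv k (fun τ => cylFst f.1 τ x) (fiberDeriv (cylFst f.1) s x) (Icc 0 1) s :=
    fun s _ => (h3 s x).hasFiberDeriv.mono (subset_univ _)
  have h := eq_of_hasFiberDeriv_eq (convex_Icc 0 1) hG' hα (left_mem_Icc.2 zero_le_one)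
    (right_mem_Icc.2 zero_le_one)
  have h0 : L.vf (G 0) = 0 := by
    rw [show G 0 = 0 from funext hG.zero, vf_zero]
  rw [h0, Pi.zero_apply, zero_sub] at h
  exact (sub_eq_iff_eq_add.1 h).trans (neg_add_eq_sub _ _)

/-- In degree `0` closed functions are constant in time. -/
theorem map_atTime_eq_of_closed {f : L.cyl.fn 0} (hf : L.cyl.Q 0 f = 0) :
    (atTime L 1).toHom.map 0 f = (atTime L 0).toHom.map 0 f := by
  obtain ⟨⟨h3, -⟩, h5, h6⟩ := mem_fn_cyl.1 f.2
  refine Subtype.ext (funext fun x => ?_)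
  change cylFst f.1 1 x = cylFst f.1 0 x
  have hα : ∀ s ∈ (univ : Set ℝ), HasFiberDeriv k (fun τ => cylFst f.1 τ x) 0 univ s := by
    intro s _
    have h := (h3 s x).hasFiberDeriv
    rw [fiberDeriv_cylFst_of_closed hf, show cylSnd f.1 s = 0 from funext (h6 s), vf_zero] at h
    exact h
  have h := eq_of_hasFiberDeriv_eq convex_univ hα
    (fun s _ => hasFiberDeriv_const 0 univ s) (mem_univ 0) (mem_univ 1)
  simpa using h

/-! ### The homotopy on functions on the space of super-curves -/

variable (M) in
/-- The contraction of `S̄` to the constant super-curves. -/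
def homotopy (χ : M.curveFn (n + 1)) : M.curveFn n :=
  ⟨fun L φ => fiberIntegral (χ.1 L.cyl φ.contract), fun L L' g φ => by
    have h := (congrArg (χ.1 L'.cyl) (φ.contract_comp g)).trans (χ.2 _ _ g.cyl φ.contract)
    exact (congrArg fiberIntegral h).trans (fiberIntegral_map g _)⟩

/-- Naturality of `χ` along the inclusion at time `1` moves the restriction from the function to the
super-curve. -/
theorem map_atTime_one_contract (χ : M.curveFn n) (φ : SuperCurve L M) :
    (atTime L 1).toHom.map n (χ.1 L.cyl φ.contract) = χ.1 L φ := by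
  rw [← χ.2, φ.contract_comp_atTime_one]

theorem map_atTime_zero_contract (χ : M.curveFn n) (φ : SuperCurve L M) :
    (atTime L 0).toHom.map n (χ.1 L.cyl φ.contract) =
      (M.initialPull n (M.constPull n χ)).1 L φ := by
  rw [← χ.2, φ.contract_comp_atTime_zero]
  exact χ.2 M L φ.initial (SuperCurve.const M)

theorem closed_apply {χ : M.curveFn n} (hχ : M.deltaB n χ = 0) (φ : SuperCurve L M) :
    L.Q n (χ.1 L φ) = 0 :=
  congrArg (fun η : M.curveFn (n + 1) => η.1 L φ) hχ

/-- Stokes' formula for `χ` on the contraction, with the two end points identified. In degree `0`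
the only coboundary is `0`, and equality follows from constancy in time. -/
theorem sub_initialPull_constPull_mem_coboundaries {χ : M.curveFn n} (hχ : M.deltaB n χ = 0) :
    χ - M.initialPull n (M.constPull n χ) ∈
      coboundaries (C := fun n => M.curveFn n) M.deltaB n := by
  cases n with
  | zero =>
    refine (sub_eq_zero (a := χ)).2 (Subtype.ext (funext fun L => funext fun φ => ?_))
    rw [← map_atTime_one_contract, ← map_atTime_zero_contract,
      map_atTime_eq_of_closed (closed_apply hχ _)]
  | succ n =>
    refine ⟨M.homotopy χ, Subtype.ext (funext fun L => funext fun φ => ?_)⟩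
    refine (Q_fiberIntegral (closed_apply hχ φ.contract)).trans ?_
    rw [map_atTime_one_contract, map_atTime_zero_contract]
    rfl

theorem initialPull_mem_coboundaries {f : M.fn n}
    (hf : f ∈ coboundaries (C := fun n => M.fn n) M.Q n) :
    M.initialPull n f ∈ coboundaries (C := fun n => M.curveFn n) M.deltaB n := by
  cases n with
  | zero =>
    rw [(hf : f = 0), map_zero]
    exact zero_mem _
  | succ n =>
    obtain ⟨g, rfl⟩ := hf
    exact ⟨M.initialPull n g, Subtype.ext (funext fun L => funext fun φ =>
      (φ.initial.map_Q n g).symm)⟩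

theorem constPull_mem_coboundaries {χ : M.curveFn n}
    (hχ : χ ∈ coboundaries (C := fun n => M.curveFn n) M.deltaB n) :
    M.constPull n χ ∈ coboundaries (C := fun n => M.fn n) M.Q n := by
  cases n with
  | zero =>
    rw [(hχ : χ = 0), map_zero]
    exact zero_mem _
  | succ n =>
    obtain ⟨η, rfl⟩ := hχ
    exact ⟨M.constPull n η, rfl⟩

end NQManifold

/-! ### Maps induced on cohomology, and the isomorphism -/

section CohomologyMap

variable {k : Type v} [Ring k] {C D : ℕ → Type*} [∀ n, AddCommGroup (C n)] [∀ n, Module k (C n)]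
  [∀ n, AddCommGroup (D n)] [∀ n, Module k (D n)] {d : ∀ n, C n →ₗ[k] C (n + 1)}
  {δ : ∀ n, D n →ₗ[k] D (n + 1)} {n : ℕ}

/-- The map on cohomology induced by a linear map that preserves cocycles and coboundaries. -/
def cohomologyMap (T : C n →ₗ[k] D n) (h : ∀ z, d n z = 0 → δ n (T z) = 0)
    (h' : ∀ z ∈ coboundaries d n, T z ∈ coboundaries δ n) : Cohomology d n →ₗ[k] Cohomology δ n :=
  Submodule.mapQ _ _ (T.restrict (p := LinearMap.ker (d n)) (q := LinearMap.ker (δ n)) h)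
    fun z hz => h' z.1 hz

theorem cohomologyClass_surjective (c : Cohomology d n) :
    ∃ (z : C n) (hz : d n z = 0), cohomologyClass d z hz = c := by
  obtain ⟨z, rfl⟩ := Submodule.Quotient.mk_surjective _ c
  exact ⟨z.1, z.2, rfl⟩

theorem cohomologyClass_eq {z z' : C n} (hz : d n z = 0) (hz' : d n z' = 0)
    (h : z - z' ∈ coboundaries d n) : cohomologyClass d z hz = cohomologyClass d z' hz' :=
  (Submodule.Quotient.eq _).2 h

end CohomologyMap

namespace NQManifold

variable {k : Type v} [RCLike k]

/-- The isomorphism between the cohomology of `M` and of the space of super-curves in `M`. -/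
def cohomologyEquiv (M : NQManifold.{u} k) (n : ℕ) : M.HQ n ≃ₗ[k] M.HdeltaB n :=
  LinearEquiv.ofLinearMap
    (cohomologyMap (C := fun n => M.fn n) (D := fun n => M.curveFn n) (M.initialPull n)
      (fun _ h => M.deltaB_initialPull h) fun _ h => initialPull_mem_coboundaries h)
    (cohomologyMap (C := fun n => M.curveFn n) (D := fun n => M.fn n) (M.constPull n)
      (fun _ h => M.Q_constPull h) fun _ h => constPull_mem_coboundaries h)
    (LinearMap.ext fun c => by
      obtain ⟨χ, hχ, rfl⟩ := cohomologyClass_surjective (C := fun n => M.curveFn n) c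
      refine Eq.symm ?_
      exact cohomologyClass_eq (C := fun n => M.curveFn n) _ _
        (sub_initialPull_constPull_mem_coboundaries hχ))
    (LinearMap.ext fun c => by
      obtain ⟨f, hf, rfl⟩ := cohomologyClass_surjective (C := fun n => M.fn n) c
      -- The constant super-curve at a point of `M` has that point as its initial point, so
      -- `constPull` undoes `initialPull` by definition.
      rfl)

end NQManifold

end

/-- The `δ_B`-cohomology of the space of super-curves in an NQ-manifold `M` is the `Q`-cohomology
of `M`; the isomorphism is induced by the initial point of super-curves, and its inverse by
the inclusion of constant super-curves. -/
theorem mainTheorem7 {k : Type v} [RCLike k] (M : NQManifold.{u} k) :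
    ∃ e : ∀ n : ℕ, M.HQ n ≃ₗ[k] M.HdeltaB n,
      (∀ (n : ℕ) (f : M.fn n) (hf : M.Q n f = 0),
        e n (M.classQ f hf) = M.classDeltaB (M.initialPull n f) (M.deltaB_initialPull hf)) ∧
      ∀ (n : ℕ) (χ : M.curveFn n) (hχ : M.deltaB n χ = 0),
        (e n).symm (M.classDeltaB χ hχ) = M.classQ (M.constPull n χ) (M.Q_constPull hχ) :=
  ⟨M.cohomologyEquiv, fun _ _ _ => rfl, fun _ _ _ => rfl⟩
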